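/- Let $(\Omega,\mathcal A,\mathbb P)$ be a complete probability space, $S$ a topological space with Borel $\sigma$-field $\mathcal B(S)$, $\pi$ a probability measure on $S$, $\lambda$ Lebesgue measure, and call a Borel set $B\subseteq S\times\mathbb R$ bounded if $B\subseteq S\times[-n,n]$ for some $n$. Let $\Lambda=\{\Lambda(B)\}$ be a real-valued Lévy basis on $S\times\mathbb R$, i.e. a family of infinitely divisible random variables indexed by the bounded Borel sets, independent over pairwise disjoint sets and almost surely $\sigma$-additive, with generating quadruple $(\gamma,0,\nu,\pi)$, i.e. $\mathbb E[e^{iu\Lambda(B)}]=\exp\bigl((\pi\otimes\lambda)(B)\,\Phi(u)\bigr)$ with $\Phi(u)=i\gamma u+\int_{\mathbb R}\bigl(e^{iux}-1-iux\mathbf 1_{\{|x|\le1\}}\bigr)\,\nu(dx)$ and $\nu$ a Lévy measure. Let $W=(W_t)_{t\in\mathbb R}$ be a standard Brownian motion independent of $\Lambda$, and let $(\mathcal A_t)_{t\in\mathbb R}$ be the ($\mathbb P$-completed) filtration generated by $\{\Lambda(B):B\subseteq S\times(-\infty,t]\text{ bounded Borel}\}$ and $\{W_u-W_s:s\le u\le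 t\}$. Assume (H): 1. $\int_{\mathbb R}|x|\,\nu(dx)<\infty$, $\gamma_0:=\gamma-\int_{|x|\le1}x\,\nu(dx)\ge0$ and $\nu((-\infty,0))=0$; 2. the kernel $f:S\times\mathbb R^+\to\mathbb R$ is Borel measurable, non-negative, and satisfies $\int_S\int_0^\infty|f(A,s)\gamma_0|\,ds\,\pi(dA)<\infty$ and $\int_S\int_0^\infty\int_{\mathbb R}(1\wedge|f(A,s)x|)\,\nu(dx)\,ds\,\pi(dA)<\infty$; 3. $X=(X_s)_{s\in\mathbb R}$ is an adapted càdlàg process with $X_s=\int_S\int_{-\infty}^s f(A,s-u)\,\Lambda(dA,du)$ almost surely for every $s\in\mathbb R$, the integral being the limit in probability of integrals of simple functions (in the sense of Rajput and Rosiński). Assume moreover that $f\in L^1(S\times\mathbb R^+,\pi\otimes\lambda)$, and put, for $r\ge0$, $$\theta_X(r)=\int_S\int_{-\infty}^{-r}\int_{\mathbb R}|f(A,-s)x|\,\nu(dx)\,ds\,\pi(dA)+\int_S\int_{-\infty}^{-r}|f(A,-s)\gamma_0|\,ds\,\pi(dA).$$ Let $\Delta>0$. Then for every $t\in\mathbb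 R$ the Itô integral $$Y_t=\int_{(t-1)\Delta}^{t\Delta}\sqrt{X_s}\,dW_s$$ is well defined as an $L^2$-limit of integrals of simple adapted processes, and the return process $Y=(Y_t)_{t\in\mathbb R}$ (for any choice of versions of the $Y_t$) is $\theta$-weakly dependent with coefficients $\theta_Y$ such that $$\theta_Y(r)=\sqrt{\Delta\,\theta_X((r-1)\Delta)}\qquad\text{for all } r\ge1 .$$ Here a process $Y$ is $\theta$-weakly dependent with coefficients $(\theta_Y(r))_{r\ge0}$ if $\theta_Y(r)\to0$ as $r\to\infty$ and there is a constant $c$ such that $$|\mathrm{Cov}(F(Y_{i_1},\dots,Y_{i_u}),G(Y_{j_1},\dots,Y_{j_v}))|\le c\,v\,\mathrm{Lip}(G)\,\|F\|_\infty\,\theta_Y(r)$$ for all $u,v\ge1$, all real $r\ge0$, all real $i_1\le\dots\le i_u\le i_u+r\le j_1\le\dots\le j_v$, all measurable $F:\mathbb R^u\to\mathbb R$ with $\|F\|_\infty\le1$ and all $G:\mathbb R^v\to\mathbb R$ with $\|G\|_\infty\le1$ and $\mathrm{Lip}(G)=\sup_{x\ne y}\frac{|G(x)-G(y)|}{\sum_{k=1}^v|x_k-y_k|}<\infty$.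 -/

import Mathlib

open MeasureTheory ProbabilityTheory Filter Topology Set
open scoped ENNReal NNReal

namespace MMASV

noncomputable section

/-! ### Lévy bases -/

/-- The bounded Borel sets of `S × ℝ`: Borel sets contained in some `S × [-n, n]`. -/
def BoundedBorel (S : Type*) [MeasurableSpace S] : Set (Set (S × ℝ)) :=
  {B | MeasurableSet B ∧ ∃ n : ℝ, B ⊆ univ ×ˢ Icc (-n) n}

/-- A probability law on `ℝ` is infinitely divisible if, for every `n ≥ 1`, it is the law of a sum
of `n` independent and identically distributed random variables. -/
def IsInfinitelyDivisible (μ : Measure ℝ) : Prop :=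
  ∀ n : ℕ, 0 < n → ∃ ρ : Measure ℝ, IsProbabilityMeasure ρ ∧
    μ = (Measure.pi (fun _ : Fin n => ρ)).map (fun x => ∑ i, x i)

/-- A real-valued Lévy basis on `S × ℝ` (only the values `Λ B` at bounded Borel sets `B` matter). -/
structure IsLevyBasis {S Ω : Type*} [MeasurableSpace S] [MeasurableSpace Ω]
    (P : Measure Ω) (Λ : Set (S × ℝ) → Ω → ℝ) : Prop where
  measurable : ∀ B ∈ BoundedBorel S, Measurable (Λ B)
  infinitelyDivisible : ∀ B ∈ BoundedBorel S, IsInfinitelyDivisible (P.map (Λ B))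
  indep : ∀ (n : ℕ) (B : Fin n → Set (S × ℝ)), (∀ i, B i ∈ BoundedBorel S) →
    Pairwise (fun i j => Disjoint (B i) (B j)) → iIndepFun (fun i => Λ (B i)) P
  sigmaAdditive : ∀ B : ℕ → Set (S × ℝ), (∀ k, B k ∈ BoundedBorel S) →
    Pairwise (fun i j => Disjoint (B i) (B j)) → (⋃ k, B k) ∈ BoundedBorel S →
    ∀ᵐ ω ∂P, Tendsto (fun n => ∑ k ∈ Finset.range n, Λ (B k) ω) atTop (𝓝 (Λ (⋃ k, B k) ω))

/-- A Lévy measure on `ℝ`. -/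
def IsLevyMeasure (ν : Measure ℝ) : Prop :=
  ν {0} = 0 ∧ ∫⁻ x, ENNReal.ofReal (min (x ^ 2) 1) ∂ν < ∞

/-- The cumulant transform of the infinitely divisible law with characteristic triplet
`(γ, Σ, ν)`. -/
def cumulant (γ sig : ℝ) (ν : Measure ℝ) (u : ℝ) : ℂ :=
  Complex.I * γ * u - (1 / 2 : ℂ) * sig * u ^ 2
    + ∫ x : ℝ, (Complex.exp (Complex.I * u * x) - 1
        - Complex.I * u * x * (if |x| ≤ 1 then 1 else 0)) ∂ν

/-- The Lévy basis `Λ` is homogeneous and factorisable with generating quadruple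
`(γ, Σ, ν, π)`: its characteristic function is `exp (Φ(u) (π ⊗ λ)(B))`. -/
structure HasGeneratingQuadruple {S Ω : Type*} [MeasurableSpace S] [MeasurableSpace Ω]
    (P : Measure Ω) (Λ : Set (S × ℝ) → Ω → ℝ)
    (γ sig : ℝ) (ν : Measure ℝ) (π : Measure S) : Prop where
  sig_nonneg : 0 ≤ sig
  levyMeasure : IsLevyMeasure ν
  charFun_eq : ∀ B ∈ BoundedBorel S, ∀ u : ℝ,
    ∫ ω, Complex.exp (Complex.I * u * Λ B ω) ∂P
      = Complex.exp (cumulant γ sig ν u * ((π.prod volume) B).toReal)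

/-- The drift `γ₀ = γ - ∫_{|x| ≤ 1} x ν(dx)`. -/
def drift (γ : ℝ) (ν : Measure ℝ) : ℝ := γ - ∫ x in {x : ℝ | |x| ≤ 1}, x ∂ν

/-! ### Integration with respect to a Lévy basis, as a limit in probability -/

/-- The integral `∫_A φ dΛ = ∑_y y Λ(A ∩ {φ = y})` of a simple function `φ`. -/
def simpleIntegral {S Ω : Type*} [MeasurableSpace S]
    (Λ : Set (S × ℝ) → Ω → ℝ) (φ : SimpleFunc (S × ℝ) ℝ) (A : Set (S × ℝ)) (ω : Ω) : ℝ :=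
  ∑ y ∈ φ.range, y * Λ (A ∩ φ ⁻¹' {y}) ω

/-- `I` is (a version of) the stochastic integral `∫ g dΛ`: there are simple functions `φ n`,
vanishing outside bounded Borel sets and converging `π ⊗ λ`-almost everywhere to `g`, such that
`∫_A φ n dΛ` converges in probability for every Borel set `A`, with limit `I` for `A = S × ℝ`. -/
def IsLevyIntegral {S Ω : Type*} [MeasurableSpace S] [MeasurableSpace Ω]
    (P : Measure Ω) (π : Measure S) (Λ : Set (S × ℝ) → Ω → ℝ)
    (g : S × ℝ → ℝ) (I : Ω → ℝ) : Prop :=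
  ∃ φ : ℕ → SimpleFunc (S × ℝ) ℝ,
    (∀ n, Function.support (φ n) ∈ BoundedBorel S) ∧
    (∀ᵐ p ∂(π.prod volume), Tendsto (fun n => φ n p) atTop (𝓝 (g p))) ∧
    (∀ A : Set (S × ℝ), MeasurableSet A → ∃ J : Ω → ℝ,
      TendstoInMeasure P (fun n => simpleIntegral Λ (φ n) A) atTop J) ∧
    TendstoInMeasure P (fun n => simpleIntegral Λ (φ n) univ) atTop I

/-- Lebesgue measure on `ℝ⁺ = [0, ∞)`. -/
def lebesguePos : Measure ℝ≥0 := Measure.comap (fun s : ℝ≥0 => (s : ℝ)) volume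

/-- The integrand `(A, u) ↦ f(A, t - u) 1_{u ≤ t}` of the causal mixed moving average at time `t`. -/
def causalKernel {S : Type*} (f : S × ℝ≥0 → ℝ) (t : ℝ) : S × ℝ → ℝ :=
  fun p => if p.2 ≤ t then f (p.1, (t - p.2).toNNReal) else 0

/-- `X_t = ∫_S ∫_{(-∞, t]} f(A, t - u) Λ(dA, du)` almost surely, for every `t`. -/
def IsCausalMMA {S Ω : Type*} [MeasurableSpace S] [MeasurableSpace Ω]
    (P : Measure Ω) (π : Measure S) (Λ : Set (S × ℝ) → Ω → ℝ)
    (f : S × ℝ≥0 → ℝ) (X : ℝ → Ω → ℝ) : Prop :=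
  ∀ t, IsLevyIntegral P π Λ (causalKernel f t) (X t)

/-! ### Brownian motion on the line, the filtration, càdlàg paths -/

/-- `W` is a standard Brownian motion indexed by `ℝ`. -/
structure IsBrownianLine {Ω : Type*} [MeasurableSpace Ω] (P : Measure Ω) (W : ℝ → Ω → ℝ) :
    Prop where
  measurable : ∀ t, Measurable (W t)
  zero : ∀ᵐ ω ∂P, W 0 ω = 0
  indepIncrements : HasIndepIncrements W P
  gaussianIncrements : ∀ s t : ℝ, s ≤ t →
    HasLaw (fun ω => W t ω - W s ω) (gaussianReal 0 (t - s).toNNReal) P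
  continuous : ∀ᵐ ω ∂P, Continuous (fun t => W t ω)

/-- The `σ`-algebra generated by `Λ(B)`, `B` bounded Borel. -/
@[reducible] def basisSigma {S Ω : Type*} [MeasurableSpace S] (Λ : Set (S × ℝ) → Ω → ℝ) : MeasurableSpace Ω :=
  ⨆ B ∈ BoundedBorel S, MeasurableSpace.comap (Λ B) inferInstance

/-- The `σ`-algebra generated by the process `W`. -/
@[reducible] def processSigma {Ω : Type*} (W : ℝ → Ω → ℝ) : MeasurableSpace Ω :=
  ⨆ t, MeasurableSpace.comap (W t) inferInstance

/-- The `σ`-algebra generated by `Λ(B)`, `B ⊆ S × (-∞, t]` bounded Borel, and by the increments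
`W_u - W_s`, `s ≤ u ≤ t`. -/
@[reducible] def pastSigma {S Ω : Type*} [MeasurableSpace S]
    (Λ : Set (S × ℝ) → Ω → ℝ) (W : ℝ → Ω → ℝ) (t : ℝ) : MeasurableSpace Ω :=
  (⨆ B ∈ {B ∈ BoundedBorel S | B ⊆ univ ×ˢ Iic t}, MeasurableSpace.comap (Λ B) inferInstance) ⊔
  (⨆ p ∈ {p : ℝ × ℝ | p.1 ≤ p.2 ∧ p.2 ≤ t},
    MeasurableSpace.comap (fun ω => W p.2 ω - W p.1 ω) inferInstance)

/-- The filtration `𝒜_t`, completed by the `P`-null sets. -/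
@[reducible] def filtr {S Ω : Type*} [MeasurableSpace S] [MeasurableSpace Ω] (P : Measure Ω)
    (Λ : Set (S × ℝ) → Ω → ℝ) (W : ℝ → Ω → ℝ) (t : ℝ) : MeasurableSpace Ω :=
  eventuallyMeasurableSpace (pastSigma Λ W t) (ae P)

/-- Right-continuous with (finite) left limits. -/
def IsCadlag (x : ℝ → ℝ) : Prop :=
  ∀ t, ContinuousWithinAt x (Ici t) t ∧ ∃ l, Tendsto x (𝓝[<] t) (𝓝 l)

/-! ### The Itô integral -/

/-- A simple process `∑_{k < N} ξ_k 1_{(t_k, t_{k+1}]}` on `(a, b]`, where `ξ_k` is square-integrable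
and measurable with respect to the `σ`-algebra `𝒢 t_k`. -/
structure SimpleProcess {Ω : Type*} [MeasurableSpace Ω] (P : Measure Ω)
    (𝒢 : ℝ → MeasurableSpace Ω) (a b : ℝ) where
  N : ℕ
  time : ℕ → ℝ
  time_mono : Monotone time
  time_mem : ∀ k, time k ∈ Icc a b
  coeff : ℕ → Ω → ℝ
  adapted : ∀ k, Measurable[𝒢 (time k)] (coeff k)
  memLp : ∀ k, MemLp (coeff k) 2 P

/-- The value of a simple process. -/
def SimpleProcess.val {Ω : Type*} [MeasurableSpace Ω] {P : Measure Ω}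
    {𝒢 : ℝ → MeasurableSpace Ω} {a b : ℝ} (φ : SimpleProcess P 𝒢 a b) (s : ℝ) (ω : Ω) : ℝ :=
  ∑ k ∈ Finset.range φ.N, if φ.time k < s ∧ s ≤ φ.time (k + 1) then φ.coeff k ω else 0

/-- The stochastic integral of a simple process with respect to `W`. -/
def SimpleProcess.integral {Ω : Type*} [MeasurableSpace Ω] {P : Measure Ω}
    {𝒢 : ℝ → MeasurableSpace Ω} {a b : ℝ} (φ : SimpleProcess P 𝒢 a b)
    (W : ℝ → Ω → ℝ) (ω : Ω) : ℝ :=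
  ∑ k ∈ Finset.range φ.N, φ.coeff k ω * (W (φ.time (k + 1)) ω - W (φ.time k) ω)

/-- `I` is (a version of) the Itô integral `∫_a^b H_s dW_s`: it is the `L²(P)`-limit of the integrals
of simple processes converging to `H` in `L²(P ⊗ ds)` on `Ω × (a, b]`. -/
def IsItoIntegral {Ω : Type*} [MeasurableSpace Ω] (P : Measure Ω)
    (𝒢 : ℝ → MeasurableSpace Ω) (W : ℝ → Ω → ℝ) (H : ℝ → Ω → ℝ) (a b : ℝ) (I : Ω → ℝ) : Prop :=
  MemLp I 2 P ∧ ∃ φ : ℕ → SimpleProcess P 𝒢 a b,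
    Tendsto (fun n => ∫⁻ ω, ∫⁻ s in Ioc a b, ‖(φ n).val s ω - H s ω‖ₑ ^ 2 ∂volume ∂P) atTop (𝓝 0) ∧
    Tendsto (fun n => eLpNorm (fun ω => (φ n).integral W ω - I ω) 2 P) atTop (𝓝 0)

/-! ### θ-weak dependence -/

/-- `‖F‖_∞` for a bounded function `F`. -/
def supNorm {α : Type*} (F : α → ℝ) : ℝ := ⨆ x, |F x|

/-- `G` is Lipschitz for the distance `δ₁(x, y) = ∑ ‖x_i - y_i‖`. -/
def IsLipschitzSum {E : Type*} [NormedAddCommGroup E] {v : ℕ} (G : (Fin v → E) → ℝ) : Prop :=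
  ∃ K : ℝ, ∀ x y, |G x - G y| ≤ K * ∑ i, ‖x i - y i‖

/-- `Lip(G) = sup_{x ≠ y} |G(x) - G(y)| / ∑ ‖x_i - y_i‖`. -/
def lipConst {E : Type*} [NormedAddCommGroup E] {v : ℕ} (G : (Fin v → E) → ℝ) : ℝ :=
  sSup {q | ∃ x y : Fin v → E, x ≠ y ∧ q = |G x - G y| / ∑ i, ‖x i - y i‖}

/-- The process `Y` is `θ`-weakly dependent with coefficients `(θ r)_{r ≥ 0}`. -/
def IsThetaWeaklyDependent {E Ω : Type*} [NormedAddCommGroup E] [MeasurableSpace E]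
    [MeasurableSpace Ω] (P : Measure Ω) (Y : ℝ → Ω → E) (θ : ℝ≥0 → ℝ) : Prop :=
  Tendsto θ atTop (𝓝 0) ∧
  ∃ c : ℝ, ∀ (u v : ℕ), 0 < u → 0 < v → ∀ (r : ℝ≥0) (i : Fin u → ℝ) (j : Fin v → ℝ),
    Monotone i → Monotone j → (∀ a b, i a + r ≤ j b) →
    ∀ (F : (Fin u → E) → ℝ) (G : (Fin v → E) → ℝ),
      Measurable F → (∀ x, |F x| ≤ 1) → (∀ x, |G x| ≤ 1) → IsLipschitzSum G →
      |cov[fun ω => F (fun a => Y (i a) ω), fun ω => G (fun b => Y (j b) ω); P]|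
        ≤ c * (v * lipConst G * supNorm F) * θ r

/-! ### The volatility model -/

/-- Assumption (H) on the volatility process `X`. The last two clauses about `f` say that
`∫∫ |f γ₀| < ∞` and `∫∫∫ (1 ∧ |f x|) < ∞`. -/
structure AssumptionH {S Ω : Type*} [MeasurableSpace S] [MeasurableSpace Ω]
    (P : Measure Ω) (π : Measure S) (Λ : Set (S × ℝ) → Ω → ℝ) (W : ℝ → Ω → ℝ)
    (γ : ℝ) (ν : Measure ℝ) (f : S × ℝ≥0 → ℝ) (X : ℝ → Ω → ℝ) : Prop where
  basis : IsLevyBasis P Λ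
  quadruple : HasGeneratingQuadruple P Λ γ 0 ν π
  finiteMean : Integrable (fun x : ℝ => x) ν
  drift_nonneg : 0 ≤ drift γ ν
  noNegativeJumps : ν (Iio 0) = 0
  kernel_measurable : Measurable f
  kernel_nonneg : ∀ p, 0 ≤ f p
  kernel_drift : ∫⁻ p, ‖f p * drift γ ν‖ₑ ∂(π.prod lebesguePos) < ∞
  kernel_jumps : ∫⁻ p, ∫⁻ x, ENNReal.ofReal (min 1 |f p * x|) ∂ν ∂(π.prod lebesguePos) < ∞
  mma : IsCausalMMA P π Λ f X
  adapted : ∀ t, Measurable[filtr P Λ W t] (X t)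
  cadlag : ∀ᵐ ω ∂P, IsCadlag (fun t => X t ω)

/-- The coefficient
`θ_X(r) = ∫_S ∫_{-∞}^{-r} ∫ |f(A,-s) x| ν(dx) ds π(dA) + ∫_S ∫_{-∞}^{-r} |f(A,-s) γ₀| ds π(dA)`. -/
def thetaX {S : Type*} [MeasurableSpace S] (π : Measure S) (γ : ℝ) (ν : Measure ℝ)
    (f : S × ℝ≥0 → ℝ) (r : ℝ) : ℝ :=
  (∫ A, ∫ s in Iic (-r), ∫ x, |f (A, (-s).toNNReal) * x| ∂ν ∂volume ∂π)
    + ∫ A, ∫ s in Iic (-r), |f (A, (-s).toNNReal) * drift γ ν| ∂volume ∂π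

end

end MMASV

namespace MMASV

/-! ### First moments from characteristic functions -/

/-! Write κ = |γ₀| + ∫|x| ν(dx), which is `levyMass γ ν`. As f ≥ 0, θ_X(r) is exactly κ times the
mass of f beyond lag r (`ofReal_thetaX`). Fix T, the end of the last window of the past. Discarding
the noise up to T from X_t leaves a variable Z_t that depends only on the future after T, and E|X_t
- Z_t| ≤ C θ_X(t - T) with an absolute constant C = `momentConst`. Since (√x - √y)² ≤ |x - y|, the
Itô isometry turns this L¹ bound for the volatility into an L² bound of order √(C Δ θ_X) for the
return. So Y_j is L¹-close to a variable V measurable with respect to the future of T. F of the past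
is independent of G(V), hence Cov(F, G(Y)) = Cov(F, G(Y) - G(V)), which is at most 2 ‖F‖ Lip(G) ∑
E|Y_j - V_j|. The window of Y_j opens one unit before j; this is the shift r - 1.

Three points need care. First, E|Λ(B)| ≤ C κ (π ⊗ λ)(B) has to be read off the characteristic
function; the scaling identity |y| ∫ (1 - cos v)/v² dv = ∫ (1 - cos(uy))/u² du does this
(`lintegral_enorm_le_of_charFun`). Second, the integral against Λ is a limit in probability along
simple functions that converge only almost everywhere, so first moments need not pass to the limit.
A gliding-hump argument (`ae_eq_zero_of_gliding_hump`) shows that the limit agrees with the L¹-limit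
along good approximations, for which they do (`IsLevyBasis.lintegral_limit_le`). Third, Z is built
separately at each time and has no path regularity, so ∫√Z dW is never formed: X and Z are compared
after sampling on a common grid, with bounds uniform in the mesh
(`IsItoIntegral.exists_measurable_approx`).

Independence of past and future combines that of W and Λ, of Λ over disjoint sets, and of the
increments of W (`indep_pastSigma_futureSigma`); `abs_cov_le_of_indep_approx` is the covariance
estimate. -/

theorem lintegral_comp_mul_div_sq (q : ℝ → ℝ) (hq : Measurable q) (h0 : q 0 = 0) (y : ℝ) :
    ∫⁻ u : ℝ, ENNReal.ofReal (q (u * y) / u ^ 2)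
      = ENNReal.ofReal |y| * ∫⁻ v : ℝ, ENNReal.ofReal (q v / v ^ 2) := by
  rcases eq_or_ne y 0 with rfl | hy
  · simp [h0]
  · have hm : Measurable fun v : ℝ => ENNReal.ofReal (q v / v ^ 2) := by fun_prop
    -- Substitution v = uy: the factor y² against the Jacobian |y|⁻¹ leaves |y|. At u = 0 both sides
    -- vanish because division by zero gives zero.
    have h1 : ∀ u : ℝ, ENNReal.ofReal (q (u * y) / u ^ 2)
        = ENNReal.ofReal (y ^ 2) * ENNReal.ofReal (q (u * y) / (u * y) ^ 2) := by
      intro u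
      rw [← ENNReal.ofReal_mul (by positivity)]
      congr 1
      rcases eq_or_ne u 0 with rfl | hu
      · simp
      · field_simp
    simp_rw [h1]
    rw [lintegral_const_mul _ (by fun_prop)]
    have h2 : ∫⁻ u : ℝ, ENNReal.ofReal (q (u * y) / (u * y) ^ 2)
        = ENNReal.ofReal |y⁻¹| * ∫⁻ v : ℝ, ENNReal.ofReal (q v / v ^ 2) := by
      rw [← lintegral_map (f := fun v : ℝ => ENNReal.ofReal (q v / v ^ 2)) hm
        (measurable_mul_const y), Real.map_volume_mul_right hy, lintegral_smul_measure]
      rfl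
    rw [h2, ← mul_assoc, ← ENNReal.ofReal_mul (by positivity)]
    congr 2
    rw [abs_inv, ← sq_abs]
    have : |y| ≠ 0 := by simpa using hy
    field_simp

theorem one_sub_cos_le_min (x : ℝ) : 1 - Real.cos x ≤ min 2 (x ^ 2 / 2) := by
  refine le_min ?_ ?_
  · linarith [Real.neg_one_le_cos x]
  · linarith [Real.one_sub_sq_div_two_le_cos (x := x)]

theorem lintegral_min_div_sq_lt_top :
    ∫⁻ v : ℝ, ENNReal.ofReal (min 2 (v ^ 2 / 2) / v ^ 2) < ∞ := by
  -- The integrand is at most 1/2 for v² ≤ 4 and at most 2/v² beyond; both are dominated by 4/(1 +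
  -- v²).
  refine lt_of_le_of_lt (lintegral_mono fun v => ENNReal.ofReal_le_ofReal
    (q := 4 * (1 + v ^ 2)⁻¹) ?_) ?_
  · rcases eq_or_ne v 0 with rfl | hv
    · simp
    · have hv2 : 0 < v ^ 2 := by positivity
      rw [div_le_iff₀ hv2, ← div_eq_mul_inv, div_mul_eq_mul_div, le_div_iff₀ (by positivity)]
      rcases le_total (v ^ 2) 4 with h | h
      · nlinarith [min_le_right (2 : ℝ) (v ^ 2 / 2)]
      · nlinarith [min_le_left (2 : ℝ) (v ^ 2 / 2)]
  · exact (integrable_inv_one_add_sq.const_mul 4).lintegral_lt_top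

theorem lintegral_one_sub_cos_div_sq_lt_top :
    ∫⁻ v : ℝ, ENNReal.ofReal ((1 - Real.cos v) / v ^ 2) < ∞ :=
  lt_of_le_of_lt (lintegral_mono fun v => ENNReal.ofReal_le_ofReal
    (div_le_div_of_nonneg_right (one_sub_cos_le_min v) (sq_nonneg v))) lintegral_min_div_sq_lt_top

theorem lintegral_one_sub_cos_div_sq_pos :
    0 < ∫⁻ v : ℝ, ENNReal.ofReal ((1 - Real.cos v) / v ^ 2) := by
  rw [lintegral_pos_iff_support (by fun_prop)]
  refine lt_of_lt_of_le (b := volume (Ioo (0 : ℝ) 1)) (by simp) (measure_mono fun v hv => ?_)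
  have h : Real.cos v < 1 := by
    have := Real.cos_lt_cos_of_nonneg_of_le_pi_div_two (x := 0) (y := v) le_rfl
      (by linarith [Real.pi_gt_three, hv.2]) hv.1
    simpa using this
  have hv0 := hv.1
  simp only [Function.mem_support, ne_eq, ENNReal.ofReal_eq_zero, not_le]
  exact div_pos (by linarith) (by positivity)

/-- The real and imaginary parts of the cumulant of a finite-variation law with finite mean. -/
theorem cumulant_re_im {γ : ℝ} {ν : Measure ℝ} (hν : Integrable (fun x : ℝ => x) ν) (u : ℝ) :
    (cumulant γ 0 ν u).re = -∫ x, (1 - Real.cos (u * x)) ∂ν ∧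
    (cumulant γ 0 ν u).im = u * drift γ ν + ∫ x, Real.sin (u * x) ∂ν := by
  have hcut : Integrable (fun x : ℝ => if |x| ≤ 1 then x else 0) ν := by
    have := hν.indicator (s := {x : ℝ | |x| ≤ 1}) (measurableSet_le (by fun_prop) (by fun_prop))
    refine this.congr (ae_of_all _ fun x => ?_)
    simp [indicator_apply]
  have hsin : Integrable (fun x : ℝ => Real.sin (u * x)) ν :=
    (hν.const_mul u).mono (by fun_prop) (ae_of_all _ fun x => by
      simpa using Real.abs_sin_le_abs (x := u * x))
  have hcos : Integrable (fun x : ℝ => 1 - Real.cos (u * x)) ν := by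
    refine (hν.const_mul (2 * u)).mono (by fun_prop) (ae_of_all _ fun x => ?_)
    have h0 : 0 ≤ 1 - Real.cos (u * x) := by linarith [Real.cos_le_one (u * x)]
    rw [Real.norm_of_nonneg h0, Real.norm_eq_abs]
    have h1 := one_sub_cos_le_min (u * x)
    have h3 : |2 * u * x| = 2 * |u * x| := by rw [mul_assoc, abs_mul]; simp
    rw [h3]
    rcases le_total 1 |u * x| with h | h
    · linarith [min_le_left (2 : ℝ) ((u * x) ^ 2 / 2)]
    · have := h1.trans (min_le_right (2 : ℝ) ((u * x) ^ 2 / 2))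
      rw [← sq_abs] at this
      nlinarith [abs_nonneg (u * x)]
  have hre : Integrable (fun x : ℝ => ((-(1 - Real.cos (u * x)) : ℝ) : ℂ)) ν := hcos.neg.ofReal
  have him : Integrable (fun x : ℝ =>
      ((Real.sin (u * x) - u * (if |x| ≤ 1 then x else 0) : ℝ) : ℂ)) ν :=
    (hsin.sub (hcut.const_mul u)).ofReal
  -- Because x is ν-integrable, the compensator can be integrated on its own; with γ it forms the
  -- drift γ₀.
  have key : ∀ x : ℝ, Complex.exp (Complex.I * u * x) - 1
        - Complex.I * u * x * (if |x| ≤ 1 then 1 else 0)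
      = ((-(1 - Real.cos (u * x)) : ℝ) : ℂ)
        + ((Real.sin (u * x) - u * (if |x| ≤ 1 then x else 0) : ℝ) : ℂ) * Complex.I := by
    intro x
    have : Complex.I * u * x = ((u * x : ℝ) : ℂ) * Complex.I := by push_cast; ring
    rw [this, Complex.exp_mul_I, ← Complex.ofReal_cos, ← Complex.ofReal_sin]
    split_ifs <;> push_cast <;> ring
  have hcutint : ∫ x, (if |x| ≤ 1 then x else 0) ∂ν = ∫ x in {x : ℝ | |x| ≤ 1}, x ∂ν := by
    rw [← integral_indicator (measurableSet_le (by fun_prop) (by fun_prop))]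
    refine integral_congr_ae (ae_of_all _ fun x => ?_)
    simp [indicator_apply]
  have hint : (∫ x : ℝ, (Complex.exp (Complex.I * u * x) - 1
        - Complex.I * u * x * (if |x| ≤ 1 then 1 else 0)) ∂ν)
      = ((-∫ x, (1 - Real.cos (u * x)) ∂ν : ℝ) : ℂ)
        + ((∫ x, Real.sin (u * x) ∂ν - u * ∫ x in {x : ℝ | |x| ≤ 1}, x ∂ν : ℝ) : ℂ)
          * Complex.I := by
    simp_rw [key]
    rw [integral_add hre (him.mul_const _), integral_mul_const, integral_complex_ofReal,
      integral_complex_ofReal,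
      integral_neg, integral_sub hsin (hcut.const_mul u), integral_const_mul, hcutint]
  unfold cumulant drift
  rw [hint]
  constructor <;> simp
  ring

/-- The first absolute moment of `∫ x ν(dx)` and of the drift. -/
noncomputable def levyMass (γ : ℝ) (ν : Measure ℝ) : ℝ := |drift γ ν| + ∫ x, |x| ∂ν

theorem levyMass_nonneg (γ : ℝ) (ν : Measure ℝ) : 0 ≤ levyMass γ ν :=
  add_nonneg (abs_nonneg _) (integral_nonneg fun _ => abs_nonneg _)

theorem abs_cumulant_im_le {γ : ℝ} {ν : Measure ℝ} (hν : Integrable (fun x : ℝ => x) ν) (u : ℝ) :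
    |(cumulant γ 0 ν u).im| ≤ levyMass γ ν * |u| := by
  rw [(cumulant_re_im hν u).2]
  have h : |∫ x, Real.sin (u * x) ∂ν| ≤ |u| * ∫ x, |x| ∂ν := by
    rw [← integral_const_mul]
    refine abs_integral_le_integral_abs.trans ?_
    refine integral_mono_of_nonneg (ae_of_all _ fun _ => abs_nonneg _) (hν.abs.const_mul _)
      (ae_of_all _ fun x => ?_)
    simpa [abs_mul] using Real.abs_sin_le_abs (x := u * x)
  calc _ ≤ |u * drift γ ν| + |∫ x, Real.sin (u * x) ∂ν| := abs_add_le _ _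
    _ ≤ |u| * |drift γ ν| + |u| * ∫ x, |x| ∂ν := by rw [abs_mul]; gcongr
    _ = _ := by unfold levyMass; ring

/-- With `N` the integral of 1 - cos(ux) and `b` the phase, 1 - e^{-mN} cos b = (1 - e^{-mN}) +
e^{-mN}(1 - cos b) ≤ mN + (1 - cos b), and |b| ≤ mκ|u|. Keeping the minimum with 2 makes the second
term integrable against du/u² at infinity as well as at 0; by scaling, its integral is again linear
in m. -/
theorem one_sub_exp_re_le {γ : ℝ} {ν : Measure ℝ} (hν : Integrable (fun x : ℝ => x) ν) (u : ℝ)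
    {m : ℝ} (hm : 0 ≤ m) :
    1 - (Complex.exp (cumulant γ 0 ν u * m)).re
      ≤ m * (∫ x, (1 - Real.cos (u * x)) ∂ν)
        + min 2 ((u * (m * levyMass γ ν)) ^ 2 / 2) := by
  set N := ∫ x, (1 - Real.cos (u * x)) ∂ν with hN
  have hN0 : 0 ≤ N := integral_nonneg fun x => by
    simpa using Real.cos_le_one (u * x)
  rw [Complex.exp_re]
  have hre : (cumulant γ 0 ν u * m).re = -(m * N) := by
    simp [(cumulant_re_im hν u).1, hN, mul_comm]
  have him : (cumulant γ 0 ν u * m).im = (cumulant γ 0 ν u).im * m := by simp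
  rw [hre, him]
  set b := (cumulant γ 0 ν u).im * m with hb
  have hb' : |b| ≤ |u * (m * levyMass γ ν)| := by
    rw [hb, abs_mul, abs_mul, abs_mul, abs_of_nonneg hm, abs_of_nonneg (levyMass_nonneg γ ν)]
    nlinarith [abs_cumulant_im_le (γ := γ) hν u]
  have h1 : 1 - Real.cos b ≤ min 2 ((u * (m * levyMass γ ν)) ^ 2 / 2) := by
    refine (one_sub_cos_le_min b).trans (min_le_min le_rfl ?_)
    have := sq_le_sq.2 hb'
    linarith
  have he : 1 - m * N ≤ Real.exp (-(m * N)) := by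
    linarith [Real.add_one_le_exp (-(m * N))]
  have he1 : Real.exp (-(m * N)) ≤ 1 := Real.exp_le_one_iff.2 (by nlinarith)
  have he0 := Real.exp_pos (-(m * N))
  nlinarith [Real.cos_le_one b]

/-- Exchange the integrals and apply the scaling identity in u. As ν may be infinite near 0, the
exchange is made for the finite measure |x| ν(dx); nothing is lost, since the integrands vanish at x
= 0. -/
theorem lintegral_lintegral_one_sub_cos {ν : Measure ℝ} (hν : Integrable (fun x : ℝ => x) ν) :
    ∫⁻ u : ℝ, ∫⁻ x, ENNReal.ofReal ((1 - Real.cos (u * x)) / u ^ 2) ∂ν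
      = ENNReal.ofReal (∫ x, |x| ∂ν)
        * ∫⁻ v : ℝ, ENNReal.ofReal ((1 - Real.cos v) / v ^ 2) := by
  set ρ := ν.withDensity fun x => ENNReal.ofReal |x| with hρ
  have hρm : Measurable fun x : ℝ => ENNReal.ofReal |x| := by fun_prop
  have : IsFiniteMeasure ρ := isFiniteMeasure_withDensity (by
    have := hν.abs.lintegral_lt_top
    exact this.ne)
  have hw : ∀ g : ℝ → ℝ, Measurable g → g 0 = 0 → ∫⁻ x, ENNReal.ofReal (g x) ∂ν
      = ∫⁻ x, ENNReal.ofReal (g x / |x|) ∂ρ := by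
    intro g hg g0
    rw [hρ, lintegral_withDensity_eq_lintegral_mul _ hρm (by fun_prop)]
    refine lintegral_congr fun x => ?_
    rw [Pi.mul_apply, ← ENNReal.ofReal_mul (abs_nonneg x)]
    rcases eq_or_ne x 0 with rfl | hx
    · simp [g0]
    · rw [mul_div_cancel₀ _ (by simpa using hx)]
  have h1 : ∀ u : ℝ, ∫⁻ x, ENNReal.ofReal ((1 - Real.cos (u * x)) / u ^ 2) ∂ν
      = ∫⁻ x, ENNReal.ofReal ((1 - Real.cos (u * x)) / u ^ 2 / |x|) ∂ρ := fun u =>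
    hw (fun x => (1 - Real.cos (u * x)) / u ^ 2) (by fun_prop) (by simp)
  simp_rw [h1]
  rw [lintegral_lintegral_swap (by fun_prop)]
  have h2 : ∀ x : ℝ, ∫⁻ u : ℝ, ENNReal.ofReal ((1 - Real.cos (u * x)) / u ^ 2 / |x|)
      = ENNReal.ofReal (|x| / |x|)
        * ∫⁻ v : ℝ, ENNReal.ofReal ((1 - Real.cos v) / v ^ 2) := by
    intro x
    simp_rw [div_eq_mul_inv _ |x|, mul_comm _ (|x|⁻¹)]
    simp_rw [ENNReal.ofReal_mul (inv_nonneg.2 (abs_nonneg x))]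
    rw [lintegral_const_mul _ (by fun_prop),
      lintegral_comp_mul_div_sq (fun v => 1 - Real.cos v) (by fun_prop) (by simp), mul_assoc]
  simp_rw [h2]
  rw [lintegral_mul_const _ (by fun_prop), ← hw (fun x => |x|) (by fun_prop) (by simp),
    ofReal_integral_eq_lintegral_ofReal hν.abs (ae_of_all _ fun _ => abs_nonneg _)]

/-- The constant in the first-moment bound `E|Λ(B)| ≤ C κ (π ⊗ λ)(B)`. -/
noncomputable def momentConst : ℝ≥0∞ :=
  1 + (∫⁻ v : ℝ, ENNReal.ofReal (min 2 (v ^ 2 / 2) / v ^ 2))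
    / ∫⁻ v : ℝ, ENNReal.ofReal ((1 - Real.cos v) / v ^ 2)

theorem momentConst_ne_top : momentConst ≠ ∞ := by
  unfold momentConst
  exact ENNReal.add_ne_top.2 ⟨by simp, ENNReal.div_ne_top lintegral_min_div_sq_lt_top.ne
    lintegral_one_sub_cos_div_sq_pos.ne'⟩

/-- Integrating (1 - Re E e^{iuY})/u² over u gives K E|Y|. The two terms of `one_sub_exp_re_le`
contribute at most mκK and mκK', so E|Y| ≤ (1 + K'/K) κ m, with an absolute factor 1 + K'/K. -/
theorem lintegral_enorm_le_of_charFun {Ω : Type*} [MeasurableSpace Ω] {P : Measure Ω}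
    [IsProbabilityMeasure P] {γ : ℝ} {ν : Measure ℝ} (hν : Integrable (fun x : ℝ => x) ν)
    {Y : Ω → ℝ} (hY : Measurable Y) {m : ℝ} (hm : 0 ≤ m)
    (h : ∀ u : ℝ, ∫ ω, Complex.exp (Complex.I * u * Y ω) ∂P
      = Complex.exp (cumulant γ 0 ν u * m)) :
    ∫⁻ ω, ‖Y ω‖ₑ ∂P ≤ momentConst * ENNReal.ofReal (levyMass γ ν) * ENNReal.ofReal m := by
  set K := ∫⁻ v : ℝ, ENNReal.ofReal ((1 - Real.cos v) / v ^ 2) with hK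
  set K' := ∫⁻ v : ℝ, ENNReal.ofReal (min 2 (v ^ 2 / 2) / v ^ 2) with hK'
  have hK0 : K ≠ 0 := lintegral_one_sub_cos_div_sq_pos.ne'
  have hKt : K ≠ ∞ := lintegral_one_sub_cos_div_sq_lt_top.ne
  have hcos : ∀ u : ℝ, ∫⁻ ω, ENNReal.ofReal ((1 - Real.cos (u * Y ω)) / u ^ 2) ∂P
      = ENNReal.ofReal ((1 - (Complex.exp (cumulant γ 0 ν u * m)).re) / u ^ 2) := by
    intro u
    have hi : Integrable (fun ω => Complex.exp (Complex.I * u * Y ω)) P := by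
      refine Integrable.of_bound (C := 1) (by fun_prop) (ae_of_all _ fun ω => ?_)
      have : Complex.I * u * Y ω = ((u * Y ω : ℝ) : ℂ) * Complex.I := by push_cast; ring
      rw [this, Complex.norm_exp_ofReal_mul_I]
    have hre : ∀ ω, (Complex.exp (Complex.I * u * Y ω)).re = Real.cos (u * Y ω) := by
      intro ω
      have : Complex.I * u * Y ω = ((u * Y ω : ℝ) : ℂ) * Complex.I := by push_cast; ring
      rw [this, Complex.exp_ofReal_mul_I_re]
    have hic : Integrable (fun ω => Real.cos (u * Y ω)) P := by
      have := hi.re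
      simpa [hre] using this
    have h1 : (Complex.exp (cumulant γ 0 ν u * m)).re = ∫ ω, Real.cos (u * Y ω) ∂P := by
      rw [← h u]
      have := integral_re hi
      simp only [RCLike.re_eq_complex_re, hre] at this
      rw [← this]
    rw [h1, ← ofReal_integral_eq_lintegral_ofReal]
    · congr 1
      rw [integral_div, integral_sub (integrable_const _) hic]
      simp
    · exact ((integrable_const _).sub hic).div_const _
    · exact ae_of_all _ fun ω => div_nonneg (by simpa using Real.cos_le_one (u * Y ω)) (sq_nonneg u)
  have hNint : ∀ u : ℝ, ENNReal.ofReal ((∫ x, (1 - Real.cos (u * x)) ∂ν) / u ^ 2)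
      ≤ ∫⁻ x, ENNReal.ofReal ((1 - Real.cos (u * x)) / u ^ 2) ∂ν := by
    intro u
    rw [← integral_div]
    refine (ENNReal.ofReal_le_ofReal (le_abs_self _)).trans ?_
    rw [← Real.norm_eq_abs, ofReal_norm]
    refine (enorm_integral_le_lintegral_enorm _).trans (lintegral_mono fun x => ?_)
    rw [Real.enorm_of_nonneg]
    exact div_nonneg (by simpa using Real.cos_le_one (u * x)) (sq_nonneg u)
  have main : (∫⁻ ω, ‖Y ω‖ₑ ∂P) * K
      ≤ ENNReal.ofReal m * (ENNReal.ofReal (∫ x, |x| ∂ν) * K)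
        + ENNReal.ofReal (m * levyMass γ ν) * K' := by
    calc (∫⁻ ω, ‖Y ω‖ₑ ∂P) * K
        = ∫⁻ ω, (∫⁻ u : ℝ, ENNReal.ofReal ((1 - Real.cos (u * Y ω)) / u ^ 2)) ∂P := by
          rw [← lintegral_mul_const _ (by fun_prop)]
          refine lintegral_congr fun ω => ?_
          rw [lintegral_comp_mul_div_sq (fun v => 1 - Real.cos v) (by fun_prop) (by simp),
            Real.enorm_eq_ofReal_abs]
      _ = ∫⁻ u : ℝ, ∫⁻ ω, ENNReal.ofReal ((1 - Real.cos (u * Y ω)) / u ^ 2) ∂P :=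
          lintegral_lintegral_swap (by fun_prop)
      _ ≤ ∫⁻ u : ℝ, (ENNReal.ofReal m
            * (∫⁻ x, ENNReal.ofReal ((1 - Real.cos (u * x)) / u ^ 2) ∂ν)
            + ENNReal.ofReal (min 2 ((u * (m * levyMass γ ν)) ^ 2 / 2) / u ^ 2)) := by
          refine lintegral_mono fun u => ?_
          simp only [hcos u]
          refine (ENNReal.ofReal_le_ofReal (div_le_div_of_nonneg_right
            (one_sub_exp_re_le (γ := γ) hν u hm) (sq_nonneg u))).trans ?_
          rw [add_div]
          refine ENNReal.ofReal_add_le.trans (add_le_add ?_ le_rfl)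
          rw [mul_div_assoc, ENNReal.ofReal_mul hm]
          gcongr
          exact hNint u
      _ = _ := by
          rw [lintegral_add_right _ (by fun_prop), lintegral_const_mul' _ _ ENNReal.ofReal_ne_top,
            lintegral_lintegral_one_sub_cos hν,
            lintegral_comp_mul_div_sq (fun v => min 2 (v ^ 2 / 2)) (by fun_prop) (by simp),
            abs_of_nonneg (mul_nonneg hm (levyMass_nonneg γ ν))]
  have hle : ENNReal.ofReal (∫ x, |x| ∂ν) ≤ ENNReal.ofReal (levyMass γ ν) :=
    ENNReal.ofReal_le_ofReal (by unfold levyMass; linarith [abs_nonneg (drift γ ν)])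
  have main2 : (∫⁻ ω, ‖Y ω‖ₑ ∂P) * K
      ≤ (momentConst * ENNReal.ofReal (levyMass γ ν) * ENNReal.ofReal m) * K := by
    refine main.trans ?_
    rw [ENNReal.ofReal_mul hm]
    calc _ ≤ ENNReal.ofReal m * (ENNReal.ofReal (levyMass γ ν) * K)
        + ENNReal.ofReal m * ENNReal.ofReal (levyMass γ ν) * K' := by gcongr
      _ = ENNReal.ofReal (levyMass γ ν) * ENNReal.ofReal m * (K + K') := by ring
      _ = ENNReal.ofReal (levyMass γ ν) * ENNReal.ofReal m * ((1 + K' / K) * K) := by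
          rw [add_mul, one_mul, ENNReal.div_mul_cancel hK0 hKt]
      _ = _ := by unfold momentConst; ring
  exact (ENNReal.mul_le_mul_iff_left hK0 hKt).1 main2

/-! ### Lévy bases: additivity, moments, simple integrals -/

theorem boundedBorel_mono {S : Type*} [MeasurableSpace S] {A B : Set (S × ℝ)}
    (hB : B ∈ BoundedBorel S) (hA : MeasurableSet A) (h : A ⊆ B) : A ∈ BoundedBorel S :=
  ⟨hA, hB.2.imp fun _ hn => h.trans hn⟩

theorem boundedBorel_empty {S : Type*} [MeasurableSpace S] : (∅ : Set (S × ℝ)) ∈ BoundedBorel S :=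
  ⟨MeasurableSet.empty, 0, empty_subset _⟩

theorem boundedBorel_union {S : Type*} [MeasurableSpace S] {A B : Set (S × ℝ)}
    (hA : A ∈ BoundedBorel S) (hB : B ∈ BoundedBorel S) : A ∪ B ∈ BoundedBorel S := by
  obtain ⟨hAm, n, hn⟩ := hA
  obtain ⟨hBm, k, hk⟩ := hB
  refine ⟨hAm.union hBm, max n k, union_subset (hn.trans ?_) (hk.trans ?_)⟩
  · exact prod_mono le_rfl (Icc_subset_Icc (neg_le_neg (le_max_left _ _)) (le_max_left _ _))
  · exact prod_mono le_rfl (Icc_subset_Icc (neg_le_neg (le_max_right _ _)) (le_max_right _ _))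

theorem boundedBorel_biUnion {S ι : Type*} [MeasurableSpace S] {B : ι → Set (S × ℝ)}
    (s : Finset ι) (hB : ∀ i ∈ s, B i ∈ BoundedBorel S) : (⋃ i ∈ s, B i) ∈ BoundedBorel S := by
  classical
  induction s using Finset.induction_on with
  | empty => simpa using boundedBorel_empty
  | insert a s _ ih =>
    rw [Finset.set_biUnion_insert]
    exact boundedBorel_union (hB a (by simp)) (ih fun i hi => hB i (by simp [hi]))

theorem boundedBorel_measure_lt_top {S : Type*} [MeasurableSpace S] (π : Measure S)
    [IsFiniteMeasure π] {B : Set (S × ℝ)} (hB : B ∈ BoundedBorel S) :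
    (π.prod volume) B < ∞ := by
  obtain ⟨_, n, hn⟩ := hB
  refine lt_of_le_of_lt (measure_mono hn) ?_
  rw [Measure.prod_prod]
  exact ENNReal.mul_lt_top (measure_lt_top π _) (by simp)

section Basis

variable {S Ω : Type*} [MeasurableSpace S] [MeasurableSpace Ω] {P : Measure Ω}
  {Λ : Set (S × ℝ) → Ω → ℝ}

/-- σ-additivity along the constant sequence ∅ makes n ↦ n Λ(∅) convergent, so its increments Λ(∅)
tend to 0. -/
theorem IsLevyBasis.ae_empty (hΛ : IsLevyBasis P Λ) : ∀ᵐ ω ∂P, Λ ∅ ω = 0 := by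
  have h := hΛ.sigmaAdditive (fun _ => ∅) (fun _ => boundedBorel_empty)
    (fun i j _ => disjoint_bot_left) (by simpa using boundedBorel_empty)
  filter_upwards [h] with ω hω
  simp only [Finset.sum_const, Finset.card_range, iUnion_empty, nsmul_eq_mul] at hω
  have h1 : Tendsto (fun n : ℕ => ((n + 1 : ℕ) : ℝ) * Λ ∅ ω - (n : ℝ) * Λ ∅ ω) atTop
      (𝓝 (Λ ∅ ω - Λ ∅ ω)) := ((tendsto_add_atTop_iff_nat 1).2 hω).sub hω
  have h2 : (fun n : ℕ => ((n + 1 : ℕ) : ℝ) * Λ ∅ ω - (n : ℝ) * Λ ∅ ω) = fun _ => Λ ∅ ω := by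
    funext n; push_cast; ring
  rw [h2, sub_self] at h1
  exact tendsto_nhds_unique tendsto_const_nhds h1

theorem IsLevyBasis.ae_union (hΛ : IsLevyBasis P Λ) {A B : Set (S × ℝ)}
    (hA : A ∈ BoundedBorel S) (hB : B ∈ BoundedBorel S) (hAB : Disjoint A B) :
    Λ (A ∪ B) =ᵐ[P] fun ω => Λ A ω + Λ B ω := by
  let C : ℕ → Set (S × ℝ) := fun k => if k = 0 then A else if k = 1 then B else ∅
  have hU : ⋃ k, C k = A ∪ B := by
    ext x
    simp only [mem_iUnion, mem_union]
    constructor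
    · rintro ⟨k, hk⟩
      simp only [C] at hk
      split_ifs at hk <;> simp_all
    · rintro (h | h)
      · exact ⟨0, by simpa [C] using h⟩
      · exact ⟨1, by simpa [C] using h⟩
  have hC : ∀ k, C k ∈ BoundedBorel S := by
    intro k
    simp only [C]
    split_ifs
    exacts [hA, hB, boundedBorel_empty]
  have hd : Pairwise fun i j => Disjoint (C i) (C j) := by
    intro i j hij
    simp only [C]
    split_ifs <;> first | omega | exact hAB | exact hAB.symm | simp
  have h := hΛ.sigmaAdditive C hC hd (hU ▸ boundedBorel_union hA hB)
  filter_upwards [h, hΛ.ae_empty] with ω hω h0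
  rw [hU] at hω
  refine tendsto_nhds_unique hω (tendsto_const_nhds.congr' ?_)
  filter_upwards [eventually_ge_atTop 2] with n hn
  obtain ⟨k, rfl⟩ := Nat.exists_eq_add_of_le' hn
  rw [Finset.sum_range_succ', Finset.sum_range_succ']
  simp [C, h0, add_comm]

theorem IsLevyBasis.ae_biUnion (hΛ : IsLevyBasis P Λ) {ι : Type*} (s : Finset ι)
    {B : ι → Set (S × ℝ)} (hB : ∀ i ∈ s, B i ∈ BoundedBorel S)
    (hd : (s : Set ι).PairwiseDisjoint B) :
    Λ (⋃ i ∈ s, B i) =ᵐ[P] fun ω => ∑ i ∈ s, Λ (B i) ω := by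
  classical
  induction s using Finset.induction_on with
  | empty =>
    filter_upwards [hΛ.ae_empty] with ω hω
    simpa using hω
  | insert a s ha ih =>
    rw [Finset.set_biUnion_insert]
    have ih' := ih (fun i hi => hB i (by simp [hi])) (hd.subset (by simp))
    have hu := hΛ.ae_union (hB a (by simp)) (boundedBorel_biUnion s fun i hi => hB i (by simp [hi]))
      (by
        rw [disjoint_iUnion₂_right]
        intro i hi
        exact hd (by simp) (by simp [hi]) (by rintro rfl; exact ha hi))
    filter_upwards [ih', hu] with ω h1 h2
    rw [h2, h1, Finset.sum_insert ha]

theorem HasGeneratingQuadruple.lintegral_enorm_le [IsProbabilityMeasure P] {π : Measure S}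
    [IsFiniteMeasure π] {γ : ℝ} {ν : Measure ℝ}
    (hq : HasGeneratingQuadruple P Λ γ 0 ν π) (hΛ : IsLevyBasis P Λ)
    (hν : Integrable (fun x : ℝ => x) ν) {B : Set (S × ℝ)} (hB : B ∈ BoundedBorel S) :
    ∫⁻ ω, ‖Λ B ω‖ₑ ∂P
      ≤ momentConst * ENNReal.ofReal (levyMass γ ν) * (π.prod volume) B := by
  have := lintegral_enorm_le_of_charFun (γ := γ) hν (hΛ.measurable B hB) ENNReal.toReal_nonneg
    (hq.charFun_eq B hB)
  rwa [ENNReal.ofReal_toReal (boundedBorel_measure_lt_top π hB).ne] at this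

/-- Only nonzero values are allowed: the zero fibre is usually unbounded, where nothing is known of
Λ. In integrals of simple functions it carries the factor 0. -/
theorem support_fiber_mem_boundedBorel {β : Type*} {χ : SimpleFunc (S × ℝ) β} {g : β → ℝ}
    (hs : Function.support (χ.map g) ∈ BoundedBorel S) {A : Set (S × ℝ)} (hA : MeasurableSet A)
    {z : β} (hz : g z ≠ 0) : A ∩ χ ⁻¹' {z} ∈ BoundedBorel S := by
  refine boundedBorel_mono hs (hA.inter (χ.measurableSet_fiber z)) ?_
  rintro p ⟨_, hp⟩
  simp only [mem_preimage, mem_singleton_iff] at hp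
  simp [hp, hz]

theorem fiber_mem_boundedBorel {φ : SimpleFunc (S × ℝ) ℝ}
    (hs : Function.support φ ∈ BoundedBorel S) {A : Set (S × ℝ)} (hA : MeasurableSet A)
    {y : ℝ} (hy : y ≠ 0) : A ∩ φ ⁻¹' {y} ∈ BoundedBorel S :=
  support_fiber_mem_boundedBorel (χ := φ) (g := id) (by simpa using hs) hA hy

/-- The integral of a simple function can be computed from any finer partition. -/
theorem IsLevyBasis.simpleIntegral_map (hΛ : IsLevyBasis P Λ) {β : Type*}
    (χ : SimpleFunc (S × ℝ) β) (g : β → ℝ)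
    (hs : Function.support (χ.map g) ∈ BoundedBorel S) {A : Set (S × ℝ)} (hA : MeasurableSet A) :
    simpleIntegral Λ (χ.map g) A =ᵐ[P] fun ω => ∑ z ∈ χ.range, g z * Λ (A ∩ χ ⁻¹' {z}) ω := by
  classical
  have h : ∀ y ∈ (χ.map g).range, ∀ᵐ ω ∂P, y * Λ (A ∩ (χ.map g) ⁻¹' {y}) ω
      = ∑ z ∈ χ.range with g z = y, g z * Λ (A ∩ χ ⁻¹' {z}) ω := by
    intro y _
    rcases eq_or_ne y 0 with rfl | hy
    · refine ae_of_all _ fun ω => ?_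
      rw [zero_mul, Finset.sum_eq_zero]
      intro z hz
      rw [(Finset.mem_filter.1 hz).2, zero_mul]
    · have hU : A ∩ (χ.map g) ⁻¹' {y}
          = ⋃ z ∈ Finset.filter (fun z => g z = y) χ.range, A ∩ χ ⁻¹' {z} := by
        ext p
        simp only [SimpleFunc.coe_map, mem_inter_iff, mem_preimage, Function.comp_apply,
          mem_singleton_iff, Finset.mem_filter, mem_iUnion, exists_prop]
        constructor
        · rintro ⟨h1, h2⟩
          exact ⟨χ p, ⟨χ.mem_range_self p, h2⟩, h1, rfl⟩
        · rintro ⟨z, ⟨_, h2⟩, h3, h4⟩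
          exact ⟨h3, by rw [h4, h2]⟩
      have := hΛ.ae_biUnion (Finset.filter (fun z => g z = y) χ.range)
        (B := fun z => A ∩ χ ⁻¹' {z})
        (fun z hz => support_fiber_mem_boundedBorel hs hA
          (by rw [(Finset.mem_filter.1 hz).2]; exact hy))
        (fun z _ w _ hzw => by
          refine Disjoint.mono inter_subset_right inter_subset_right ?_
          exact Disjoint.preimage _ (by simpa using hzw))
      filter_upwards [this] with ω hω
      rw [hU, hω, Finset.mul_sum]
      refine Finset.sum_congr rfl fun z hz => ?_
      rw [(Finset.mem_filter.1 hz).2]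
  have h' : ∀ᵐ ω ∂P, ∀ y ∈ (χ.map g).range, y * Λ (A ∩ (χ.map g) ⁻¹' {y}) ω
      = ∑ z ∈ χ.range with g z = y, g z * Λ (A ∩ χ ⁻¹' {z}) ω :=
    (Finset.eventually_all _).2 h
  filter_upwards [h'] with ω hω
  unfold simpleIntegral
  rw [Finset.sum_congr rfl hω]
  exact Finset.sum_fiberwise_of_maps_to (fun z hz => by
    rw [SimpleFunc.range_map]; exact Finset.mem_image_of_mem g hz) _

theorem IsLevyBasis.simpleIntegral_sub (hΛ : IsLevyBasis P Λ) {φ ψ : SimpleFunc (S × ℝ) ℝ}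
    (hφ : Function.support φ ∈ BoundedBorel S) (hψ : Function.support ψ ∈ BoundedBorel S)
    {A : Set (S × ℝ)} (hA : MeasurableSet A) :
    simpleIntegral Λ (φ - ψ) A
      =ᵐ[P] fun ω => simpleIntegral Λ φ A ω - simpleIntegral Λ ψ A ω := by
  have hsub : Function.support (φ - ψ) ∈ BoundedBorel S := by
    refine boundedBorel_mono (boundedBorel_union hφ hψ) (SimpleFunc.measurableSet_support _) ?_
    exact Function.support_sub _ _
  -- `φ`, `ψ` and `φ - ψ` are all functions of the common refinement `φ.pair ψ`, over which the
  -- three integrals are sums on the same sets.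
  have h1 := hΛ.simpleIntegral_map (φ.pair ψ) (fun p => p.1 - p.2) hsub hA
  have h2 := hΛ.simpleIntegral_map (φ.pair ψ) Prod.fst hφ hA
  have h3 := hΛ.simpleIntegral_map (φ.pair ψ) Prod.snd hψ hA
  have e1 : φ - ψ = (φ.pair ψ).map (fun p => p.1 - p.2) := rfl
  have e2 : φ = (φ.pair ψ).map Prod.fst := rfl
  have e3 : ψ = (φ.pair ψ).map Prod.snd := rfl
  rw [← e1] at h1
  rw [← e2] at h2
  rw [← e3] at h3
  filter_upwards [h1, h2, h3] with ω w1 w2 w3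
  rw [w1, w2, w3, ← Finset.sum_sub_distrib]
  exact Finset.sum_congr rfl fun z _ => by ring

theorem IsLevyBasis.simpleIntegral_union (hΛ : IsLevyBasis P Λ) {φ : SimpleFunc (S × ℝ) ℝ}
    (hφ : Function.support φ ∈ BoundedBorel S)
    {A B : Set (S × ℝ)} (hA : MeasurableSet A) (hB : MeasurableSet B) (hAB : Disjoint A B) :
    simpleIntegral Λ φ (A ∪ B)
      =ᵐ[P] fun ω => simpleIntegral Λ φ A ω + simpleIntegral Λ φ B ω := by
  have h : ∀ᵐ ω ∂P, ∀ y ∈ φ.range, y * Λ ((A ∪ B) ∩ φ ⁻¹' {y}) ω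
      = y * Λ (A ∩ φ ⁻¹' {y}) ω + y * Λ (B ∩ φ ⁻¹' {y}) ω := by
    refine (Finset.eventually_all _).2 fun y _ => ?_
    rcases eq_or_ne y 0 with rfl | hy
    · simp
    · rw [union_inter_distrib_right]
      filter_upwards [hΛ.ae_union (fiber_mem_boundedBorel hφ hA hy)
        (fiber_mem_boundedBorel hφ hB hy)
        (hAB.mono inter_subset_left inter_subset_left)] with ω hω
      rw [hω, mul_add]
  filter_upwards [h] with ω hω
  unfold simpleIntegral
  rw [Finset.sum_congr rfl hω, Finset.sum_add_distrib]

theorem IsLevyBasis.lintegral_simpleIntegral_le (hΛ : IsLevyBasis P Λ) {μ : Measure (S × ℝ)}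
    {C : ℝ≥0∞} (hC : ∀ B ∈ BoundedBorel S, ∫⁻ ω, ‖Λ B ω‖ₑ ∂P ≤ C * μ B)
    {φ : SimpleFunc (S × ℝ) ℝ} (hφ : Function.support φ ∈ BoundedBorel S)
    {A : Set (S × ℝ)} (hA : MeasurableSet A) :
    ∫⁻ ω, ‖simpleIntegral Λ φ A ω‖ₑ ∂P ≤ C * ∫⁻ p in A, ‖φ p‖ₑ ∂μ := by
  have h1 : ∫⁻ p in A, ‖φ p‖ₑ ∂μ = ∑ y ∈ φ.range, ‖y‖ₑ * μ (A ∩ φ ⁻¹' {y}) := by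
    have : ∀ p, ‖φ p‖ₑ = ∑ y ∈ φ.range, (φ ⁻¹' {y}).indicator (fun _ => ‖y‖ₑ) p := by
      intro p
      rw [Finset.sum_eq_single (φ p)]
      · simp
      · intro y _ hy
        exact indicator_of_notMem (by simpa using hy.symm) _
      · intro h
        exact absurd (φ.mem_range_self p) h
    simp_rw [this]
    rw [lintegral_finsetSum _ fun y _ => measurable_const.indicator (φ.measurableSet_fiber y)]
    refine Finset.sum_congr rfl fun y _ => ?_
    rw [lintegral_indicator_const (φ.measurableSet_fiber y),
      Measure.restrict_apply (φ.measurableSet_fiber y), inter_comm]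
  calc ∫⁻ ω, ‖simpleIntegral Λ φ A ω‖ₑ ∂P
      ≤ ∫⁻ ω, ∑ y ∈ φ.range, ‖y * Λ (A ∩ φ ⁻¹' {y}) ω‖ₑ ∂P :=
        lintegral_mono fun ω => enorm_sum_le _ _
    _ = ∑ y ∈ φ.range, ∫⁻ ω, ‖y * Λ (A ∩ φ ⁻¹' {y}) ω‖ₑ ∂P := by
        refine lintegral_finsetSum' _ fun y _ => ?_
        rcases eq_or_ne y 0 with rfl | hy
        · simp
        · have := hΛ.measurable _ (fiber_mem_boundedBorel hφ hA hy)
          fun_prop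
    _ ≤ ∑ y ∈ φ.range, C * (‖y‖ₑ * μ (A ∩ φ ⁻¹' {y})) := by
        refine Finset.sum_le_sum fun y _ => ?_
        rcases eq_or_ne y 0 with rfl | hy
        · simp
        · simp_rw [enorm_mul]
          rw [lintegral_const_mul' _ _ enorm_ne_top, ← mul_assoc, mul_comm C, mul_assoc]
          gcongr
          exact hC _ (fiber_mem_boundedBorel hφ hA hy)
    _ = _ := by rw [h1, Finset.mul_sum]

end Basis

/-- The σ-algebra `m` is left free: it will be the ambient one, the past or the future. -/
theorem measurable_simpleIntegral {S Ω : Type*} [MeasurableSpace S] {m : MeasurableSpace Ω}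
    {Λ : Set (S × ℝ) → Ω → ℝ}
    {φ : SimpleFunc (S × ℝ) ℝ} (hs : Function.support φ ∈ BoundedBorel S) {A : Set (S × ℝ)}
    (hA : MeasurableSet A)
    (h : ∀ B ∈ BoundedBorel S, B ⊆ A → Measurable[m] (Λ B)) :
    Measurable[m] (simpleIntegral Λ φ A) := by
  unfold simpleIntegral
  refine Finset.measurable_fun_sum _ fun y _ => ?_
  rcases eq_or_ne y 0 with rfl | hy
  · simp
  · exact (h _ (fiber_mem_boundedBorel hs hA hy) inter_subset_left).const_mul y

/-! ### Limits in probability of simple integrals -/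

/-- Along successive subsequences all three sequences converge almost everywhere, and pointwise
limits are additive. -/
theorem tendstoInMeasure_add_ae_eq {Ω : Type*} [MeasurableSpace Ω] {P : Measure Ω}
    {f g h : ℕ → Ω → ℝ} {F G H : Ω → ℝ} (hf : TendstoInMeasure P f atTop F)
    (hg : TendstoInMeasure P g atTop G) (hh : TendstoInMeasure P h atTop H)
    (hfg : ∀ n, h n =ᵐ[P] fun ω => f n ω + g n ω) : H =ᵐ[P] fun ω => F ω + G ω := by
  obtain ⟨n1, t1, a1⟩ := hf.exists_seq_tendsto_ae'
  obtain ⟨n2, t2, a2⟩ := (hg.comp t1).exists_seq_tendsto_ae'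
  obtain ⟨n3, t3, a3⟩ := ((hh.comp t1).comp t2).exists_seq_tendsto_ae'
  filter_upwards [a1, a2, a3, ae_all_iff.2 hfg] with ω b1 b2 b3 b4
  refine tendsto_nhds_unique b3 ?_
  have := ((b1.comp t2).comp t3).add (b2.comp t3)
  refine this.congr fun k => ?_
  simp [b4]

theorem exists_tendsto_eLpNorm_of_cauchy {Ω : Type*} [MeasurableSpace Ω] {P : Measure Ω}
    {p : ℝ≥0∞} (hp : 1 ≤ p) {f : ℕ → Ω → ℝ} (hf : ∀ n, MemLp (f n) p P)
    (hc : ∀ ε : ℝ≥0∞, 0 < ε → ∃ N, ∀ m ≥ N, ∀ n ≥ N, eLpNorm (f m - f n) p P < ε) :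
    ∃ F : Ω → ℝ, MemLp F p P ∧ Tendsto (fun n => eLpNorm (f n - F) p P) atTop (𝓝 0) := by
  have : Fact (1 ≤ p) := ⟨hp⟩
  have hcs : CauchySeq fun n => (hf n).toLp (f n) := by
    refine EMetric.cauchySeq_iff.2 fun ε hε => ?_
    simp_rw [Lp.edist_toLp_toLp]
    exact hc ε hε
  obtain ⟨F, hF⟩ := cauchySeq_tendsto_of_complete hcs
  refine ⟨F, Lp.memLp F, ?_⟩
  rw [tendsto_iff_edist_tendsto_0] at hF
  refine hF.congr fun n => ?_
  rw [Lp.edist_def]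
  exact eLpNorm_congr_ae ((hf n).coeFn_toLp.sub (EventuallyEq.refl _ _))

theorem tendstoInMeasure_zero_of_lintegral {Ω : Type*} [MeasurableSpace Ω] {P : Measure Ω}
    {f : ℕ → Ω → ℝ} (hf : ∀ n, AEStronglyMeasurable (f n) P)
    (h : Tendsto (fun n => ∫⁻ ω, ‖f n ω‖ₑ ∂P) atTop (𝓝 0)) :
    TendstoInMeasure P f atTop (fun _ => 0) := by
  refine tendstoInMeasure_of_tendsto_eLpNorm one_ne_zero hf aestronglyMeasurable_const ?_
  refine h.congr fun n => ?_
  rw [eLpNorm_one_eq_lintegral_enorm]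
  simp

/-- A gliding-hump argument: if random set functions `L n`, dominated in mean by densities `h n`
that vanish almost everywhere in the limit, converge in probability on every measurable set, then
the limits are zero. -/
theorem ae_eq_zero_of_gliding_hump {E Ω : Type*} [MeasurableSpace E] [MeasurableSpace Ω]
    {P : Measure Ω} {μ : Measure E} [SigmaFinite μ] {C : ℝ≥0∞} (hC : C ≠ ∞)
    {h : ℕ → E → ℝ} (hm : ∀ n, Measurable (h n)) (hi : ∀ n, ∫⁻ p, ‖h n p‖ₑ ∂μ < ∞)
    (h0 : ∀ᵐ p ∂μ, Tendsto (fun n => h n p) atTop (𝓝 0))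
    {L : ℕ → Set E → Ω → ℝ}
    (Lm : ∀ n A, MeasurableSet A → AEStronglyMeasurable (L n A) P)
    (Ladd : ∀ n A B, MeasurableSet A → MeasurableSet B → Disjoint A B →
      L n (A ∪ B) =ᵐ[P] fun ω => L n A ω + L n B ω)
    (Lb : ∀ n A, MeasurableSet A → ∫⁻ ω, ‖L n A ω‖ₑ ∂P ≤ C * ∫⁻ p in A, ‖h n p‖ₑ ∂μ)
    (Lc : ∀ A, MeasurableSet A → ∃ J, TendstoInMeasure P (fun n => L n A) atTop J)
    {A : Set E} (hA : MeasurableSet A) {J : Ω → ℝ}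
    (hJ : TendstoInMeasure P (fun n => L n A) atTop J) : J =ᵐ[P] fun _ => 0 := by
  -- `w` is a strictly positive integrable threshold. `D n` collects the points where some `h k`
  -- with k ≥ n still exceeds it; as `h` tends to 0 almost everywhere, these sets decrease to a null
  -- set.
  obtain ⟨w, wpos, wm, wi⟩ := exists_pos_lintegral_lt_of_sigmaFinite μ (ε := 1) one_ne_zero
  let D : ℕ → Set E := fun n => ⋃ k ∈ Ici n, {p | (w p : ℝ≥0∞) < ‖h k p‖ₑ}
  have Dm : ∀ n, MeasurableSet (D n) := fun n =>
    MeasurableSet.biUnion (to_countable _) fun k _ =>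
      measurableSet_lt (by fun_prop) (hm k).enorm
  have Danti : Antitone D := fun a b hab =>
    biUnion_subset_biUnion_left (Ici_subset_Ici.2 hab)
  have Dnull : μ (⋂ n, D n) = 0 := by
    refine measure_mono_null (fun p hp => ?_) (ae_iff.1 h0)
    intro ht
    have ht' : Tendsto (fun n => ‖h n p‖ₑ) atTop (𝓝 0) := by
      simpa using ht.enorm
    obtain ⟨N, hN⟩ := eventually_atTop.1
      (ht'.eventually_lt_const (show (0 : ℝ≥0∞) < w p by exact_mod_cast wpos p))
    obtain ⟨k, hk, hk'⟩ := mem_iUnion₂.1 (mem_iInter.1 hp N)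
    exact absurd (hN k hk) (not_lt.2 (le_of_lt hk'))
  have Dtail : ∀ k, Tendsto (fun n => ∫⁻ p in D n, ‖h k p‖ₑ ∂μ) atTop (𝓝 0) := by
    intro k
    have hfin : (μ.withDensity fun p => ‖h k p‖ₑ) (D 0) ≠ ∞ := by
      rw [withDensity_apply _ (Dm 0)]
      exact ((setLIntegral_le_lintegral _ _).trans_lt (hi k)).ne
    have := tendsto_measure_iInter_atTop (μ := μ.withDensity fun p => ‖h k p‖ₑ)
      (fun n => (Dm n).nullMeasurableSet) Danti ⟨0, hfin⟩
    rw [withDensity_absolutelyContinuous μ _ Dnull] at this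
    exact this.congr fun n => by simp [withDensity_apply _ (Dm n)]
  -- Off `D n` the density `h n` is dominated by `w`.
  have Dcompl : Tendsto (fun n => ∫⁻ p in (D n)ᶜ, ‖h n p‖ₑ ∂μ) atTop (𝓝 0) := by
    simp_rw [← lintegral_indicator (Dm _).compl]
    have := tendsto_lintegral_of_dominated_convergence (μ := μ)
      (F := fun n => (D n)ᶜ.indicator fun p => ‖h n p‖ₑ) (f := fun _ => 0) (fun p => (w p : ℝ≥0∞))
      (fun n => (hm n).enorm.indicator (Dm n).compl)
      (fun n => ae_of_all _ fun p => by
        refine indicator_apply_le' (fun hp => ?_) (fun _ => by simp)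
        by_contra hlt
        exact hp (mem_iUnion₂.2 ⟨n, self_mem_Ici, not_le.1 hlt⟩))
      (wi.trans ENNReal.one_lt_top).ne
      (by
        filter_upwards [h0] with p hp
        have hp' : Tendsto (fun n => ‖h n p‖ₑ) atTop (𝓝 0) := by simpa using hp.enorm
        exact tendsto_of_tendsto_of_tendsto_of_le_of_le tendsto_const_nhds hp'
          (fun _ => by simp) (fun n => indicator_le_self _ _ _))
    simpa using this
  -- The indices `s j` are chosen so sparse that `h (s j)` has little mass on `D (s (j + 1))`. As it
  -- also has little mass off `D (s j)`, it is concentrated on the ring `D (s j) \ D (s (j + 1))`: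
  -- these are the humps.
  have hnext : ∀ k : ℕ, ∃ n > k, ∫⁻ p in D n, ‖h k p‖ₑ ∂μ < ((k : ℝ≥0∞) + 1)⁻¹ := by
    intro k
    have := (Dtail k).eventually_lt_const
      (show (0 : ℝ≥0∞) < ((k : ℝ≥0∞) + 1)⁻¹ by
        exact ENNReal.inv_pos.2 (ENNReal.add_ne_top.2 ⟨ENNReal.natCast_ne_top k, by simp⟩))
    obtain ⟨n, h1, h2⟩ := (this.and (eventually_gt_atTop k)).exists
    exact ⟨n, h2, h1⟩
  choose nxt nxt_gt nxt_lt using hnext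
  let s : ℕ → ℕ := fun j => nxt^[j] 0
  have s_succ : ∀ j, s (j + 1) = nxt (s j) := fun j => Function.iterate_succ_apply' nxt j 0
  have s_mono : StrictMono s := strictMono_nat_of_lt_succ fun j => by
    rw [s_succ]; exact nxt_gt _
  have tail : Tendsto (fun j => ∫⁻ p in D (s (j + 1)), ‖h (s j) p‖ₑ ∂μ) atTop (𝓝 0) := by
    have hinv : Tendsto (fun k : ℕ => ((k : ℝ≥0∞) + 1)⁻¹) atTop (𝓝 0) := by
      have := (tendsto_add_atTop_iff_nat (f := fun k : ℕ => (k : ℝ≥0∞)⁻¹) 1).2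
        ENNReal.tendsto_inv_nat_nhds_zero
      simpa using this
    refine tendsto_of_tendsto_of_tendsto_of_le_of_le tendsto_const_nhds
      (hinv.comp s_mono.tendsto_atTop) (fun _ => by simp) (fun j => ?_)
    rw [s_succ]
    exact (nxt_lt (s j)).le
  -- along a subsequence avoiding the rings, the integrals vanish
  have vanish : ∀ (i : ℕ → ℕ), StrictMono i → ∀ B, MeasurableSet B →
      (∀ k, B ⊆ (D (s (i k)))ᶜ ∪ D (s (i k + 1))) →
      ∀ K, TendstoInMeasure P (fun n => L n B) atTop K → K =ᵐ[P] fun _ => 0 := by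
    intro i himono B hB hsub K hK
    have hsi : Tendsto (fun k => s (i k)) atTop atTop :=
      s_mono.tendsto_atTop.comp himono.tendsto_atTop
    have hz : TendstoInMeasure P (fun k => L (s (i k)) B) atTop (fun _ => 0) := by
      refine tendstoInMeasure_zero_of_lintegral (fun k => Lm _ _ hB) ?_
      have hlim : Tendsto (fun k => C * (∫⁻ p in (D (s (i k)))ᶜ, ‖h (s (i k)) p‖ₑ ∂μ
          + ∫⁻ p in D (s (i k + 1)), ‖h (s (i k)) p‖ₑ ∂μ)) atTop (𝓝 (C * (0 + 0))) :=
        ENNReal.Tendsto.const_mul ((Dcompl.comp hsi).add (tail.comp himono.tendsto_atTop))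
          (Or.inr hC)
      simp only [add_zero, mul_zero] at hlim
      refine tendsto_of_tendsto_of_tendsto_of_le_of_le tendsto_const_nhds hlim
        (fun _ => by simp) (fun k => (Lb _ _ hB).trans ?_)
      gcongr
      exact (lintegral_mono_set (hsub k)).trans (lintegral_union_le _ _ _)
    exact tendstoInMeasure_ae_unique (hK.comp hsi) hz
  -- `R` is the union of the even rings. On `A ∩ R` the odd humps are negligible, on `A \ R` the
  -- even ones. Since the full sequence converges in probability on both sets, each limit is
  -- determined by that subsequence and is 0.
  let R : Set E := ⋃ i : ℕ, D (s (2 * i)) \ D (s (2 * i + 1))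
  have Rm : MeasurableSet R := MeasurableSet.iUnion fun i => (Dm _).diff (Dm _)
  obtain ⟨J1, hJ1⟩ := Lc (A ∩ R) (hA.inter Rm)
  obtain ⟨J2, hJ2⟩ := Lc (A \ R) (hA.diff Rm)
  have z1 : J1 =ᵐ[P] fun _ => 0 := by
    refine vanish (fun k => 2 * k + 1) (fun a b hab => by simpa using hab) _ (hA.inter Rm)
      (fun k => ?_) J1 hJ1
    rintro p ⟨_, hp⟩
    obtain ⟨i, hi1, hi2⟩ := mem_iUnion.1 hp
    rcases le_or_gt i k with hik | hik
    · exact Or.inl fun hp' => hi2 (Danti (s_mono.monotone (by omega)) hp')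
    · exact Or.inr (Danti (s_mono.monotone (by omega)) hi1)
  have z2 : J2 =ᵐ[P] fun _ => 0 := by
    refine vanish (fun k => 2 * k) (fun a b hab => by simpa using hab) _ (hA.diff Rm)
      (fun k => ?_) J2 hJ2
    rintro p ⟨_, hp⟩
    by_contra hcon
    simp only [mem_union, mem_compl_iff, not_or, not_not] at hcon
    exact hp (mem_iUnion.2 ⟨k, hcon.1, hcon.2⟩)
  have hsum := tendstoInMeasure_add_ae_eq hJ1 hJ2 hJ fun n => by
    have := Ladd n (A ∩ R) (A \ R) (hA.inter Rm) (hA.diff Rm)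
      (disjoint_sdiff_right.mono_left inter_subset_right)
    rwa [inter_union_sdiff] at this
  filter_upwards [hsum, z1, z2] with ω w1 w2 w3
  rw [w1, w2, w3, add_zero]

theorem exists_simpleFunc_approx {S : Type*} [MeasurableSpace S] {μ : Measure (S × ℝ)}
    {g : S × ℝ → ℝ} (hg : Measurable g) (hgi : Integrable g μ) :
    ∃ ψ : ℕ → SimpleFunc (S × ℝ) ℝ, (∀ n, Function.support (ψ n) ∈ BoundedBorel S) ∧
      (∀ p, Tendsto (fun n => ψ n p) atTop (𝓝 (g p))) ∧
      Tendsto (fun n => ∫⁻ p, ‖ψ n p - g p‖ₑ ∂μ) atTop (𝓝 0) := by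
  let T : ℕ → Set (S × ℝ) := fun n => univ ×ˢ Icc (-(n : ℝ)) n
  have Tm : ∀ n, MeasurableSet (T n) := fun n => MeasurableSet.univ.prod measurableSet_Icc
  let a : ℕ → SimpleFunc (S × ℝ) ℝ := fun n =>
    SimpleFunc.approxOn g hg univ 0 (mem_univ _) n
  let ψ : ℕ → SimpleFunc (S × ℝ) ℝ := fun n => (a n).restrict (T n)
  have ψ_apply : ∀ n p, ψ n p = (T n).indicator (a n) p := fun n p => by
    rw [SimpleFunc.coe_restrict _ (Tm n)]
  have hlim : ∀ p, Tendsto (fun n => ψ n p) atTop (𝓝 (g p)) := by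
    intro p
    have h1 : Tendsto (fun n => a n p) atTop (𝓝 (g p)) :=
      SimpleFunc.tendsto_approxOn hg (mem_univ _) (by simp)
    refine h1.congr' ?_
    obtain ⟨N, hN⟩ := exists_nat_ge |p.2|
    filter_upwards [eventually_ge_atTop N] with n hn
    rw [ψ_apply, indicator_of_mem]
    have : |p.2| ≤ n := hN.trans (by exact_mod_cast hn)
    exact ⟨mem_univ _, abs_le.1 this⟩
  refine ⟨ψ, fun n => ⟨SimpleFunc.measurableSet_support _, n, ?_⟩, hlim, ?_⟩
  · intro p hp
    rw [Function.mem_support, ψ_apply] at hp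
    exact mem_of_indicator_ne_zero hp
  · have hbound : ∀ n p, ‖ψ n p - g p‖ ≤ 3 * ‖g p‖ := by
      intro n p
      have h1 : ‖ψ n p‖ ≤ ‖g p‖ + ‖g p‖ := by
        rw [ψ_apply]
        refine (norm_indicator_le_norm_self _ _).trans ?_
        exact SimpleFunc.norm_approxOn_zero_le hg (mem_univ _) p n
      linarith [norm_sub_le (ψ n p) (g p)]
    have := tendsto_lintegral_of_dominated_convergence (μ := μ)
      (F := fun n p => ‖ψ n p - g p‖ₑ) (f := fun _ => 0) (fun p => ‖3 * g p‖ₑ)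
      (fun n => ((ψ n).measurable.sub hg).enorm)
      (fun n => ae_of_all _ fun p => by
        refine enorm_le_iff_norm_le.2 ((hbound n p).trans ?_)
        simp [norm_mul])
      (hgi.const_mul 3).2.ne
      (ae_of_all _ fun p => by
        have := ((hlim p).sub_const (g p)).enorm
        simpa using this)
    simpa using this

theorem lintegral_enorm_lt_top_of_support {S : Type*} [MeasurableSpace S] {π : Measure S}
    [IsFiniteMeasure π] {φ : SimpleFunc (S × ℝ) ℝ}
    (hφ : Function.support φ ∈ BoundedBorel S) :
    ∫⁻ p, ‖φ p‖ₑ ∂(π.prod volume) < ∞ :=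
  (SimpleFunc.integrable_iff_finMeasSupp.2 (SimpleFunc.finMeasSupp_iff_support.2
    (boundedBorel_measure_lt_top π hφ))).2

/-- First-moment bound for the limits in probability defining the integral with respect to a
Lévy basis. -/
theorem IsLevyBasis.lintegral_limit_le {S Ω : Type*} [MeasurableSpace S] [MeasurableSpace Ω]
    {P : Measure Ω} {π : Measure S} [IsFiniteMeasure π] {Λ : Set (S × ℝ) → Ω → ℝ}
    (hΛ : IsLevyBasis P Λ) {C : ℝ≥0∞} (hCt : C ≠ ∞)
    (hC : ∀ B ∈ BoundedBorel S, ∫⁻ ω, ‖Λ B ω‖ₑ ∂P ≤ C * (π.prod volume) B)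
    {g : S × ℝ → ℝ} (hg : Measurable g) (hgi : Integrable g (π.prod volume))
    {φ : ℕ → SimpleFunc (S × ℝ) ℝ} (hφ : ∀ n, Function.support (φ n) ∈ BoundedBorel S)
    (hlim : ∀ᵐ p ∂(π.prod volume), Tendsto (fun n => φ n p) atTop (𝓝 (g p)))
    (hconv : ∀ A : Set (S × ℝ), MeasurableSet A → ∃ J : Ω → ℝ,
      TendstoInMeasure P (fun n => simpleIntegral Λ (φ n) A) atTop J)
    {A : Set (S × ℝ)} (hA : MeasurableSet A) {J : Ω → ℝ}
    (hJ : TendstoInMeasure P (fun n => simpleIntegral Λ (φ n) A) atTop J) :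
    ∫⁻ ω, ‖J ω‖ₑ ∂P ≤ C * ∫⁻ p in A, ‖g p‖ₑ ∂(π.prod volume) := by
  -- The sequence `φ` need not converge in L¹. It is compared with a sequence `ψ` that does, whose
  -- integrals converge in L¹(P) by the first-moment bound.
  obtain ⟨ψ, hψ, ψlim, ψL1⟩ := exists_simpleFunc_approx (μ := π.prod volume) hg hgi
  have meas : ∀ (χ : SimpleFunc (S × ℝ) ℝ), Function.support χ ∈ BoundedBorel S →
      ∀ B, MeasurableSet B → Measurable (simpleIntegral Λ χ B) := fun χ hχ B hB =>
    measurable_simpleIntegral hχ hB fun D hD _ => hΛ.measurable D hD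
  -- the good approximations converge in `L¹`
  have good : ∀ B, MeasurableSet B → ∃ K : Ω → ℝ, MemLp K 1 P ∧
      Tendsto (fun n => eLpNorm (simpleIntegral Λ (ψ n) B - K) 1 P) atTop (𝓝 0) := by
    intro B hB
    have bd : ∀ m n, eLpNorm (simpleIntegral Λ (ψ m) B - simpleIntegral Λ (ψ n) B) 1 P
        ≤ C * (∫⁻ p, ‖ψ m p - g p‖ₑ ∂(π.prod volume)
          + ∫⁻ p, ‖ψ n p - g p‖ₑ ∂(π.prod volume)) := by
      intro m n
      have e := hΛ.simpleIntegral_sub (hψ m) (hψ n) hB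
      have e' : eLpNorm (simpleIntegral Λ (ψ m) B - simpleIntegral Λ (ψ n) B) 1 P
          = eLpNorm (simpleIntegral Λ (ψ m - ψ n) B) 1 P := eLpNorm_congr_ae e.symm
      rw [e', eLpNorm_one_eq_lintegral_enorm]
      refine (hΛ.lintegral_simpleIntegral_le hC ?_ hB).trans ?_
      · exact boundedBorel_mono (boundedBorel_union (hψ m) (hψ n))
          (SimpleFunc.measurableSet_support _) (Function.support_sub _ _)
      · gcongr
        refine (setLIntegral_le_lintegral _ _).trans ?_
        rw [← lintegral_add_left (show Measurable fun p => ‖ψ m p - g p‖ₑ from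
          ((ψ m).measurable.sub hg).enorm)]
        refine lintegral_mono fun p => ?_
        have : (ψ m - ψ n) p = (ψ m p - g p) - (ψ n p - g p) := by simp
        rw [this]
        exact enorm_sub_le
    refine exists_tendsto_eLpNorm_of_cauchy le_rfl (fun n => ?_) fun ε hε => ?_
    · refine memLp_one_iff_integrable.2 ⟨(meas _ (hψ n) B hB).aestronglyMeasurable, ?_⟩
      refine lt_of_le_of_lt (hΛ.lintegral_simpleIntegral_le hC (hψ n) hB) ?_
      exact ENNReal.mul_lt_top hCt.lt_top ((setLIntegral_le_lintegral _ _).trans_lt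
        (lintegral_enorm_lt_top_of_support (hψ n)))
    · have hl : Tendsto (fun q : ℕ × ℕ => C * (∫⁻ p, ‖ψ q.1 p - g p‖ₑ ∂(π.prod volume)
          + ∫⁻ p, ‖ψ q.2 p - g p‖ₑ ∂(π.prod volume))) (atTop ×ˢ atTop) (𝓝 (C * (0 + 0))) :=
        ENNReal.Tendsto.const_mul ((ψL1.comp tendsto_fst).add (ψL1.comp tendsto_snd))
          (Or.inr hCt)
      simp only [add_zero, mul_zero] at hl
      rw [prod_atTop_atTop_eq] at hl
      obtain ⟨⟨N1, N2⟩, hN⟩ := eventually_atTop.1 (hl.eventually_lt_const hε)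
      refine ⟨max N1 N2, fun m hm n hn => (bd m n).trans_lt (hN (m, n) ?_)⟩
      exact ⟨(le_max_left _ _).trans hm, (le_max_right _ _).trans hn⟩
  have good' : ∀ B, MeasurableSet B → ∃ K : Ω → ℝ,
      TendstoInMeasure P (fun n => simpleIntegral Λ (ψ n) B) atTop K := fun B hB => by
    obtain ⟨K, hK, hK'⟩ := good B hB
    exact ⟨K, tendstoInMeasure_of_tendsto_eLpNorm one_ne_zero
      (fun n => (meas _ (hψ n) B hB).aestronglyMeasurable) hK.1 hK'⟩
  have hdiff : ∀ {f1 f2 : ℕ → Ω → ℝ} {F1 F2 : Ω → ℝ}, TendstoInMeasure P f1 atTop F1 →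
      TendstoInMeasure P f2 atTop F2 →
      TendstoInMeasure P (fun n ω => f1 n ω - f2 n ω) atTop (fun ω => F1 ω - F2 ω) := by
    intro f1 f2 F1 F2 h1 h2
    rw [tendstoInMeasure_iff_enorm] at *
    intro ε hε hε'
    have hε2 : ε / 2 ≠ 0 := (ENNReal.half_pos hε.ne').ne'
    have hε2t : ε / 2 ≠ ∞ := ENNReal.div_ne_top hε' (by simp)
    have := (h1 (ε / 2) (pos_iff_ne_zero.2 hε2) hε2t).add (h2 (ε / 2) (pos_iff_ne_zero.2 hε2) hε2t)
    rw [add_zero] at this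
    refine tendsto_of_tendsto_of_tendsto_of_le_of_le tendsto_const_nhds this
      (fun _ => by simp) (fun n => (measure_mono fun ω hω => ?_).trans (measure_union_le _ _))
    by_contra hcon
    simp only [mem_union, mem_ofPred_eq, not_or, not_le] at hcon hω
    have e : f1 n ω - f2 n ω - (F1 ω - F2 ω) = (f1 n ω - F1 ω) - (f2 n ω - F2 ω) := by ring
    rw [e] at hω
    have := (hω.trans enorm_sub_le).trans_lt (ENNReal.add_lt_add hcon.1 hcon.2)
    rw [ENNReal.add_halves] at this
    exact lt_irrefl _ this
  obtain ⟨K, hK⟩ := good' A hA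
  -- `φ n - ψ n` tends to 0 almost everywhere and its integrals converge in probability over every
  -- Borel set, which is what the gliding hump needs.
  have hzero : (fun ω => J ω - K ω) =ᵐ[P] fun _ => 0 := by
    refine ae_eq_zero_of_gliding_hump (μ := π.prod volume) (C := C) hCt
      (h := fun n => ⇑(φ n - ψ n))
      (L := fun n B ω => simpleIntegral Λ (φ n) B ω - simpleIntegral Λ (ψ n) B ω)
      (fun n => (φ n - ψ n).measurable) (fun n => ?_) ?_ (fun n B hB => ?_)
      (fun n B B' hB hB' hBB' => ?_) (fun n B hB => ?_) (fun B hB => ?_) hA (hdiff hJ hK)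
    · refine lintegral_enorm_lt_top_of_support (boundedBorel_mono (boundedBorel_union (hφ n) (hψ n))
        (SimpleFunc.measurableSet_support _) (Function.support_sub _ _))
    · filter_upwards [hlim] with p hp
      simpa using hp.sub (ψlim p)
    · exact ((meas _ (hφ n) B hB).sub (meas _ (hψ n) B hB)).aestronglyMeasurable
    · filter_upwards [hΛ.simpleIntegral_union (hφ n) hB hB' hBB',
        hΛ.simpleIntegral_union (hψ n) hB hB' hBB'] with ω w1 w2
      rw [w1, w2]; ring
    · have e : ∫⁻ ω, ‖simpleIntegral Λ (φ n) B ω - simpleIntegral Λ (ψ n) B ω‖ₑ ∂P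
          = ∫⁻ ω, ‖simpleIntegral Λ (φ n - ψ n) B ω‖ₑ ∂P := by
        refine lintegral_congr_ae ?_
        filter_upwards [hΛ.simpleIntegral_sub (hφ n) (hψ n) hB] with ω w
        rw [w]
      rw [e]
      exact hΛ.lintegral_simpleIntegral_le hC (boundedBorel_mono
        (boundedBorel_union (hφ n) (hψ n)) (SimpleFunc.measurableSet_support _)
        (Function.support_sub _ _)) hB
    · obtain ⟨J', hJ'⟩ := hconv B hB
      obtain ⟨K', hK'⟩ := good' B hB
      exact ⟨_, hdiff hJ' hK'⟩
  have hJK : J =ᵐ[P] K := by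
    filter_upwards [hzero] with ω w using sub_eq_zero.1 w
  have hbd : ∀ n, eLpNorm (simpleIntegral Λ (ψ n) A) 1 P
      ≤ C * (∫⁻ p in A, ‖g p‖ₑ ∂(π.prod volume) + ∫⁻ p, ‖ψ n p - g p‖ₑ ∂(π.prod volume)) := by
    intro n
    rw [eLpNorm_one_eq_lintegral_enorm]
    refine (hΛ.lintegral_simpleIntegral_le hC (hψ n) hA).trans ?_
    gcongr
    refine le_trans ?_ (add_le_add le_rfl (setLIntegral_le_lintegral A _))
    rw [← lintegral_add_left hg.enorm]
    refine lintegral_mono fun p => ?_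
    have : ψ n p = g p + (ψ n p - g p) := by ring
    exact (congrArg _ this).trans_le (enorm_add_le _ _)
  have hbl : Tendsto (fun n => C * (∫⁻ p in A, ‖g p‖ₑ ∂(π.prod volume)
      + ∫⁻ p, ‖ψ n p - g p‖ₑ ∂(π.prod volume))) atTop
      (𝓝 (C * (∫⁻ p in A, ‖g p‖ₑ ∂(π.prod volume) + 0))) :=
    ENNReal.Tendsto.const_mul (tendsto_const_nhds.add ψL1) (Or.inr hCt)
  rw [add_zero] at hbl
  rw [lintegral_congr_ae (hJK.mono fun ω w => by rw [w]), ← eLpNorm_one_eq_lintegral_enorm]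
  -- Lower semicontinuity of the L¹ norm under convergence in measure, with an intermediate constant
  -- `c` to absorb the vanishing error.
  refine le_of_forall_gt fun b hb => ?_
  obtain ⟨c, hc1, hc2⟩ := exists_between hb
  refine lt_of_le_of_lt (eLpNorm_le_of_tendstoInMeasure (C := c) ?_ hK fun n =>
    (meas _ (hψ n) A hA).aestronglyMeasurable) hc2
  filter_upwards [hbl.eventually_lt_const hc1] with n hn
  exact (hbd n).trans hn.le

/-! ### Independence of past and future -/

section Independence

variable {Ω : Type*} {mΩ : MeasurableSpace Ω} {P : Measure Ω}

theorem sup_eq_generateFrom_inter (m n : MeasurableSpace Ω) :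
    m ⊔ n = MeasurableSpace.generateFrom
      {s | ∃ a b, MeasurableSet[m] a ∧ MeasurableSet[n] b ∧ a ∩ b = s} := by
  refine le_antisymm (sup_le (fun a ha => ?_) (fun b hb => ?_)) ?_
  · exact MeasurableSpace.measurableSet_generateFrom
      ⟨a, univ, ha, MeasurableSet.univ, inter_univ a⟩
  · exact MeasurableSpace.measurableSet_generateFrom
      ⟨univ, b, MeasurableSet.univ, hb, univ_inter b⟩
  · refine MeasurableSpace.generateFrom_le ?_
    rintro s ⟨a, b, ha, hb, rfl⟩
    exact MeasurableSet.inter ((le_sup_left : m ≤ m ⊔ n) a ha) ((le_sup_right : n ≤ m ⊔ n) b hb)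

theorem isPiSystem_inter (m n : MeasurableSpace Ω) :
    IsPiSystem {s | ∃ a b, MeasurableSet[m] a ∧ MeasurableSet[n] b ∧ a ∩ b = s} := by
  rintro s ⟨a, b, ha, hb, rfl⟩ t ⟨c, d, hc, hd, rfl⟩ _
  exact ⟨a ∩ c, b ∩ d, ha.inter hc, hb.inter hd, inter_inter_inter_comm _ _ _ _⟩

/-- It suffices to test intersections a ∩ b and c ∩ d, which generate the joins. Independence of `m`
and `n` separates the factors of the two sources, and each source then splits by its own
independence. -/
theorem indep_sup_sup [IsProbabilityMeasure P] {m m₁ m₂ n n₁ n₂ : MeasurableSpace Ω}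
    (hm : m ≤ mΩ) (hn : n ≤ mΩ) (hmn : Indep m n P)
    (hm₁ : m₁ ≤ m) (hm₂ : m₂ ≤ m) (hn₁ : n₁ ≤ n) (hn₂ : n₂ ≤ n)
    (h₁ : Indep m₁ m₂ P) (h₂ : Indep n₁ n₂ P) : Indep (m₁ ⊔ n₁) (m₂ ⊔ n₂) P := by
  refine IndepSets.indep (sup_le (hm₁.trans hm) (hn₁.trans hn))
    (sup_le (hm₂.trans hm) (hn₂.trans hn)) (isPiSystem_inter m₁ n₁) (isPiSystem_inter m₂ n₂)
    (sup_eq_generateFrom_inter _ _) (sup_eq_generateFrom_inter _ _) ?_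
  rw [IndepSets_iff]
  rintro s t ⟨a, b, ha, hb, rfl⟩ ⟨c, d, hc, hd, rfl⟩
  rw [Indep_iff] at hmn h₁ h₂
  rw [inter_inter_inter_comm, hmn _ _ ((hm₁ a ha).inter (hm₂ c hc)) ((hn₁ b hb).inter (hn₂ d hd)),
    h₁ a c ha hc, h₂ b d hb hd, hmn a b (hm₁ a ha) (hn₁ b hb), hmn c d (hm₂ c hc) (hn₂ d hd)]
  ring

theorem biSup_comap_eq_comap_pi {ι : Type*} (X : ι → Ω → ℝ) (s : Set ι) :
    ⨆ i ∈ s, MeasurableSpace.comap (X i) inferInstance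
      = MeasurableSpace.comap (fun ω (i : s) => X i ω) MeasurableSpace.pi := by
  rw [MeasurableSpace.pi, MeasurableSpace.comap_iSup, iSup_subtype']
  refine iSup_congr fun i => ?_
  rw [MeasurableSpace.comap_comp]
  rfl

/-- Independence of the σ-algebras generated by infinite families reduces to finite subfamilies,
where it is independence of random vectors. -/
theorem indep_biSup_comap [IsProbabilityMeasure P] {ι κ : Type*} {X : ι → Ω → ℝ} {Y : κ → Ω → ℝ}
    {s : Set ι} {t : Set κ} (hX : ∀ i ∈ s, Measurable (X i)) (hY : ∀ j ∈ t, Measurable (Y j))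
    (h : ∀ (I : Finset ι) (J : Finset κ), (∀ i ∈ I, i ∈ s) → (∀ j ∈ J, j ∈ t) →
      IndepFun (fun ω (i : I) => X i ω) (fun ω (j : J) => Y j ω) P) :
    Indep (⨆ i ∈ s, MeasurableSpace.comap (X i) inferInstance)
      (⨆ j ∈ t, MeasurableSpace.comap (Y j) inferInstance) P := by
  rw [biSup_comap_eq_comap_pi, biSup_comap_eq_comap_pi]
  rw [← IndepFun_iff_Indep]
  refine IndepFun.process_indepFun_process (fun i => hX i i.2) (fun j => hY j j.2) fun I J => ?_
  have := h (I.map (Function.Embedding.subtype _)) (J.map (Function.Embedding.subtype _))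
    (fun i hi => by
      obtain ⟨x, _, rfl⟩ := Finset.mem_map.1 hi
      exact x.2)
    (fun i hi => by
      obtain ⟨x, _, rfl⟩ := Finset.mem_map.1 hi
      exact x.2)
  exact this.comp
    (φ := fun x (i : I) => x ⟨i.1, Finset.mem_map.2 ⟨i.1, i.2, rfl⟩⟩)
    (ψ := fun x (j : J) => x ⟨j.1, Finset.mem_map.2 ⟨j.1, j.2, rfl⟩⟩)
    (by fun_prop) (by fun_prop)

/-- The part of the partition generated by `B` lying in exactly the sets indexed by `σ`. -/
def atom {E ι : Type*} (B : ι → Set E) (σ : Finset ι) : Set E := {p | ∀ i, p ∈ B i ↔ i ∈ σ}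

theorem measurableSet_atom {E ι : Type*} [MeasurableSpace E] [Finite ι] {B : ι → Set E}
    (hB : ∀ i, MeasurableSet (B i)) (σ : Finset ι) : MeasurableSet (atom B σ) := by
  have : atom B σ = ⋂ i, {p | p ∈ B i ↔ i ∈ σ} := by ext; simp [atom]
  rw [this]
  refine MeasurableSet.iInter fun i => ?_
  by_cases hi : i ∈ σ
  · simpa [hi] using hB i
  · simp only [hi, iff_false]
    exact (hB i).compl

theorem disjoint_atom {E ι : Type*} (B : ι → Set E) {σ τ : Finset ι} (h : σ ≠ τ) :
    Disjoint (atom B σ) (atom B τ) :=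
  disjoint_left.2 fun _ hp hq => h (Finset.ext fun i => (hp i).symm.trans (hq i))

theorem atom_subset {E ι : Type*} (B : ι → Set E) {σ : Finset ι} {i : ι} (hi : i ∈ σ) :
    atom B σ ⊆ B i := fun _ hp => (hp i).2 hi

/-- Nonempty index sets suffice. The atom of ∅ is excluded because it lies outside every `B i` and
need not be bounded. -/
theorem biUnion_atom {E ι : Type*} [Fintype ι] [DecidableEq ι] (B : ι → Set E) (i : ι) :
    ⋃ σ ∈ Finset.univ.filter (fun σ : {σ : Finset ι // σ.Nonempty} => i ∈ σ.1), atom B σ.1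
      = B i := by
  classical
  ext p
  simp only [Finset.mem_filter, Finset.mem_univ, true_and, mem_iUnion, exists_prop]
  constructor
  · rintro ⟨σ, h1, h2⟩
    exact atom_subset B h1 h2
  · intro hp
    have hi : i ∈ Finset.univ.filter (fun j => p ∈ B j) := by simpa using hp
    exact ⟨⟨Finset.univ.filter (fun j => p ∈ B j), ⟨i, hi⟩⟩, hi, fun j => by simp⟩

/-- A Lévy basis is independent over pairwise disjoint sets, but the sets inside each family may
overlap. Cutting each family into atoms gives one pairwise disjoint collection in which the two
families occupy separate blocks, and every Λ(B i) is almost surely the sum over its atoms. -/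
theorem IsLevyBasis.indepFun_of_disjoint {S : Type*} [MeasurableSpace S]
    {Λ : Set (S × ℝ) → Ω → ℝ} (hΛ : IsLevyBasis P Λ) {ι κ : Type*} [Fintype ι] [Fintype κ]
    {B : ι → Set (S × ℝ)} {B' : κ → Set (S × ℝ)} (hB : ∀ i, B i ∈ BoundedBorel S)
    (hB' : ∀ i, B' i ∈ BoundedBorel S) (hd : ∀ i j, Disjoint (B i) (B' j)) :
    IndepFun (fun ω i => Λ (B i) ω) (fun ω j => Λ (B' j) ω) P := by
  classical
  let C : {σ : Finset ι // σ.Nonempty} ⊕ {τ : Finset κ // τ.Nonempty} → Set (S × ℝ) :=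
    Sum.elim (fun σ => atom B σ.1) (fun τ => atom B' τ.1)
  have hC : ∀ x, C x ∈ BoundedBorel S := by
    rintro (⟨σ, i, hi⟩ | ⟨τ, j, hj⟩)
    · exact boundedBorel_mono (hB i) (measurableSet_atom (fun i => (hB i).1) σ)
        (atom_subset B hi)
    · exact boundedBorel_mono (hB' j) (measurableSet_atom (fun i => (hB' i).1) τ)
        (atom_subset B' hj)
  have hCd : Pairwise fun x y => Disjoint (C x) (C y) := by
    rintro (⟨σ, i, hi⟩ | ⟨τ, j, hj⟩) (⟨σ', i', hi'⟩ | ⟨τ', j', hj'⟩) hne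
    · exact disjoint_atom B fun h => hne (by subst h; rfl)
    · exact (hd i j').mono (atom_subset B hi) (atom_subset B' hj')
    · exact (hd i' j).symm.mono (atom_subset B' hj) (atom_subset B hi')
    · exact disjoint_atom B' fun h => hne (by subst h; rfl)
  let e := Fintype.equivFin ({σ : Finset ι // σ.Nonempty} ⊕ {τ : Finset κ // τ.Nonempty})
  have hind : iIndepFun (fun x => Λ (C x)) P := by
    have h1 := hΛ.indep _ (fun i => C (e.symm i)) (fun i => hC _)
      (fun i j hij => hCd (fun h => hij (e.symm.injective h)))
    have h2 := h1.precomp e.injective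
    simpa [Function.comp_def] using h2
  have hI := hind.indepFun_finset (Finset.univ.map Function.Embedding.inl)
    (Finset.univ.map Function.Embedding.inr)
    (by
      rw [Finset.disjoint_left]
      intro x hx hy
      obtain ⟨a, _, rfl⟩ := Finset.mem_map.1 hx
      obtain ⟨b, _, hb⟩ := Finset.mem_map.1 hy
      exact absurd hb (by simp))
    (fun x => hΛ.measurable _ (hC x))
  have hI' := hI.comp
    (φ := fun x (i : ι) => ∑ σ ∈ Finset.univ.filter
      (fun σ : {σ : Finset ι // σ.Nonempty} => i ∈ σ.1),
      x ⟨Sum.inl σ, Finset.mem_map.2 ⟨σ, Finset.mem_univ _, rfl⟩⟩)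
    (ψ := fun x (j : κ) => ∑ τ ∈ Finset.univ.filter
      (fun τ : {τ : Finset κ // τ.Nonempty} => j ∈ τ.1),
      x ⟨Sum.inr τ, Finset.mem_map.2 ⟨τ, Finset.mem_univ _, rfl⟩⟩)
    (by fun_prop) (by fun_prop)
  refine hI'.congr ?_ ?_
  · have : ∀ i, Λ (B i) =ᵐ[P] fun ω => ∑ σ ∈ Finset.univ.filter
        (fun σ : {σ : Finset ι // σ.Nonempty} => i ∈ σ.1), Λ (atom B σ.1) ω := fun i => by
      have := hΛ.ae_biUnion (Finset.univ.filter
        (fun σ : {σ : Finset ι // σ.Nonempty} => i ∈ σ.1)) (B := fun σ => atom B σ.1)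
        (fun σ _ => hC (Sum.inl σ))
        (fun σ _ τ _ h => disjoint_atom B fun h' => h (Subtype.ext h'))
      rwa [biUnion_atom] at this
    filter_upwards [ae_all_iff.2 this] with ω hω
    funext i
    simp only [Function.comp_apply]
    rw [hω i]
    rfl
  · have : ∀ i, Λ (B' i) =ᵐ[P] fun ω => ∑ σ ∈ Finset.univ.filter
        (fun σ : {σ : Finset κ // σ.Nonempty} => i ∈ σ.1), Λ (atom B' σ.1) ω := fun i => by
      have := hΛ.ae_biUnion (Finset.univ.filter
        (fun σ : {σ : Finset κ // σ.Nonempty} => i ∈ σ.1)) (B := fun σ => atom B' σ.1)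
        (fun σ _ => hC (Sum.inr σ))
        (fun σ _ τ _ h => disjoint_atom B' fun h' => h (Subtype.ext h'))
      rwa [biUnion_atom] at this
    filter_upwards [ae_all_iff.2 this] with ω hω
    funext i
    simp only [Function.comp_apply]
    rw [hω i]
    rfl

/-- Sort T together with all endpoints. The increments between neighbouring points are independent,
and every past (future) increment telescopes into those before (after) the index of T. -/
theorem HasIndepIncrements.indepFun_past_future {W : ℝ → Ω → ℝ} (hW : HasIndepIncrements W P)
    (hm : ∀ t, Measurable (W t)) (T : ℝ) (I J : Finset (ℝ × ℝ))
    (hI : ∀ p ∈ I, p.1 ≤ p.2 ∧ p.2 ≤ T) (hJ : ∀ p ∈ J, T ≤ p.1 ∧ p.1 ≤ p.2) :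
    IndepFun (fun ω (p : I) => W p.1.2 ω - W p.1.1 ω) (fun ω (p : J) => W p.1.2 ω - W p.1.1 ω)
      P := by
  classical
  let F : Finset ℝ := insert T ((I ∪ J).image Prod.fst ∪ (I ∪ J).image Prod.snd)
  have hTF : T ∈ F := Finset.mem_insert_self _ _
  have h1F : ∀ p ∈ I ∪ J, p.1 ∈ F := fun p hp => Finset.mem_insert_of_mem
    (Finset.mem_union_left _ (Finset.mem_image_of_mem _ hp))
  have h2F : ∀ p ∈ I ∪ J, p.2 ∈ F := fun p hp => Finset.mem_insert_of_mem
    (Finset.mem_union_right _ (Finset.mem_image_of_mem _ hp))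
  have hpos : 0 < F.card := Finset.card_pos.2 ⟨T, hTF⟩
  -- The sorted points, continued constantly after the last one to give a monotone sequence on all
  -- of ℕ; `k` below is the rank of a point, with value 0 off `F`.
  let t : ℕ → ℝ := fun n => F.orderEmbOfFin rfl ⟨min n (F.card - 1), by omega⟩
  have ht : Monotone t := fun a b hab => (F.orderEmbOfFin rfl).monotone
    (by simp only [Fin.mk_le_mk]; omega)
  let k : ℝ → ℕ := fun x => if hx : x ∈ F then ((F.orderIsoOfFin rfl).symm ⟨x, hx⟩ : ℕ) else 0
  have hk : ∀ x ∈ F, t (k x) = x := by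
    intro x hx
    have hlt := ((F.orderIsoOfFin rfl).symm ⟨x, hx⟩).2
    simp only [t, k, dif_pos hx]
    have : (⟨min ((F.orderIsoOfFin rfl).symm ⟨x, hx⟩ : ℕ) (F.card - 1), by omega⟩ : Fin F.card)
        = (F.orderIsoOfFin rfl).symm ⟨x, hx⟩ := by
      ext; simp only; omega
    rw [this, ← Finset.coe_orderIsoOfFin_apply]
    simp
  have hkN : ∀ x ∈ F, k x ≤ F.card := by
    intro x hx
    simp only [k, dif_pos hx]
    exact ((F.orderIsoOfFin rfl).symm ⟨x, hx⟩).2.le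
  have hkm : ∀ x ∈ F, ∀ y ∈ F, x ≤ y → k x ≤ k y := by
    intro x hx y hy hxy
    simp only [k, dif_pos hx, dif_pos hy]
    exact (F.orderIsoOfFin rfl).symm.monotone (show (⟨x, hx⟩ : F) ≤ ⟨y, hy⟩ from hxy)
  have htel : ∀ x ∈ F, ∀ y ∈ F, x ≤ y → ∀ ω, W y ω - W x ω
      = ∑ l ∈ Finset.Ico (k x) (k y), (W (t (l + 1)) ω - W (t l) ω) := by
    intro x hx y hy hxy ω
    rw [Finset.sum_Ico_sub (fun l => W (t l) ω) (hkm x hx y hy hxy), hk x hx, hk y hy]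
  have hind := (hW.nat ht).indepFun_finset (Finset.range (k T)) (Finset.Ico (k T) F.card)
    (by
      rw [Finset.disjoint_left]
      intro a ha hb
      simp only [Finset.mem_range, Finset.mem_Ico] at ha hb
      omega)
    (fun l => (hm _).sub (hm _))
  have hsum : ∀ (A : Finset ℕ) (x y : ℝ) (d : ℕ → ℝ), Finset.Ico (k x) (k y) ⊆ A →
      ∑ l ∈ Finset.Ico (k x) (k y), d l
        = ∑ l : A, if k x ≤ l.1 ∧ l.1 < k y then d l else 0 := by
    intro A x y d hA
    rw [Finset.sum_coe_sort A fun l => if k x ≤ l ∧ l < k y then d l else 0,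
      ← Finset.sum_filter]
    refine Finset.sum_congr ?_ fun _ _ => rfl
    ext l
    simp only [Finset.mem_filter, ← Finset.mem_Ico]
    exact ⟨fun h => ⟨hA h, h⟩, fun h => h.2⟩
  have h := hind.comp
    (φ := fun (x : Finset.range (k T) → ℝ) (p : I) =>
      ∑ l, if k p.1.1 ≤ l.1 ∧ l.1 < k p.1.2 then x l else 0)
    (ψ := fun (x : Finset.Ico (k T) F.card → ℝ) (p : J) =>
      ∑ l, if k p.1.1 ≤ l.1 ∧ l.1 < k p.1.2 then x l else 0)
    (by
      refine measurable_pi_lambda _ fun p => Finset.measurable_fun_sum _ fun l _ => ?_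
      split_ifs <;> fun_prop)
    (by
      refine measurable_pi_lambda _ fun p => Finset.measurable_fun_sum _ fun l _ => ?_
      split_ifs <;> fun_prop)
  convert h using 1
  · funext ω p
    have hp := Finset.mem_union_left J p.2
    rw [htel _ (h1F _ hp) _ (h2F _ hp) (hI _ p.2).1, hsum (Finset.range (k T))]
    · rfl
    · intro l hl
      have := hkm _ (h2F _ hp) _ hTF (hI _ p.2).2
      simp only [Finset.mem_range, Finset.mem_Ico] at hl ⊢
      omega
  · funext ω p
    have hp := Finset.mem_union_right I p.2
    rw [htel _ (h1F _ hp) _ (h2F _ hp) (hJ _ p.2).2, hsum (Finset.Ico (k T) F.card)]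
    · rfl
    · intro l hl
      have := hkm _ hTF _ (h1F _ hp) (hJ _ p.2).1
      have := hkN _ (h2F _ hp)
      simp only [Finset.mem_Ico] at hl ⊢
      omega

theorem indep_eventuallyMeasurableSpace {m n : MeasurableSpace Ω} (h : Indep m n P) :
    Indep (eventuallyMeasurableSpace m (ae P)) n P := by
  rw [Indep_iff] at h ⊢
  rintro s t ⟨s', hs', hss'⟩ ht
  rw [measure_congr (hss'.inter (EventuallyEq.refl _ t)), measure_congr hss', h s' t hs' ht]

end Independence

/-- The `σ`-algebra generated by `Λ(B)`, `B ⊆ S × (t, ∞)` bounded Borel, and by the increments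
`W_u - W_s`, `t ≤ s ≤ u`. -/
@[reducible] def futureSigma {S Ω : Type*} [MeasurableSpace S]
    (Λ : Set (S × ℝ) → Ω → ℝ) (W : ℝ → Ω → ℝ) (t : ℝ) : MeasurableSpace Ω :=
  (⨆ B ∈ {B ∈ BoundedBorel S | B ⊆ univ ×ˢ Ioi t}, MeasurableSpace.comap (Λ B) inferInstance) ⊔
  (⨆ p ∈ {p : ℝ × ℝ | t ≤ p.1 ∧ p.1 ≤ p.2},
    MeasurableSpace.comap (fun ω => W p.2 ω - W p.1 ω) inferInstance)

/-! ### Generators of the past and future σ-algebras -/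

section GeneratedSigma

variable {S Ω : Type*} [MeasurableSpace S] {Λ : Set (S × ℝ) → Ω → ℝ} {W : ℝ → Ω → ℝ}

theorem measurable_increment_futureSigma {s u t : ℝ} (hts : t ≤ s) (hsu : s ≤ u) :
    Measurable[futureSigma Λ W t] (fun ω => W u ω - W s ω) := by
  have h1 : MeasurableSpace.comap (fun ω => W u ω - W s ω) inferInstance ≤ futureSigma Λ W t :=
    le_sup_of_le_right (le_iSup₂_of_le (f := fun (p : ℝ × ℝ)
      (_ : p ∈ {p : ℝ × ℝ | t ≤ p.1 ∧ p.1 ≤ p.2}) =>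
        MeasurableSpace.comap (fun ω => W p.2 ω - W p.1 ω) inferInstance) (s, u) ⟨hts, hsu⟩ le_rfl)
  exact (comap_measurable _).mono h1 le_rfl

theorem measurable_basis_pastSigma {B : Set (S × ℝ)} (hB : B ∈ BoundedBorel S) {t : ℝ}
    (h : B ⊆ univ ×ˢ Iic t) : Measurable[pastSigma Λ W t] (Λ B) := by
  have h1 : MeasurableSpace.comap (Λ B) inferInstance ≤ pastSigma Λ W t :=
    le_sup_of_le_left (le_iSup₂_of_le (f := fun (B : Set (S × ℝ))
      (_ : B ∈ {B ∈ BoundedBorel S | B ⊆ univ ×ˢ Iic t}) =>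
        MeasurableSpace.comap (Λ B) inferInstance) B ⟨hB, h⟩ le_rfl)
  exact (comap_measurable _).mono h1 le_rfl

theorem measurable_basis_futureSigma {B : Set (S × ℝ)} (hB : B ∈ BoundedBorel S) {t : ℝ}
    (h : B ⊆ univ ×ˢ Ioi t) : Measurable[futureSigma Λ W t] (Λ B) := by
  have h1 : MeasurableSpace.comap (Λ B) inferInstance ≤ futureSigma Λ W t :=
    le_sup_of_le_left (le_iSup₂_of_le (f := fun (B : Set (S × ℝ))
      (_ : B ∈ {B ∈ BoundedBorel S | B ⊆ univ ×ˢ Ioi t}) =>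
        MeasurableSpace.comap (Λ B) inferInstance) B ⟨hB, h⟩ le_rfl)
  exact (comap_measurable _).mono h1 le_rfl

end GeneratedSigma

/-! ### The completed filtration and its independence of the future -/

section Filtration

variable {S Ω : Type*} [MeasurableSpace S] [mΩ : MeasurableSpace Ω] {P : Measure Ω}
  {Λ : Set (S × ℝ) → Ω → ℝ} {W : ℝ → Ω → ℝ}

/-- Both sources split at t: Λ because S × (-∞, t] and S × (t, ∞) are disjoint, W by its independent
increments. Independence of W and Λ joins the two splittings. -/
theorem indep_pastSigma_futureSigma [IsProbabilityMeasure P] (hΛ : IsLevyBasis P Λ)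
    (hW : IsBrownianLine P W) (hind : Indep (processSigma W) (basisSigma Λ) P) (t : ℝ) :
    Indep (pastSigma Λ W t) (futureSigma Λ W t) P := by
  have hWle : ∀ s, MeasurableSpace.comap (W s) inferInstance ≤ processSigma W := fun s =>
    le_iSup (fun s => MeasurableSpace.comap (W s) inferInstance) s
  have hinc : ∀ p : ℝ × ℝ,
      MeasurableSpace.comap (fun ω => W p.2 ω - W p.1 ω) inferInstance ≤ processSigma W :=
    fun p => Measurable.comap_le (Measurable.sub
      ((comap_measurable (W p.2)).mono (hWle _) le_rfl)
      ((comap_measurable (W p.1)).mono (hWle _) le_rfl))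
  refine indep_sup_sup (m := basisSigma Λ) (n := processSigma W) ?_ ?_ hind.symm ?_ ?_ ?_ ?_ ?_ ?_
  · exact iSup₂_le fun B hB => (hΛ.measurable B hB).comap_le
  · exact iSup_le fun s => (hW.measurable s).comap_le
  · exact biSup_mono fun B hB => hB.1
  · exact biSup_mono fun B hB => hB.1
  · exact iSup₂_le fun p _ => hinc p
  · exact iSup₂_le fun p _ => hinc p
  · refine indep_biSup_comap (fun B hB => hΛ.measurable B hB.1)
      (fun B hB => hΛ.measurable B hB.1) fun I J hI hJ => ?_
    refine hΛ.indepFun_of_disjoint (B := fun i : I => i.1) (B' := fun j : J => j.1)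
      (fun i => (hI _ i.2).1) (fun j => (hJ _ j.2).1) fun i j => ?_
    refine Disjoint.mono (hI _ i.2).2 (hJ _ j.2).2 ?_
    rw [Set.disjoint_prod]
    exact Or.inr (Iic_disjoint_Ioi le_rfl)
  · exact indep_biSup_comap (X := fun (p : ℝ × ℝ) ω => W p.2 ω - W p.1 ω)
      (Y := fun (p : ℝ × ℝ) ω => W p.2 ω - W p.1 ω)
      (fun p _ => (hW.measurable _).sub (hW.measurable _))
      (fun p _ => (hW.measurable _).sub (hW.measurable _)) fun I J hI hJ =>
        HasIndepIncrements.indepFun_past_future hW.indepIncrements hW.measurable t I J hI hJ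

theorem indep_filtr_futureSigma [IsProbabilityMeasure P] (hΛ : IsLevyBasis P Λ)
    (hW : IsBrownianLine P W) (hind : Indep (processSigma W) (basisSigma Λ) P) (t : ℝ) :
    Indep (filtr P Λ W t) (futureSigma Λ W t) P :=
  indep_eventuallyMeasurableSpace (indep_pastSigma_futureSigma hΛ hW hind t)

theorem filtr_mono : Monotone (filtr P Λ W) := by
  rintro s t hst A ⟨B, hB, hAB⟩
  refine ⟨B, ?_, hAB⟩
  have h : pastSigma Λ W s ≤ pastSigma Λ W t := by
    refine sup_le_sup (biSup_mono ?_) (biSup_mono ?_)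
    · exact fun B hB => ⟨hB.1, hB.2.trans (prod_mono le_rfl (Iic_subset_Iic.2 hst))⟩
    · exact fun p hp => ⟨hp.1, hp.2.trans hst⟩
  exact h B hB

theorem pastSigma_le (hΛ : IsLevyBasis P Λ) (hW : IsBrownianLine P W) (t : ℝ) :
    pastSigma Λ W t ≤ mΩ :=
  sup_le (iSup₂_le fun B hB => (hΛ.measurable B hB.1).comap_le)
    (iSup₂_le fun p _ => ((hW.measurable p.2).sub (hW.measurable p.1)).comap_le)

theorem futureSigma_le (hΛ : IsLevyBasis P Λ) (hW : IsBrownianLine P W) (t : ℝ) :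
    futureSigma Λ W t ≤ mΩ :=
  sup_le (iSup₂_le fun B hB => (hΛ.measurable B hB.1).comap_le)
    (iSup₂_le fun p _ => ((hW.measurable p.2).sub (hW.measurable p.1)).comap_le)

/-- Completeness of `P` is what keeps the completed σ-algebra inside the ambient one. -/
theorem filtr_le [P.IsComplete] (hΛ : IsLevyBasis P Λ) (hW : IsBrownianLine P W) (t : ℝ) :
    filtr P Λ W t ≤ mΩ := by
  rintro A ⟨B, hB, hAB⟩
  exact (NullMeasurableSet.congr (pastSigma_le hΛ hW t B hB).nullMeasurableSet
    hAB.symm).measurable_of_complete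

theorem measurable_increment_filtr {s u t : ℝ} (hsu : s ≤ u) (hut : u ≤ t) :
    Measurable[filtr P Λ W t] (fun ω => W u ω - W s ω) := by
  have h1 : MeasurableSpace.comap (fun ω => W u ω - W s ω) inferInstance ≤ pastSigma Λ W t :=
    le_sup_of_le_right (le_iSup₂_of_le (f := fun (p : ℝ × ℝ)
      (_ : p ∈ {p : ℝ × ℝ | p.1 ≤ p.2 ∧ p.2 ≤ t}) =>
        MeasurableSpace.comap (fun ω => W p.2 ω - W p.1 ω) inferInstance) (s, u) ⟨hsu, hut⟩ le_rfl)
  exact (comap_measurable _).mono (h1.trans le_eventuallyMeasurableSpace) le_rfl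

end Filtration

/-! ### The Itô isometry for simple integrands -/

/-- `W` has adapted increments, independent of the past, centred, with variance equal to the length
of the time interval. -/
structure HasBrownianIncrements {Ω : Type*} [mΩ : MeasurableSpace Ω] (P : Measure Ω)
    (𝒢 : ℝ → MeasurableSpace Ω) (W : ℝ → Ω → ℝ) : Prop where
  mono : Monotone 𝒢
  le : ∀ t, 𝒢 t ≤ mΩ
  measurable : ∀ {s u t : ℝ}, s ≤ u → u ≤ t → Measurable[𝒢 t] (fun ω => W u ω - W s ω)
  indep : ∀ {s t : ℝ} {A : Ω → ℝ}, s ≤ t → Measurable[𝒢 s] A →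
    IndepFun A (fun ω => W t ω - W s ω) P
  memLp : ∀ {s t : ℝ}, s ≤ t → MemLp (fun ω => W t ω - W s ω) 2 P
  mean : ∀ {s t : ℝ}, s ≤ t → ∫ ω, (W t ω - W s ω) ∂P = 0
  variance : ∀ {s t : ℝ}, s ≤ t → ∫ ω, (W t ω - W s ω) ^ 2 ∂P = t - s

theorem IsBrownianLine.hasBrownianIncrements {S Ω : Type*} [MeasurableSpace S]
    [mΩ : MeasurableSpace Ω] {P : Measure Ω} [IsProbabilityMeasure P] [P.IsComplete]
    {Λ : Set (S × ℝ) → Ω → ℝ} {W : ℝ → Ω → ℝ} (hΛ : IsLevyBasis P Λ)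
    (hW : IsBrownianLine P W) (hind : Indep (processSigma W) (basisSigma Λ) P) :
    HasBrownianIncrements P (filtr P Λ W) W where
  mono := filtr_mono
  le := filtr_le hΛ hW
  measurable hsu hut := measurable_increment_filtr hsu hut
  indep {s t A} hst hA := by
    rw [IndepFun_iff_Indep]
    exact indep_of_indep_of_le (indep_filtr_futureSigma hΛ hW hind s) hA.comap_le
      (Measurable.comap_le (measurable_increment_futureSigma le_rfl hst))
  memLp {s t} hst := by
    have h := hW.gaussianIncrements s t hst
    have h2 := memLp_id_gaussianReal' (μ := 0) (v := (t - s).toNNReal) 2 (by simp)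
    rw [← h.map_eq] at h2
    exact (memLp_map_measure_iff aestronglyMeasurable_id h.aemeasurable).1 h2
  mean {s t} hst := by
    rw [(hW.gaussianIncrements s t hst).integral_eq, integral_id_gaussianReal]
  variance {s t} hst := by
    have h := hW.gaussianIncrements s t hst
    have h1 := h.variance_eq
    rw [variance_of_integral_eq_zero h.aemeasurable
      (by rw [h.integral_eq, integral_id_gaussianReal]), variance_id_gaussianReal] at h1
    rw [h1, Real.coe_toNNReal _ (sub_nonneg.2 hst)]

namespace HasBrownianIncrements

variable {Ω : Type*} [mΩ : MeasurableSpace Ω] {P : Measure Ω}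
  {𝒢 : ℝ → MeasurableSpace Ω} {W : ℝ → Ω → ℝ}

theorem measurable_increment (h : HasBrownianIncrements P 𝒢 W) {s t : ℝ} (hst : s ≤ t) :
    Measurable (fun ω => W t ω - W s ω) :=
  (h.measurable hst le_rfl).mono (h.le t) le_rfl

theorem integral_mul_increment (h : HasBrownianIncrements P 𝒢 W) {s t : ℝ} (hst : s ≤ t)
    {A : Ω → ℝ} (hA : Measurable[𝒢 s] A) :
    ∫ ω, A ω * (W t ω - W s ω) ∂P = 0 := by
  have := (h.indep hst hA).integral_fun_mul_eq_mul_integral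
    (hA.mono (h.le s) le_rfl).aestronglyMeasurable (h.memLp hst).1
  rw [this, h.mean hst, mul_zero]

theorem integral_mul_increment_sq (h : HasBrownianIncrements P 𝒢 W) {s t : ℝ} (hst : s ≤ t)
    {A : Ω → ℝ} (hA : Measurable[𝒢 s] A) :
    ∫ ω, A ω * (W t ω - W s ω) ^ 2 ∂P = (t - s) * ∫ ω, A ω ∂P := by
  have hi : IndepFun A (fun ω => (W t ω - W s ω) ^ 2) P :=
    (h.indep hst hA).comp (φ := id) (ψ := fun x => x ^ 2) measurable_id (by fun_prop)
  have := hi.integral_fun_mul_eq_mul_integral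
    (hA.mono (h.le s) le_rfl).aestronglyMeasurable
    ((h.measurable_increment hst).pow_const 2).aestronglyMeasurable
  rw [this, h.variance hst, mul_comm]

theorem memLp_mul_increment (h : HasBrownianIncrements P 𝒢 W) {s t : ℝ} (hst : s ≤ t)
    {A : Ω → ℝ} (hA : Measurable[𝒢 s] A) (hA2 : MemLp A 2 P) :
    MemLp (fun ω => A ω * (W t ω - W s ω)) 2 P := by
  have hm : AEStronglyMeasurable (fun ω => A ω * (W t ω - W s ω)) P := hA2.1.mul (h.memLp hst).1
  rw [memLp_two_iff_integrable_sq hm]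
  have hi : IndepFun (fun ω => A ω ^ 2) (fun ω => (W t ω - W s ω) ^ 2) P :=
    (h.indep hst hA).comp (φ := fun x => x ^ 2) (ψ := fun x => x ^ 2) (by fun_prop) (by fun_prop)
  have := hi.integrable_mul hA2.integrable_sq (h.memLp hst).integrable_sq
  refine this.congr (ae_of_all _ fun ω => ?_)
  simp only [Pi.mul_apply]
  ring

/-- For b ≤ d, split W_d - W_c at b. The part after b is centred and independent of the rest, which
leaves A B (W_b - W_c)². -/
theorem integral_mul_increment_mul_increment_of_eq (h : HasBrownianIncrements P 𝒢 W)
    {c b d : ℝ} (hcb : c ≤ b) (hcd : c ≤ d) {A B : Ω → ℝ} (hA : Measurable[𝒢 c] A)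
    (hA2 : MemLp A 2 P) (hB : Measurable[𝒢 c] B) (hB2 : MemLp B 2 P) :
    ∫ ω, (A ω * (W b ω - W c ω)) * (B ω * (W d ω - W c ω)) ∂P
      = (min b d - c) * ∫ ω, A ω * B ω ∂P := by
  wlog hbd : b ≤ d generalizing b d A B
  · have := this hcd hcb hB hB2 hA hA2 (le_of_not_ge hbd)
    rw [min_comm, integral_congr_ae (ae_of_all P fun ω => mul_comm (A ω) (B ω)), ← this]
    exact integral_congr_ae (ae_of_all P fun ω => mul_comm _ _)
  rw [min_eq_left hbd]
  have e : ∀ ω, (A ω * (W b ω - W c ω)) * (B ω * (W d ω - W c ω))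
      = (A ω * B ω) * (W b ω - W c ω) ^ 2
        + (A ω * (B ω * (W b ω - W c ω))) * (W d ω - W b ω) := fun ω => by ring
  have hAc := h.memLp_mul_increment hcb hA hA2
  have hBc := h.memLp_mul_increment hcb hB hB2
  have hAd := h.memLp_mul_increment hcd hB hB2
  have i1 : Integrable (fun ω => (A ω * B ω) * (W b ω - W c ω) ^ 2) P := by
    refine (hAc.integrable_mul hBc).congr (ae_of_all _ fun ω => ?_)
    simp only [Pi.mul_apply]; ring
  -- The factor in front of W_d - W_b is a product of two L² variables, so L² bounds do not apply to
  -- it; integrability is obtained by subtracting `i1` from the full product.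
  have i2 : Integrable (fun ω => (A ω * (B ω * (W b ω - W c ω))) * (W d ω - W b ω)) P := by
    refine ((hAc.integrable_mul hAd).sub i1).congr (ae_of_all _ fun ω => ?_)
    simp only [Pi.mul_apply, Pi.sub_apply]; ring
  simp_rw [e]
  have hAB : Measurable[𝒢 c] fun ω => A ω * B ω := hA.mul hB
  have hABW : Measurable[𝒢 b] fun ω => A ω * (B ω * (W b ω - W c ω)) :=
    (hA.mono (h.mono hcb) le_rfl).mul
      ((hB.mono (h.mono hcb) le_rfl).mul (h.measurable hcb le_rfl))
  rw [integral_add i1 i2, h.integral_mul_increment_sq hcb hAB,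
    h.integral_mul_increment hbd hABW, add_zero]

/-- For a ≤ c, split W_b - W_a at c; the part before c contributes nothing, by centring. The factor
is the length of the overlap of the two intervals, so simple processes on unrelated grids can be
compared without refining them. -/
theorem integral_mul_increment_mul_increment (h : HasBrownianIncrements P 𝒢 W)
    {a b c d : ℝ} (hab : a ≤ b) (hcd : c ≤ d) {A B : Ω → ℝ} (hA : Measurable[𝒢 a] A)
    (hA2 : MemLp A 2 P) (hB : Measurable[𝒢 c] B) (hB2 : MemLp B 2 P) :
    ∫ ω, (A ω * (W b ω - W a ω)) * (B ω * (W d ω - W c ω)) ∂P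
      = max (min b d - max a c) 0 * ∫ ω, A ω * B ω ∂P := by
  wlog hac : a ≤ c generalizing a b c d A B
  · have := this hcd hab hB hB2 hA hA2 (le_of_not_ge hac)
    rw [min_comm, max_comm a, integral_congr_ae (ae_of_all P fun ω => mul_comm (A ω) (B ω)),
      ← this]
    exact integral_congr_ae (ae_of_all P fun ω => mul_comm _ _)
  rw [max_eq_right hac]
  rcases le_total b c with hbc | hcb
  · rw [max_eq_right (by linarith [min_le_left b d]), zero_mul]
    have e : ∀ ω, (A ω * (W b ω - W a ω)) * (B ω * (W d ω - W c ω))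
        = ((A ω * (W b ω - W a ω)) * B ω) * (W d ω - W c ω) := fun ω => by ring
    simp_rw [e]
    exact h.integral_mul_increment hcd (((hA.mono (h.mono hac) le_rfl).mul
      (h.measurable hab hbc)).mul hB)
  · rw [max_eq_left (by linarith [le_min hcb hcd])]
    have hA' : Measurable[𝒢 c] A := hA.mono (h.mono hac) le_rfl
    have e : ∀ ω, (A ω * (W b ω - W a ω)) * (B ω * (W d ω - W c ω))
        = ((A ω * (W c ω - W a ω)) * B ω) * (W d ω - W c ω)
          + (A ω * (W b ω - W c ω)) * (B ω * (W d ω - W c ω)) := fun ω => by ring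
    have i2 : Integrable (fun ω => (A ω * (W b ω - W c ω)) * (B ω * (W d ω - W c ω))) P :=
      (h.memLp_mul_increment hcb hA' hA2).integrable_mul (h.memLp_mul_increment hcd hB hB2)
    have i1 : Integrable (fun ω => ((A ω * (W c ω - W a ω)) * B ω) * (W d ω - W c ω)) P := by
      refine ((h.memLp_mul_increment hac hA hA2).integrable_mul
        (h.memLp_mul_increment hcd hB hB2)).congr (ae_of_all _ fun ω => ?_)
      simp only [Pi.mul_apply]; ring
    simp_rw [e]
    have hAWB : Measurable[𝒢 c] fun ω => A ω * (W c ω - W a ω) * B ω :=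
      (hA'.mul (h.measurable hac le_rfl)).mul hB
    rw [integral_add i1 i2, h.integral_mul_increment_mul_increment_of_eq hcb hcd hA' hA2 hB hB2,
      h.integral_mul_increment hcd hAWB, zero_add]

theorem setIntegral_indicator_mul_indicator {a b : ℝ} (s t s' t' : ℝ) (hs : a ≤ s) (ht : t ≤ b) :
    IntegrableOn (fun x : ℝ => (Ioc s t).indicator (fun _ => (1 : ℝ)) x
      * (Ioc s' t').indicator (fun _ => (1 : ℝ)) x) (Ioc a b) ∧
    ∫ x in Ioc a b, (Ioc s t).indicator (fun _ => (1 : ℝ)) x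
      * (Ioc s' t').indicator (fun _ => (1 : ℝ)) x = max (min t t' - max s s') 0 := by
  have e : (fun x : ℝ => (Ioc s t).indicator (fun _ => (1 : ℝ)) x
      * (Ioc s' t').indicator (fun _ => (1 : ℝ)) x)
      = (Ioc (max s s') (min t t')).indicator fun _ => (1 : ℝ) := by
    funext x
    rw [show Ioc (max s s') (min t t') = Ioc s t ∩ Ioc s' t' from Ioc_inter_Ioc.symm]
    by_cases h1 : x ∈ Ioc s t <;> by_cases h2 : x ∈ Ioc s' t' <;> simp [h1, h2]
  rw [e]
  refine ⟨(integrable_indicator_iff measurableSet_Ioc).2 (integrableOn_const (by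
    exact ((Measure.restrict_apply_le _ _).trans_lt (by simp)).ne)), ?_⟩
  rw [integral_indicator_const _ measurableSet_Ioc, measureReal_restrict_apply measurableSet_Ioc,
    inter_eq_left.2 (Ioc_subset_Ioc (hs.trans (le_max_left _ _)) ((min_le_left _ _).trans ht)),
    Real.volume_real_Ioc]
  simp

/-- Itô isometry for a finite sum of elementary integrands, over arbitrary time intervals. -/
theorem isometry (h : HasBrownianIncrements P 𝒢 W) {ι : Type*} [Fintype ι]
    {a b : ℝ} {s t : ι → ℝ} (hst : ∀ i, s i ≤ t i) (hs : ∀ i, a ≤ s i) (ht : ∀ i, t i ≤ b)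
    {ξ : ι → Ω → ℝ} (hξ : ∀ i, Measurable[𝒢 (s i)] (ξ i)) (hξ2 : ∀ i, MemLp (ξ i) 2 P) :
    ∫⁻ ω, ‖∑ i, ξ i ω * (W (t i) ω - W (s i) ω)‖ₑ ^ 2 ∂P
      = ∫⁻ ω, ∫⁻ x in Ioc a b, ‖∑ i, if s i < x ∧ x ≤ t i then ξ i ω else 0‖ₑ ^ 2 ∂volume ∂P := by
  have sq_enorm : ∀ x : ℝ, ‖x‖ₑ ^ 2 = ENNReal.ofReal (x ^ 2) := fun x => by
    rw [Real.enorm_eq_ofReal_abs, ← ENNReal.ofReal_pow (abs_nonneg x), sq_abs]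
  -- Length of the overlap of intervals i and j. Both sides expand to the double sum of `ℓ i j`
  -- times E[ξ_i ξ_j].
  let ℓ : ι → ι → ℝ := fun i j => max (min (t i) (t j) - max (s i) (s j)) 0
  have hterm : ∀ i j, Integrable (fun ω => (ξ i ω * (W (t i) ω - W (s i) ω))
      * (ξ j ω * (W (t j) ω - W (s j) ω))) P := fun i j =>
    (h.memLp_mul_increment (hst i) (hξ i) (hξ2 i)).integrable_mul
      (h.memLp_mul_increment (hst j) (hξ j) (hξ2 j))
  have hξξ : ∀ i j, Integrable (fun ω => ξ i ω * ξ j ω) P := fun i j =>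
    (hξ2 i).integrable_mul (hξ2 j)
  have esq : ∀ ω, (∑ i, ξ i ω * (W (t i) ω - W (s i) ω)) ^ 2
      = ∑ i, ∑ j, (ξ i ω * (W (t i) ω - W (s i) ω)) * (ξ j ω * (W (t j) ω - W (s j) ω)) :=
    fun ω => by rw [sq, Finset.sum_mul_sum]
  have hleft : ∫ ω, (∑ i, ξ i ω * (W (t i) ω - W (s i) ω)) ^ 2 ∂P
      = ∑ i, ∑ j, ℓ i j * ∫ ω, ξ i ω * ξ j ω ∂P := by
    simp_rw [esq]
    rw [integral_finsetSum _ fun i _ => integrable_finsetSum _ fun j _ => hterm i j]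
    refine Finset.sum_congr rfl fun i _ => ?_
    rw [integral_finsetSum _ fun j _ => hterm i j]
    exact Finset.sum_congr rfl fun j _ => h.integral_mul_increment_mul_increment (hst i) (hst j)
      (hξ i) (hξ2 i) (hξ j) (hξ2 j)
  have hLint : Integrable (fun ω => (∑ i, ξ i ω * (W (t i) ω - W (s i) ω)) ^ 2) P := by
    simp_rw [esq]
    exact integrable_finsetSum _ fun i _ => integrable_finsetSum _ fun j _ => hterm i j
  have eval : ∀ ω x, (∑ i, if s i < x ∧ x ≤ t i then ξ i ω else 0) ^ 2
      = ∑ i, ∑ j, (ξ i ω * ξ j ω) * ((Ioc (s i) (t i)).indicator (fun _ => (1 : ℝ)) x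
        * (Ioc (s j) (t j)).indicator (fun _ => (1 : ℝ)) x) := by
    intro ω x
    have : ∀ i, (if s i < x ∧ x ≤ t i then ξ i ω else 0)
        = ξ i ω * (Ioc (s i) (t i)).indicator (fun _ => (1 : ℝ)) x := fun i => by
      simp [indicator_apply]
    simp_rw [this]
    rw [sq, Finset.sum_mul_sum]
    exact Finset.sum_congr rfl fun i _ => Finset.sum_congr rfl fun j _ => by ring
  have hval : ∀ ω, ∫⁻ x in Ioc a b, ‖∑ i, if s i < x ∧ x ≤ t i then ξ i ω else 0‖ₑ ^ 2
      = ENNReal.ofReal (∑ i, ∑ j, ℓ i j * (ξ i ω * ξ j ω)) := by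
    intro ω
    have hI : ∀ i j, IntegrableOn (fun x => (ξ i ω * ξ j ω)
        * ((Ioc (s i) (t i)).indicator (fun _ => (1 : ℝ)) x
        * (Ioc (s j) (t j)).indicator (fun _ => (1 : ℝ)) x)) (Ioc a b) := fun i j =>
      (setIntegral_indicator_mul_indicator (s i) (t i) (s j) (t j) (hs i) (ht i)).1.const_mul _
    simp_rw [sq_enorm]
    rw [← ofReal_integral_eq_lintegral_ofReal _ (ae_of_all _ fun x => sq_nonneg _)]
    · congr 1
      simp_rw [eval]
      rw [integral_finsetSum _ fun i _ => integrable_finsetSum _ fun j _ => hI i j]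
      refine Finset.sum_congr rfl fun i _ => ?_
      rw [integral_finsetSum _ fun j _ => hI i j]
      refine Finset.sum_congr rfl fun j _ => ?_
      rw [integral_const_mul, (setIntegral_indicator_mul_indicator (s i) (t i) (s j) (t j) (hs i)
        (ht i)).2, mul_comm]
    · simp_rw [eval]
      exact integrable_finsetSum _ fun i _ => integrable_finsetSum _ fun j _ => hI i j
  have hR : ∀ i j, Integrable (fun ω => ℓ i j * (ξ i ω * ξ j ω)) P := fun i j =>
    (hξξ i j).const_mul _
  simp_rw [hval]
  simp_rw [sq_enorm]
  rw [← ofReal_integral_eq_lintegral_ofReal hLint (ae_of_all _ fun ω => sq_nonneg _), hleft,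
    ← ofReal_integral_eq_lintegral_ofReal]
  · congr 1
    rw [integral_finsetSum _ fun i _ => integrable_finsetSum _ fun j _ => hR i j]
    refine Finset.sum_congr rfl fun i _ => ?_
    rw [integral_finsetSum _ fun j _ => hR i j]
    exact Finset.sum_congr rfl fun j _ => (integral_const_mul _ _).symm
  · exact integrable_finsetSum _ fun i _ => integrable_finsetSum _ fun j _ => hR i j
  · refine ae_of_all _ fun ω => ?_
    -- The double sum is nonnegative, being the integral of a square.
    have e : ∑ i, ∑ j, ℓ i j * (ξ i ω * ξ j ω)
        = ∫ x in Ioc a b, (∑ i, if s i < x ∧ x ≤ t i then ξ i ω else 0) ^ 2 := by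
      have hI : ∀ i j, IntegrableOn (fun x => (ξ i ω * ξ j ω)
          * ((Ioc (s i) (t i)).indicator (fun _ => (1 : ℝ)) x
          * (Ioc (s j) (t j)).indicator (fun _ => (1 : ℝ)) x)) (Ioc a b) := fun i j =>
        (setIntegral_indicator_mul_indicator (s i) (t i) (s j) (t j) (hs i) (ht i)).1.const_mul _
      simp_rw [eval]
      rw [integral_finsetSum _ fun i _ => integrable_finsetSum _ fun j _ => hI i j]
      refine Finset.sum_congr rfl fun i _ => ?_
      rw [integral_finsetSum _ fun j _ => hI i j]
      refine Finset.sum_congr rfl fun j _ => ?_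
      rw [integral_const_mul, (setIntegral_indicator_mul_indicator (s i) (t i) (s j) (t j) (hs i)
        (ht i)).2, mul_comm]
    simp only [Pi.zero_apply]
    rw [e]
    exact integral_nonneg fun x => sq_nonneg _

theorem memLp_simple_integral (h : HasBrownianIncrements P 𝒢 W) {a b : ℝ}
    (φ : SimpleProcess P 𝒢 a b) : MemLp (φ.integral W) 2 P :=
  memLp_finsetSum _ fun k _ => h.memLp_mul_increment (φ.time_mono k.le_succ) (φ.adapted k)
    (φ.memLp k)

/-- Itô isometry for the difference of two simple processes. -/
theorem isometry_sub (h : HasBrownianIncrements P 𝒢 W) {a b : ℝ} (φ ψ : SimpleProcess P 𝒢 a b) :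
    ∫⁻ ω, ‖φ.integral W ω - ψ.integral W ω‖ₑ ^ 2 ∂P
      = ∫⁻ ω, ∫⁻ x in Ioc a b, ‖φ.val x ω - ψ.val x ω‖ₑ ^ 2 ∂volume ∂P := by
  -- The difference is one elementary sum over the disjoint union of the two index sets, with the
  -- coefficients of `ψ` negated.
  have hiso := h.isometry (ι := Fin φ.N ⊕ Fin ψ.N) (a := a) (b := b)
    (s := Sum.elim (fun k : Fin φ.N => φ.time k) (fun k : Fin ψ.N => ψ.time k))
    (t := Sum.elim (fun k : Fin φ.N => φ.time (k + 1)) (fun k : Fin ψ.N => ψ.time (k + 1)))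
    (ξ := Sum.elim (fun k : Fin φ.N => φ.coeff k) (fun k : Fin ψ.N => -ψ.coeff k))
    (by rintro (k | k); exacts [φ.time_mono (k : ℕ).le_succ, ψ.time_mono (k : ℕ).le_succ])
    (by rintro (k | k); exacts [(φ.time_mem k).1, (ψ.time_mem k).1])
    (by rintro (k | k); exacts [(φ.time_mem _).2, (ψ.time_mem _).2])
    (by rintro (k | k); exacts [φ.adapted k, (ψ.adapted k).neg])
    (by rintro (k | k); exacts [φ.memLp k, (ψ.memLp k).neg])
  have e1 : ∀ ω, φ.integral W ω - ψ.integral W ω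
      = ∑ i : Fin φ.N ⊕ Fin ψ.N, Sum.elim (fun k : Fin φ.N => φ.coeff k) (fun k : Fin ψ.N => -ψ.coeff k) i ω
        * (W (Sum.elim (fun k : Fin φ.N => φ.time (k + 1)) (fun k : Fin ψ.N => ψ.time (k + 1)) i) ω
          - W (Sum.elim (fun k : Fin φ.N => φ.time k) (fun k : Fin ψ.N => ψ.time k) i) ω) := by
    intro ω
    simp only [SimpleProcess.integral, Fintype.sum_sum_type, Sum.elim_inl, Sum.elim_inr,
      Pi.neg_apply, neg_mul, Finset.sum_neg_distrib, Finset.sum_range, sub_eq_add_neg]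
  have e2 : ∀ ω x, φ.val x ω - ψ.val x ω
      = ∑ i : Fin φ.N ⊕ Fin ψ.N, if Sum.elim (fun k : Fin φ.N => φ.time k) (fun k : Fin ψ.N => ψ.time k) i < x
          ∧ x ≤ Sum.elim (fun k : Fin φ.N => φ.time (k + 1)) (fun k : Fin ψ.N => ψ.time (k + 1)) i
        then Sum.elim (fun k : Fin φ.N => φ.coeff k) (fun k : Fin ψ.N => -ψ.coeff k) i ω else 0 := by
    intro ω x
    simp only [SimpleProcess.val, Fintype.sum_sum_type, Sum.elim_inl, Sum.elim_inr,
      Pi.neg_apply, Finset.sum_range, sub_eq_add_neg, ← Finset.sum_neg_distrib]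
    congr 1
    refine Finset.sum_congr rfl fun k _ => ?_
    by_cases hk : ψ.time k < x ∧ x ≤ ψ.time (k + 1)
    · exact (congrArg Neg.neg (if_pos hk)).trans (if_pos hk).symm
    · exact ((congrArg Neg.neg (if_neg hk)).trans neg_zero).trans (if_neg hk).symm
  simp_rw [e1, e2]
  exact hiso

end HasBrownianIncrements

theorem eLpNorm_two_sq {α : Type*} [MeasurableSpace α] {μ : Measure α} (f : α → ℝ) :
    eLpNorm f 2 μ ^ 2 = ∫⁻ x, ‖f x‖ₑ ^ 2 ∂μ := by
  have := eLpNorm_nnreal_pow_eq_lintegral (μ := μ) (f := f) (p := 2) two_ne_zero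
  simpa using this

/-! ### The kernel and its tails -/

/-- Links the two descriptions of the lag: ℝ⁺ in the integrability of f, the half-line (-∞, 0] in
θ_X. -/
theorem measurePreserving_neg_toNNReal :
    MeasurePreserving (fun s : ℝ => (-s).toNNReal) (volume.restrict (Iic 0)) lebesguePos := by
  refine ⟨by fun_prop, ?_⟩
  have hemb : MeasurableEmbedding (fun s : ℝ≥0 => (s : ℝ)) :=
    NNReal.isClosedEmbedding_coe.measurableEmbedding
  ext B hB
  have hm : Measurable fun s : ℝ => (-s).toNNReal := by fun_prop
  rw [Measure.map_apply hm hB, Measure.restrict_apply (hm hB), lebesguePos, hemb.comap_apply]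
  have : (fun s : ℝ => (-s).toNNReal) ⁻¹' B ∩ Iic 0
      = Neg.neg ⁻¹' ((fun s : ℝ≥0 => (s : ℝ)) '' B) := by
    ext s
    simp only [mem_inter_iff, mem_preimage, mem_Iic, mem_image]
    constructor
    · rintro ⟨h1, h2⟩
      exact ⟨_, h1, Real.coe_toNNReal _ (by linarith)⟩
    · rintro ⟨x, hx, hxs⟩
      refine ⟨?_, ?_⟩
      · rw [← hxs, Real.toNNReal_coe]; exact hx
      · have hxs' : (x : ℝ) = -s := hxs
        linarith [NNReal.coe_nonneg x]
  rw [this]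
  exact (Measure.measurePreserving_neg (volume : Measure ℝ)).measure_preimage
    (hemb.measurableSet_image.2 hB).nullMeasurableSet

section Kernel

variable {S : Type*} [MeasurableSpace S]

/-- The mass `∫_S ∫_{(-∞, -r]} |f(A, -s)| ds π(dA)` of the kernel beyond time `r`. -/
noncomputable def kernelTail (π : Measure S) (f : S × ℝ≥0 → ℝ) (r : ℝ) : ℝ≥0∞ :=
  ∫⁻ p in univ ×ˢ Iic (-r), ‖f (p.1, (-p.2).toNNReal)‖ₑ ∂(π.prod volume)

variable {π : Measure S} {f : S × ℝ≥0 → ℝ}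

theorem kernelTail_antitone (π : Measure S) (f : S × ℝ≥0 → ℝ) : Antitone (kernelTail π f) :=
  fun _ _ h => lintegral_mono_set (prod_mono le_rfl (Iic_subset_Iic.2 (neg_le_neg h)))

theorem measurable_causalKernel (hf : Measurable f) (t : ℝ) : Measurable (causalKernel f t) := by
  unfold causalKernel
  exact Measurable.ite (measurableSet_le (by fun_prop) (by fun_prop)) (by fun_prop) (by fun_prop)

theorem setLIntegral_causalKernel [IsProbabilityMeasure π] (hf : Measurable f) {T t : ℝ}
    (h : T ≤ t) :
    ∫⁻ p in univ ×ˢ Iic T, ‖causalKernel f t p‖ₑ ∂(π.prod volume) = kernelTail π f (t - T) := by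
  have hmp : MeasurePreserving (fun p : S × ℝ => (p.1, p.2 + t)) (π.prod volume)
      (π.prod volume) :=
    (MeasurePreserving.id π).prod (measurePreserving_add_right volume t)
  have hs : MeasurableSet (univ ×ˢ Iic T : Set (S × ℝ)) := MeasurableSet.univ.prod measurableSet_Iic
  rw [← hmp.setLIntegral_comp_preimage hs (measurable_causalKernel hf t).enorm, kernelTail]
  have hpre : (fun p : S × ℝ => (p.1, p.2 + t)) ⁻¹' (univ ×ˢ Iic T) = univ ×ˢ Iic (-(t - T)) := by
    ext p
    simp only [mem_preimage, mem_prod, mem_univ, true_and, mem_Iic]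
    constructor <;> intro h <;> linarith
  rw [hpre]
  refine setLIntegral_congr_fun (MeasurableSet.univ.prod measurableSet_Iic) fun p hp => ?_
  have h1 : p.2 ≤ -(t - T) := hp.2
  have h2 : p.2 + t ≤ t := by linarith
  simp only [causalKernel, if_pos h2]
  congr 4
  ring_nf

/-- The kernel vanishes after t, so outside (T, t] only the times up to T count. -/
theorem setLIntegral_causalKernel_compl [IsProbabilityMeasure π] (hf : Measurable f) {T t : ℝ}
    (h : T ≤ t) :
    ∫⁻ p in (univ ×ˢ Ioc T t)ᶜ, ‖causalKernel f t p‖ₑ ∂(π.prod volume)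
      ≤ kernelTail π f (t - T) := by
  rw [← setLIntegral_causalKernel hf h]
  have hs : (univ ×ˢ Ioc T t : Set (S × ℝ))ᶜ ⊆ (univ ×ˢ Iic T) ∪ (univ ×ˢ Ioi t) := by
    intro p hp
    simp only [mem_compl_iff, mem_prod, mem_univ, true_and, mem_Ioc, not_and, not_le] at hp
    rcases le_or_gt p.2 T with h1 | h1
    · exact Or.inl ⟨mem_univ _, h1⟩
    · exact Or.inr ⟨mem_univ _, hp h1⟩
  refine (lintegral_mono_set hs).trans ((lintegral_union_le _ _ _).trans ?_)
  have hz : ∫⁻ p in univ ×ˢ Ioi t, ‖causalKernel f t p‖ₑ ∂(π.prod volume) = 0 := by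
    rw [setLIntegral_congr_fun (g := fun _ => 0) (MeasurableSet.univ.prod measurableSet_Ioi)
      fun p hp => ?_]
    · simp
    · have h1 : ¬ p.2 ≤ t := not_le.2 hp.2
      simp [causalKernel, if_neg h1]
  rw [hz, add_zero]

theorem lintegral_causalKernel [IsProbabilityMeasure π] (hf : Measurable f) (t : ℝ) :
    ∫⁻ p, ‖causalKernel f t p‖ₑ ∂(π.prod volume) ≤ kernelTail π f 0 := by
  have := setLIntegral_causalKernel_compl (π := π) hf (le_refl t)
  simpa using this

theorem kernelTail_zero [IsProbabilityMeasure π] (hf : Measurable f) :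
    kernelTail π f 0 = ∫⁻ p, ‖f p‖ₑ ∂(π.prod lebesguePos) := by
  have : SFinite lebesguePos := by
    rw [← measurePreserving_neg_toNNReal.map_eq]; infer_instance
  have hmp : MeasurePreserving (fun p : S × ℝ => (p.1, (-p.2).toNNReal))
      (π.prod (volume.restrict (Iic 0))) (π.prod lebesguePos) :=
    (MeasurePreserving.id π).prod measurePreserving_neg_toNNReal
  rw [← hmp.lintegral_comp hf.enorm, kernelTail, neg_zero]
  rw [← Measure.prod_restrict, Measure.restrict_univ]

theorem kernelTail_zero_lt_top [IsProbabilityMeasure π] (hf : Measurable f)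
    (hfi : Integrable f (π.prod lebesguePos)) : kernelTail π f 0 < ∞ := by
  rw [kernelTail_zero hf]
  exact hfi.2

theorem integrable_causalKernel [IsProbabilityMeasure π] (hf : Measurable f)
    (hfi : Integrable f (π.prod lebesguePos)) (t : ℝ) :
    Integrable (causalKernel f t) (π.prod volume) :=
  ⟨(measurable_causalKernel hf t).aestronglyMeasurable,
    (lintegral_causalKernel hf t).trans_lt (kernelTail_zero_lt_top hf hfi)⟩

theorem tendsto_kernelTail [IsProbabilityMeasure π] (hf : Measurable f)
    (hfi : Integrable f (π.prod lebesguePos)) :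
    Tendsto (kernelTail π f) atTop (𝓝 0) := by
  let μ : Measure (S × ℝ) := (π.prod volume).withDensity fun p => ‖f (p.1, (-p.2).toNNReal)‖ₑ
  have hs : ∀ r : ℝ, MeasurableSet (univ ×ˢ Iic (-r) : Set (S × ℝ)) := fun r =>
    MeasurableSet.univ.prod measurableSet_Iic
  have happ : ∀ r : ℝ, μ (univ ×ˢ Iic (-r)) = kernelTail π f r := fun r =>
    withDensity_apply _ (hs r)
  have := tendsto_measure_iInter_atTop (μ := μ) (s := fun r : ℝ => univ ×ˢ Iic (-r))
    (fun r => (hs r).nullMeasurableSet)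
    (fun r r' h => prod_mono le_rfl (Iic_subset_Iic.2 (neg_le_neg h)))
    ⟨0, by rw [happ]; exact (kernelTail_zero_lt_top hf hfi).ne⟩
  have hempty : ⋂ r : ℝ, (univ ×ˢ Iic (-r) : Set (S × ℝ)) = ∅ := by
    refine eq_empty_of_forall_notMem fun p hp => ?_
    have h1 : p.2 ≤ -(1 - p.2) := (mem_iInter.1 hp (1 - p.2)).2
    linarith
  rw [hempty, measure_empty] at this
  exact this.congr happ

/-- As f ≥ 0, |f x| = f |x| and |f γ₀| = f |γ₀|, so ν and the drift factor out as κ. Integrability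
of f identifies the iterated integral with the tail mass. -/
theorem ofReal_thetaX [IsProbabilityMeasure π] (hf : Measurable f) (hf0 : ∀ p, 0 ≤ f p)
    (hfi : Integrable f (π.prod lebesguePos)) (γ : ℝ) (ν : Measure ℝ) {r : ℝ} (hr : 0 ≤ r) :
    ENNReal.ofReal (thetaX π γ ν f r) = ENNReal.ofReal (levyMass γ ν) * kernelTail π f r := by
  have hm : Measurable fun p : S × ℝ => f (p.1, (-p.2).toNNReal) := by fun_prop
  have hrestr : (π.prod volume).restrict (univ ×ˢ Iic (-r))
      = π.prod (volume.restrict (Iic (-r))) := by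
    rw [← Measure.prod_restrict, Measure.restrict_univ]
  have hfin : kernelTail π f r < ∞ :=
    (kernelTail_antitone π f hr).trans_lt (kernelTail_zero_lt_top hf hfi)
  have hint : Integrable (fun p : S × ℝ => f (p.1, (-p.2).toNNReal))
      (π.prod (volume.restrict (Iic (-r)))) := by
    refine ⟨hm.aestronglyMeasurable, ?_⟩
    rw [← hrestr]
    exact hfin
  have hK : ENNReal.ofReal (∫ A, ∫ s in Iic (-r), f (A, (-s).toNNReal) ∂volume ∂π)
      = kernelTail π f r := by
    rw [← integral_prod _ hint, ofReal_integral_eq_lintegral_ofReal hint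
      (ae_of_all _ fun p => hf0 _), kernelTail, hrestr]
    exact lintegral_congr fun p => (Real.enorm_of_nonneg (hf0 _)).symm
  have h1 : ∀ c : ℝ, 0 ≤ c → ∀ p : S × ℝ≥0, |f p * c| = f p * c := fun c hc p =>
    abs_of_nonneg (mul_nonneg (hf0 p) hc)
  have h2 : thetaX π γ ν f r
      = levyMass γ ν * ∫ A, ∫ s in Iic (-r), f (A, (-s).toNNReal) ∂volume ∂π := by
    unfold thetaX levyMass
    have e1 : ∀ (A : S) (s : ℝ), ∫ x, |f (A, (-s).toNNReal) * x| ∂ν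
        = f (A, (-s).toNNReal) * ∫ x, |x| ∂ν := fun A s => by
      rw [← integral_const_mul]
      exact integral_congr_ae (ae_of_all _ fun x => by
        simp only [abs_mul, abs_of_nonneg (hf0 _)])
    have e2 : ∀ (A : S) (s : ℝ), |f (A, (-s).toNNReal) * drift γ ν|
        = f (A, (-s).toNNReal) * |drift γ ν| := fun A s => by
      rw [abs_mul, abs_of_nonneg (hf0 _)]
    simp_rw [e1, e2, integral_mul_const]
    ring
  rw [h2, ENNReal.ofReal_mul (levyMass_nonneg γ ν), hK]

end Kernel

/-! ### The volatility process -/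

section Volatility

variable {S Ω : Type*} [MeasurableSpace S] [mΩ : MeasurableSpace Ω] {P : Measure Ω}
  {π : Measure S} [IsProbabilityMeasure π]
  {Λ : Set (S × ℝ) → Ω → ℝ} {W : ℝ → Ω → ℝ} {f : S × ℝ≥0 → ℝ} {X : ℝ → Ω → ℝ}

theorem lintegral_mma_le (hΛ : IsLevyBasis P Λ) {C : ℝ≥0∞} (hCt : C ≠ ∞)
    (hC : ∀ B ∈ BoundedBorel S, ∫⁻ ω, ‖Λ B ω‖ₑ ∂P ≤ C * (π.prod volume) B)
    (hf : Measurable f) (hfi : Integrable f (π.prod lebesguePos))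
    (hX : IsCausalMMA P π Λ f X) (t : ℝ) :
    ∫⁻ ω, ‖X t ω‖ₑ ∂P ≤ C * kernelTail π f 0 := by
  obtain ⟨φ, hφ, hlim, hconv, hJ⟩ := hX t
  refine (hΛ.lintegral_limit_le hCt hC (measurable_causalKernel hf t)
    (integrable_causalKernel hf hfi t) hφ hlim hconv MeasurableSet.univ hJ).trans ?_
  gcongr
  rw [Measure.restrict_univ]
  exact lintegral_causalKernel hf t

/-- Truncation of the moving average at time `T`: the part driven by the noise on `(T, t]`. -/
theorem exists_truncated_mma (hΛ : IsLevyBasis P Λ)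
    {C : ℝ≥0∞} (hCt : C ≠ ∞)
    (hC : ∀ B ∈ BoundedBorel S, ∫⁻ ω, ‖Λ B ω‖ₑ ∂P ≤ C * (π.prod volume) B)
    (hf : Measurable f) (hfi : Integrable f (π.prod lebesguePos))
    (hX : IsCausalMMA P π Λ f X) {T t : ℝ} (hTt : T ≤ t) :
    ∃ Z : Ω → ℝ, Measurable[futureSigma Λ W T] Z ∧ Measurable[pastSigma Λ W t] Z ∧
      ∫⁻ ω, ‖X t ω - Z ω‖ₑ ∂P ≤ C * kernelTail π f (t - T) := by
  obtain ⟨φ, hφ, hlim, hconv, hJ⟩ := hX t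
  have hA : MeasurableSet (univ ×ˢ Ioc T t : Set (S × ℝ)) :=
    MeasurableSet.univ.prod measurableSet_Ioc
  obtain ⟨J1, hJ1⟩ := hconv _ hA
  obtain ⟨J2, hJ2⟩ := hconv _ hA.compl
  have hsum := tendstoInMeasure_add_ae_eq hJ1 hJ2 hJ fun n => by
    have := hΛ.simpleIntegral_union (hφ n) hA hA.compl disjoint_compl_right
    rwa [union_compl_self] at this
  have hbd := hΛ.lintegral_limit_le hCt hC (measurable_causalKernel hf t)
    (integrable_causalKernel hf hfi t) hφ hlim hconv hA.compl hJ2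
  have h1 : ∀ n, Measurable[futureSigma Λ W T] (simpleIntegral Λ (φ n) (univ ×ˢ Ioc T t)) :=
    fun n => measurable_simpleIntegral (hφ n) hA fun B hB hBA => measurable_basis_futureSigma hB
      (hBA.trans (prod_mono le_rfl fun _ hx => hx.1))
  have h2 : ∀ n, Measurable[pastSigma Λ W t] (simpleIntegral Λ (φ n) (univ ×ˢ Ioc T t)) :=
    fun n => measurable_simpleIntegral (hφ n) hA fun B hB hBA => measurable_basis_pastSigma hB
      (hBA.trans (prod_mono le_rfl fun _ hx => hx.2))
  -- The limsup along an almost surely convergent subsequence is a version of `J1` that is exactly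
  -- measurable for both σ-algebras; neither of them is completed.
  obtain ⟨ns, _, hns⟩ := hJ1.exists_seq_tendsto_ae'
  refine ⟨fun ω => limsup (fun n => simpleIntegral Λ (φ (ns n)) (univ ×ˢ Ioc T t) ω) atTop,
    Measurable.limsup fun n => h1 (ns n), Measurable.limsup fun n => h2 (ns n), ?_⟩
  have e : ∫⁻ ω, ‖X t ω - limsup (fun n => simpleIntegral Λ (φ (ns n)) (univ ×ˢ Ioc T t) ω) atTop‖ₑ
      ∂P = ∫⁻ ω, ‖J2 ω‖ₑ ∂P := by
    refine lintegral_congr_ae ?_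
    filter_upwards [hsum, hns] with ω w1 w2
    rw [w1, w2.limsup_eq, add_sub_cancel_left]
  rw [e]
  refine hbd.trans ?_
  gcongr
  exact setLIntegral_causalKernel_compl hf hTt

end Volatility

/-! ### Càdlàg paths -/

/-- Where the left limit differs from the value, a rational q lies strictly between them. For fixed
q and fixed direction such points are isolated from the left among themselves, hence countable. -/
theorem IsCadlag.ae_tendsto_left {x : ℝ → ℝ} (hx : IsCadlag x) :
    ∀ᵐ t, Tendsto x (𝓝[<] t) (𝓝 (x t)) := by
  choose l hl using fun t => (hx t).2
  let A : ℚ → Set ℝ := fun q => {t | l t < q ∧ (q : ℝ) < x t}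
  let B : ℚ → Set ℝ := fun q => {t | x t < q ∧ (q : ℝ) < l t}
  have hA : ∀ q, (A q).Countable := fun q => by
    refine (countable_setOfPred_isolated_left_within (s := A q)).mono ?_
    intro t ht
    refine ⟨ht, ?_⟩
    have h1 : ∀ᶠ u in 𝓝[<] t, x u < q := (hl t).eventually_lt_const ht.1
    rw [← empty_mem_iff_bot, inter_comm, nhdsWithin_inter', mem_inf_principal]
    filter_upwards [h1] with u hu hu'
    exact lt_asymm hu hu'.2
  have hB : ∀ q, (B q).Countable := fun q => by
    refine (countable_setOfPred_isolated_left_within (s := B q)).mono ?_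
    intro t ht
    refine ⟨ht, ?_⟩
    have h1 : ∀ᶠ u in 𝓝[<] t, (q : ℝ) < x u := (hl t).eventually_const_lt ht.2
    rw [← empty_mem_iff_bot, inter_comm, nhdsWithin_inter', mem_inf_principal]
    filter_upwards [h1] with u hu hu'
    exact lt_asymm hu hu'.1
  have hc : (⋃ q, A q ∪ B q).Countable := countable_iUnion fun q => (hA q).union (hB q)
  filter_upwards [compl_mem_ae_iff.2 (hc.measure_zero volume)] with t ht
  have : l t = x t := by
    by_contra hne
    rcases lt_or_gt_of_ne hne with h | h
    · obtain ⟨q, h1, h2⟩ := exists_rat_btwn h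
      exact ht (mem_iUnion.2 ⟨q, Or.inl ⟨h1, h2⟩⟩)
    · obtain ⟨q, h1, h2⟩ := exists_rat_btwn h
      exact ht (mem_iUnion.2 ⟨q, Or.inr ⟨h1, h2⟩⟩)
  rw [← this]
  exact hl t

/-- A process with right-continuous paths has a jointly measurable modification. -/
theorem exists_measurable_modification {Ω : Type*} [MeasurableSpace Ω] {P : Measure Ω}
    {X : ℝ → Ω → ℝ} (hX : ∀ t, Measurable (X t))
    (hr : ∀ᵐ ω ∂P, ∀ t, ContinuousWithinAt (fun s => X s ω) (Ici t) t) :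
    ∃ X' : Ω × ℝ → ℝ, Measurable X' ∧ ∀ᵐ ω ∂P, ∀ t, X' (ω, t) = X t ω := by
  -- Grid points within 1/(n + 1) to the right of t, so right-continuity applies. For each n they
  -- range over a countable set, which gives joint measurability.
  let τ : ℕ → ℤ → ℝ := fun n k => ((k : ℝ) + 1) / ((n : ℝ) + 1)
  have hτ : ∀ t : ℝ, Tendsto (fun n : ℕ => τ n ⌊t * ((n : ℝ) + 1)⌋) atTop (𝓝[Ici t] t) := by
    intro t
    have hpos : ∀ n : ℕ, (0 : ℝ) < (n : ℝ) + 1 := fun n => by positivity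
    have hlow : ∀ n : ℕ, t ≤ τ n ⌊t * ((n : ℝ) + 1)⌋ := fun n => by
      rw [le_div_iff₀ (hpos n)]
      exact (Int.lt_floor_add_one _).le
    have hup : ∀ n : ℕ, τ n ⌊t * ((n : ℝ) + 1)⌋ ≤ t + 1 / ((n : ℝ) + 1) := fun n => by
      rw [div_le_iff₀ (hpos n), add_mul, one_div_mul_cancel (hpos n).ne']
      linarith [Int.floor_le (t * ((n : ℝ) + 1))]
    refine tendsto_nhdsWithin_iff.2 ⟨tendsto_of_tendsto_of_tendsto_of_le_of_le tendsto_const_nhds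
      ?_ hlow hup, Eventually.of_forall hlow⟩
    simpa using (tendsto_const_nhds (x := t)).add (tendsto_one_div_add_atTop_nhds_zero_nat (𝕜 := ℝ))
  refine ⟨fun p => limsup (fun n : ℕ => X (τ n ⌊p.2 * ((n : ℝ) + 1)⌋) p.1) atTop,
    Measurable.limsup fun n => ?_, ?_⟩
  · have h1 : Measurable fun p : Ω × ℤ => X (τ n p.2) p.1 :=
      measurable_from_prod_countable_left fun k => by
        exact hX (τ n k)
    have h2 : Measurable fun p : Ω × ℝ => (p.1, ⌊p.2 * ((n : ℝ) + 1)⌋) := by fun_prop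
    exact h1.comp h2
  · filter_upwards [hr] with ω hω t
    exact ((hω t).tendsto.comp (hτ t)).limsup_eq

/-! ### Sampled processes -/

/-- The `k`-th point of the partition of `[a, b]` into `n` intervals of equal length. -/
noncomputable def gridPoint (a b : ℝ) (n k : ℕ) : ℝ := a + (b - a) * ((min k n : ℕ) / n : ℝ)

theorem gridPoint_mono {a b : ℝ} (hab : a ≤ b) (n : ℕ) : Monotone (gridPoint a b n) := by
  intro k l hkl
  unfold gridPoint
  have : (0 : ℝ) ≤ b - a := sub_nonneg.2 hab
  gcongr

theorem gridPoint_mem {a b : ℝ} (hab : a ≤ b) (n k : ℕ) : gridPoint a b n k ∈ Icc a b := by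
  have h0 : (0 : ℝ) ≤ b - a := sub_nonneg.2 hab
  have h1 : ((min k n : ℕ) / n : ℝ) ≤ 1 :=
    div_le_one_of_le₀ (by exact_mod_cast min_le_right k n) (Nat.cast_nonneg _)
  have h2 : (0 : ℝ) ≤ ((min k n : ℕ) / n : ℝ) := by positivity
  unfold gridPoint
  constructor <;> nlinarith

theorem exists_gridPoint_lt {a b s : ℝ} (hs : s ∈ Ioc a b) {n : ℕ} (hn : 0 < n) :
    ∃ k < n, gridPoint a b n k < s ∧ s ≤ gridPoint a b n (k + 1) ∧
      s - (b - a) / n ≤ gridPoint a b n k := by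
  have hab : 0 < b - a := by linarith [hs.1, hs.2]
  have hn' : (0 : ℝ) < n := by exact_mod_cast hn
  -- The cells are open on the left and closed on the right, so the index is the ceiling minus one.
  obtain ⟨k, hk⟩ : ∃ k, ⌈(s - a) / (b - a) * n⌉₊ = k + 1 :=
    Nat.exists_eq_succ_of_ne_zero (Nat.ceil_pos.2 (by have := sub_pos.2 hs.1; positivity)).ne'
  have h1 : (k : ℝ) < (s - a) / (b - a) * n := Nat.lt_ceil.1 (by omega)
  have h2 : (s - a) / (b - a) * n ≤ (k : ℝ) + 1 := by exact_mod_cast Nat.ceil_le.1 hk.le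
  have h3 : (s - a) / (b - a) ≤ 1 := (div_le_one hab).2 (by linarith [hs.2])
  have hkn : k < n := by
    have : (k : ℝ) < n := h1.trans_le (by nlinarith)
    exact_mod_cast this
  have e1 : gridPoint a b n k = a + (b - a) * (k / n) := by
    rw [gridPoint, min_eq_left hkn.le]
  have e2 : gridPoint a b n (k + 1) = a + (b - a) * ((k + 1) / n) := by
    rw [gridPoint, min_eq_left (Nat.succ_le_of_lt hkn)]; push_cast; rfl
  have e3 : s = a + (b - a) * ((s - a) / (b - a) * n / n) := by
    field_simp; ring
  refine ⟨k, hkn, ?_, ?_, ?_⟩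
  · rw [e1, e3]; gcongr
  · rw [e2, e3]; gcongr
  · have : s ≤ a + (b - a) * ((k + 1) / n) := by rw [e3]; gcongr
    rw [e1]
    have e4 : (b - a) * ((k + 1) / n) = (b - a) * (k / n) + (b - a) / n := by ring
    linarith

section Sampling

variable {Ω : Type*} [mΩ : MeasurableSpace Ω] {P : Measure Ω} {𝒢 : ℝ → MeasurableSpace Ω}
  {W : ℝ → Ω → ℝ} {a b : ℝ}

/-- The simple process obtained by sampling `H` at the points of the regular partition. -/
noncomputable def sampled (hab : a ≤ b) (n : ℕ) (H : ℝ → Ω → ℝ) (hH : ∀ t, Measurable[𝒢 t] (H t))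
    (hH2 : ∀ t, MemLp (H t) 2 P) : SimpleProcess P 𝒢 a b where
  N := n
  time := gridPoint a b n
  time_mono := gridPoint_mono hab n
  time_mem := gridPoint_mem hab n
  coeff k := H (gridPoint a b n k)
  adapted _ := hH _
  memLp _ := hH2 _

theorem SimpleProcess.val_eq (φ : SimpleProcess P 𝒢 a b) {k : ℕ} (hk : k < φ.N) {s : ℝ}
    (h1 : φ.time k < s) (h2 : s ≤ φ.time (k + 1)) (ω : Ω) : φ.val s ω = φ.coeff k ω := by
  unfold SimpleProcess.val
  rw [Finset.sum_eq_single k, if_pos ⟨h1, h2⟩]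
  · intro l _ hlk
    refine if_neg fun h => ?_
    rcases lt_or_gt_of_ne hlk with h' | h'
    · exact absurd (h.2.trans (φ.time_mono (Nat.succ_le_of_lt h'))) (not_le.2 h1)
    · exact absurd (h2.trans (φ.time_mono (Nat.succ_le_of_lt h'))) (not_le.2 h.1)
  · intro h
    exact absurd (Finset.mem_range.2 hk) h

/-- The sampling time τ is found before `H`, so two processes sampled on the same grid are compared
at the same instant. -/
theorem exists_sampled_val_eq (hab : a ≤ b) {s : ℝ} (hs : s ∈ Ioc a b) {n : ℕ} (hn : 0 < n) :
    ∃ τ ∈ Ico a s, s - (b - a) / n ≤ τ ∧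
      ∀ (H : ℝ → Ω → ℝ) (hH : ∀ t, Measurable[𝒢 t] (H t)) (hH2 : ∀ t, MemLp (H t) 2 P) (ω : Ω),
        (sampled hab n H hH hH2).val s ω = H τ ω := by
  obtain ⟨k, hk, h1, h2, h3⟩ := exists_gridPoint_lt hs hn
  exact ⟨_, ⟨(gridPoint_mem hab n k).1, h1⟩, h3, fun H hH hH2 ω =>
    (sampled hab n H hH hH2).val_eq hk h1 h2 ω⟩

theorem SimpleProcess.measurable_val (φ : SimpleProcess P 𝒢 a b) (h𝒢 : ∀ t, 𝒢 t ≤ mΩ) :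
    Measurable fun z : Ω × ℝ => φ.val z.2 z.1 := by
  unfold SimpleProcess.val
  refine Finset.measurable_fun_sum _ fun k _ => Measurable.ite ?_ ?_ measurable_const
  · exact (measurableSet_lt measurable_const measurable_snd).inter
      (measurableSet_le measurable_snd measurable_const)
  · exact ((φ.adapted k).mono (h𝒢 _) le_rfl).comp measurable_fst

end Sampling

/-! ### The Itô integral -/

theorem tendsto_eLpNorm_two {α : Type*} [MeasurableSpace α] {μ : Measure α} {f : ℕ → α → ℝ}
    (h : Tendsto (fun n => ∫⁻ x, ‖f n x‖ₑ ^ 2 ∂μ) atTop (𝓝 0)) :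
    Tendsto (fun n => eLpNorm (f n) 2 μ) atTop (𝓝 0) := by
  rw [ENNReal.tendsto_nhds_zero] at h ⊢
  intro ε hε
  filter_upwards [h (ε ^ 2) (ENNReal.pow_pos hε 2)] with n hn
  rw [← eLpNorm_two_sq] at hn
  exact (ENNReal.pow_le_pow_left_iff two_ne_zero).1 hn

section Ito

variable {Ω : Type*} [mΩ : MeasurableSpace Ω] {P : Measure Ω}
  {𝒢 : ℝ → MeasurableSpace Ω} {W : ℝ → Ω → ℝ} {a b : ℝ} {H : ℝ → Ω → ℝ} {H' : Ω × ℝ → ℝ}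

/-- The jointly measurable version `H'` turns the iterated integral of the definition into an L²
norm on the product space. -/
theorem SimpleProcess.lintegral_val_sub (φ : SimpleProcess P 𝒢 a b) (h𝒢 : ∀ t, 𝒢 t ≤ mΩ)
    (hm : Measurable H') (hH : ∀ᵐ ω ∂P, ∀ t, H' (ω, t) = H t ω) :
    ∫⁻ ω, (∫⁻ s in Ioc a b, ‖φ.val s ω - H s ω‖ₑ ^ 2) ∂P
      = eLpNorm (fun z => φ.val z.2 z.1 - H' z) 2 (P.prod (volume.restrict (Ioc a b))) ^ 2 := by
  have hm' : Measurable fun z : Ω × ℝ => ‖φ.val z.2 z.1 - H' z‖ₑ ^ 2 :=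
    ((φ.measurable_val h𝒢).sub hm).enorm.pow_const 2
  rw [eLpNorm_two_sq, lintegral_prod _ hm'.aemeasurable]
  refine lintegral_congr_ae ?_
  filter_upwards [hH] with ω hω
  simp only [hω]

theorem HasBrownianIncrements.eLpNorm_integral_sub (h : HasBrownianIncrements P 𝒢 W)
    (φ ψ : SimpleProcess P 𝒢 a b) :
    eLpNorm (fun ω => φ.integral W ω - ψ.integral W ω) 2 P
      = eLpNorm (fun z => φ.val z.2 z.1 - ψ.val z.2 z.1) 2
        (P.prod (volume.restrict (Ioc a b))) := by
  refine (ENNReal.pow_right_strictMono two_ne_zero).injective ?_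
  rw [eLpNorm_two_sq, eLpNorm_two_sq, h.isometry_sub, lintegral_prod]
  exact (((φ.measurable_val h.le).sub (ψ.measurable_val h.le)).enorm.pow_const 2).aemeasurable

theorem HasBrownianIncrements.eLpNorm_integral_sub_le (h : HasBrownianIncrements P 𝒢 W)
    (hm : Measurable H') (φ ψ : SimpleProcess P 𝒢 a b) :
    eLpNorm (fun ω => φ.integral W ω - ψ.integral W ω) 2 P
      ≤ eLpNorm (fun z => φ.val z.2 z.1 - H' z) 2 (P.prod (volume.restrict (Ioc a b)))
        + eLpNorm (fun z => ψ.val z.2 z.1 - H' z) 2 (P.prod (volume.restrict (Ioc a b))) := by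
  rw [h.eLpNorm_integral_sub]
  have := eLpNorm_sub_le (p := 2) (μ := P.prod (volume.restrict (Ioc a b)))
    ((φ.measurable_val h.le).sub hm).aestronglyMeasurable
    ((ψ.measurable_val h.le).sub hm).aestronglyMeasurable (by norm_num)
  refine le_trans (le_of_eq ?_) this
  congr 1
  ext z
  simp only [Pi.sub_apply]
  ring

/-- By the isometry, integrals of simple processes approaching `H'` form a Cauchy sequence in L²(P).
-/
theorem HasBrownianIncrements.exists_isItoIntegral (h : HasBrownianIncrements P 𝒢 W)
    (hm : Measurable H') (hH : ∀ᵐ ω ∂P, ∀ t, H' (ω, t) = H t ω)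
    (happ : ∀ ε : ℝ≥0∞, 0 < ε → ∃ φ : SimpleProcess P 𝒢 a b,
      eLpNorm (fun z => φ.val z.2 z.1 - H' z) 2 (P.prod (volume.restrict (Ioc a b))) < ε) :
    ∃ I, IsItoIntegral P 𝒢 W H a b I := by
  choose φ hφ using fun n : ℕ => happ (n : ℝ≥0∞)⁻¹ (ENNReal.inv_pos.2 (ENNReal.natCast_ne_top n))
  have hlim : Tendsto (fun n => eLpNorm (fun z => (φ n).val z.2 z.1 - H' z) 2
      (P.prod (volume.restrict (Ioc a b)))) atTop (𝓝 0) :=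
    tendsto_of_tendsto_of_tendsto_of_le_of_le tendsto_const_nhds
      ENNReal.tendsto_inv_nat_nhds_zero (fun _ => zero_le) fun n => (hφ n).le
  obtain ⟨I, hI, hconv⟩ := exists_tendsto_eLpNorm_of_cauchy (P := P) (p := 2)
    (f := fun n => (φ n).integral W) (by norm_num) (fun n => h.memLp_simple_integral (φ n))
    fun ε hε => by
      obtain ⟨N, hN⟩ := eventually_atTop.1 (hlim.eventually_lt_const (ENNReal.half_pos hε.ne'))
      refine ⟨N, fun m hm' n hn => (h.eLpNorm_integral_sub_le hm (φ m) (φ n)).trans_lt ?_⟩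
      rw [← ENNReal.add_halves ε]
      exact ENNReal.add_lt_add (hN m hm') (hN n hn)
  refine ⟨I, hI, φ, ?_, hconv⟩
  simp_rw [(φ _).lintegral_val_sub h.le hm hH]
  simpa using ENNReal.Tendsto.pow (n := 2) hlim

/-- The isometry passed to the limit. It bounds the distance from any version `I` to the integral of
any simple process, whatever sequence defined `I`. -/
theorem IsItoIntegral.eLpNorm_sub_le {I : Ω → ℝ} (hI : IsItoIntegral P 𝒢 W H a b I)
    (h : HasBrownianIncrements P 𝒢 W) (hm : Measurable H')
    (hH : ∀ᵐ ω ∂P, ∀ t, H' (ω, t) = H t ω) (ψ : SimpleProcess P 𝒢 a b) :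
    eLpNorm (fun ω => ψ.integral W ω - I ω) 2 P
      ≤ eLpNorm (fun z => ψ.val z.2 z.1 - H' z) 2 (P.prod (volume.restrict (Ioc a b))) := by
  obtain ⟨hI2, φ, hφ, hconv⟩ := hI
  simp_rw [(φ _).lintegral_val_sub h.le hm hH, eLpNorm_two_sq] at hφ
  have hlim := (tendsto_eLpNorm_two hφ).const_add
    (eLpNorm (fun z => ψ.val z.2 z.1 - H' z) 2 (P.prod (volume.restrict (Ioc a b))))
  have hsum := hlim.add hconv
  rw [add_zero, add_zero] at hsum
  refine ge_of_tendsto' hsum fun n => ?_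
  have := eLpNorm_add_le (p := 2)
    ((h.memLp_simple_integral ψ).sub (h.memLp_simple_integral (φ n))).1
    ((h.memLp_simple_integral (φ n)).sub hI2).1 (by norm_num)
  rw [sub_add_sub_cancel] at this
  exact this.trans (add_le_add_left (h.eLpNorm_integral_sub_le hm ψ (φ n)) _)

end Ito

/-! ### Approximation of the square root of a càdlàg process -/

/-- For y ≤ x, √x ≤ √y + √(x - y), also for negative y, whose root is 0. This converts L¹ control of
X into L² control of √X. -/
theorem sq_sqrt_sub_sqrt_le (x y : ℝ) : (√x - √y) ^ 2 ≤ |x - y| := by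
  wlog h : y ≤ x generalizing x y
  · have := this y x (le_of_not_ge h)
    rwa [abs_sub_comm, ← neg_sub, neg_sq] at this
  have h1 : √x ≤ √y + √(x - y) := by
    rw [Real.sqrt_le_iff]
    refine ⟨by positivity, ?_⟩
    have h2 : y ≤ √y ^ 2 := by
      rcases le_total 0 y with hy | hy
      · rw [Real.sq_sqrt hy]
      · exact hy.trans (sq_nonneg _)
    have h3 := Real.sq_sqrt (sub_nonneg.2 h)
    have h4 : 0 ≤ √y * √(x - y) := by positivity
    nlinarith
  rw [abs_of_nonneg (sub_nonneg.2 h)]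
  calc (√x - √y) ^ 2 ≤ √(x - y) ^ 2 :=
        pow_le_pow_left₀ (sub_nonneg.2 (Real.sqrt_le_sqrt h)) (by linarith) 2
    _ = x - y := Real.sq_sqrt (sub_nonneg.2 h)

/-- The square root, capped at `√M`. -/
noncomputable def cutSqrt (M : ℕ) (x : ℝ) : ℝ := √(min x M)

theorem continuous_cutSqrt (M : ℕ) : Continuous (cutSqrt M) := by
  unfold cutSqrt; fun_prop

theorem abs_cutSqrt_le (M : ℕ) (x : ℝ) : |cutSqrt M x| ≤ √M := by
  rw [cutSqrt, abs_of_nonneg (Real.sqrt_nonneg _)]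
  exact Real.sqrt_le_sqrt (min_le_right _ _)

theorem cutSqrt_zero (M : ℕ) : cutSqrt M 0 = 0 := by
  simp [cutSqrt]

theorem enorm_sq_le_of_sq_le {x y : ℝ} (h : x ^ 2 ≤ |y|) : ‖x‖ₑ ^ 2 ≤ ‖y‖ₑ := by
  rw [← enorm_pow, Real.enorm_eq_ofReal_abs, Real.enorm_eq_ofReal_abs, abs_of_nonneg (sq_nonneg x)]
  exact ENNReal.ofReal_le_ofReal h

/-- Capping at M is 1-Lipschitz, so the Hölder bound of the root survives uniformly in M. -/
theorem enorm_cutSqrt_sub_sq_le (M : ℕ) (x y : ℝ) :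
    ‖cutSqrt M x - cutSqrt M y‖ₑ ^ 2 ≤ ‖x - y‖ₑ :=
  enorm_sq_le_of_sq_le ((sq_sqrt_sub_sqrt_le _ _).trans
    ((abs_min_sub_min_le_max x M y M).trans (by simp)))

theorem enorm_cutSqrt_sub_sqrt_sq_le (M : ℕ) (x : ℝ) : ‖cutSqrt M x - √x‖ₑ ^ 2 ≤ ‖x‖ₑ := by
  refine enorm_sq_le_of_sq_le ((sq_sqrt_sub_sqrt_le _ _).trans ?_)
  have hM : (0 : ℝ) ≤ M := Nat.cast_nonneg M
  rcases le_total x M with h | h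
  · simp [min_eq_left h]
  · rw [min_eq_right h, abs_sub_comm, abs_of_nonneg (sub_nonneg.2 h), abs_of_nonneg (hM.trans h)]
    linarith

section Approx

variable {Ω : Type*} [mΩ : MeasurableSpace Ω] {P : Measure Ω}
  {𝒢 : ℝ → MeasurableSpace Ω} {W : ℝ → Ω → ℝ} {a b : ℝ} {X : ℝ → Ω → ℝ} {X' : Ω × ℝ → ℝ}

theorem tendsto_cutSqrt (hm : Measurable X')
    (hint : ∫⁻ z, ‖X' z‖ₑ ∂(P.prod (volume.restrict (Ioc a b))) ≠ ∞) :
    Tendsto (fun M => eLpNorm (fun z => cutSqrt M (X' z) - √(X' z)) 2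
        (P.prod (volume.restrict (Ioc a b)))) atTop (𝓝 0) := by
  refine tendsto_eLpNorm_two ?_
  have := tendsto_lintegral_of_dominated_convergence
    (μ := P.prod (volume.restrict (Ioc a b)))
    (F := fun M z => ‖cutSqrt M (X' z) - √(X' z)‖ₑ ^ 2)
    (f := fun _ => 0) (fun z => ‖X' z‖ₑ)
    (fun M => (((continuous_cutSqrt M).measurable.comp hm).sub hm.sqrt).enorm.pow_const 2)
    (fun M => ae_of_all _ fun z => enorm_cutSqrt_sub_sqrt_sq_le M _) hint
    (ae_of_all _ fun z => ?_)
  · simpa using this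
  · refine tendsto_const_nhds.congr' ?_
    filter_upwards [eventually_ge_atTop ⌈X' z⌉₊] with M hM
    rw [cutSqrt, min_eq_left (Nat.ceil_le.1 hM)]
    simp

variable [IsProbabilityMeasure P]

theorem memLp_cutSqrt (M : ℕ) {f : Ω → ℝ} (hf : Measurable f) :
    MemLp (fun ω => cutSqrt M (f ω)) 2 P :=
  MemLp.of_bound ((continuous_cutSqrt M).measurable.comp hf).aestronglyMeasurable (√M)
    (ae_of_all _ fun _ => abs_cutSqrt_le M _)

/-- The capped square root of `X`, sampled at `n` points. -/
noncomputable def sampledSqrt (P : Measure Ω) [IsProbabilityMeasure P] (h𝒢 : ∀ t, 𝒢 t ≤ mΩ)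
    (hab : a ≤ b) (n M : ℕ) (X : ℝ → Ω → ℝ) (hX : ∀ t, Measurable[𝒢 t] (X t)) :
    SimpleProcess P 𝒢 a b :=
  sampled hab n (fun t ω => cutSqrt M (X t ω))
    (fun t => (continuous_cutSqrt M).measurable.comp (hX t))
    fun t => memLp_cutSqrt M ((hX t).mono (h𝒢 t) le_rfl)

/-- The sampling times approach s strictly from the left, and a càdlàg path agrees with its left
limit at almost every s. The cap supplies a constant dominating function; `n + 1` avoids the empty
partition. -/
theorem tendsto_sampledSqrt (h𝒢 : ∀ t, 𝒢 t ≤ mΩ) (hab : a ≤ b)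
    (hX : ∀ t, Measurable[𝒢 t] (X t)) (hm : Measurable X')
    (hX' : ∀ᵐ ω ∂P, ∀ t, X' (ω, t) = X t ω) (hc : ∀ᵐ ω ∂P, IsCadlag fun t => X t ω) (M : ℕ) :
    Tendsto (fun n => eLpNorm (fun z =>
      (sampledSqrt P h𝒢 hab (n + 1) M X hX).val z.2 z.1 - cutSqrt M (X' z)) 2
        (P.prod (volume.restrict (Ioc a b)))) atTop (𝓝 0) := by
  set ρ := P.prod (volume.restrict (Ioc a b)) with hρ
  have hval : ∀ n, Measurable fun z : Ω × ℝ => (sampledSqrt P h𝒢 hab (n + 1) M X hX).val z.2 z.1 :=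
    fun n => SimpleProcess.measurable_val _ h𝒢
  have hcut : Measurable fun z => cutSqrt M (X' z) := (continuous_cutSqrt M).measurable.comp hm
  have hmem : ∀ᵐ z ∂ρ, z.2 ∈ Ioc a b := by
    rw [Measure.ae_prod_iff_ae_ae (measurable_snd measurableSet_Ioc)]
    exact ae_of_all _ fun _ => ae_restrict_mem measurableSet_Ioc
  have hlim : ∀ᵐ z ∂ρ, Tendsto (fun n => (sampledSqrt P h𝒢 hab (n + 1) M X hX).val z.2 z.1) atTop
      (𝓝 (cutSqrt M (X' z))) := by
    rw [Measure.ae_prod_iff_ae_ae (measurableSet_tendsto_fun hval hcut)]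
    filter_upwards [hX', hc] with ω h1 h2
    filter_upwards [ae_restrict_of_ae h2.ae_tendsto_left, ae_restrict_mem measurableSet_Ioc]
      with s h3 hs
    choose τ hτ hτ' hv using fun n : ℕ =>
      exists_sampled_val_eq (P := P) (𝒢 := 𝒢) hab hs (Nat.succ_pos n)
    have e : ∀ n, (sampledSqrt P h𝒢 hab (n + 1) M X hX).val s ω = cutSqrt M (X (τ n) ω) :=
      fun n => hv n _ _ _ ω
    simp only [e, h1]
    have hτlim : Tendsto τ atTop (𝓝[<] s) := by
      refine tendsto_nhdsWithin_iff.2 ⟨?_, Eventually.of_forall fun n => (hτ n).2⟩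
      refine tendsto_of_tendsto_of_tendsto_of_le_of_le ?_ tendsto_const_nhds hτ'
        fun n => (hτ n).2.le
      have := (tendsto_const_div_atTop_nhds_zero_nat (b - a)).comp (tendsto_add_atTop_nat 1)
      simpa using (tendsto_const_nhds (x := s)).sub this
    exact ((continuous_cutSqrt M).tendsto _).comp (h3.comp hτlim)
  refine tendsto_eLpNorm_two ?_
  have := tendsto_lintegral_of_dominated_convergence (μ := ρ)
    (F := fun n z => ‖(sampledSqrt P h𝒢 hab (n + 1) M X hX).val z.2 z.1 - cutSqrt M (X' z)‖ₑ ^ 2)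
    (f := fun _ => 0) (fun _ => ENNReal.ofReal (√M + √M) ^ 2)
    (fun n => ((hval n).sub hcut).enorm.pow_const 2) (fun n => ?_) ?_ ?_
  · simpa using this
  · filter_upwards [hmem] with z hz
    obtain ⟨τ, _, _, hv⟩ := exists_sampled_val_eq (P := P) (𝒢 := 𝒢) hab hz (Nat.succ_pos n)
    have e : (sampledSqrt P h𝒢 hab (n + 1) M X hX).val z.2 z.1 = cutSqrt M (X τ z.1) :=
      hv _ _ _ _
    rw [e, Real.enorm_eq_ofReal_abs]
    gcongr
    exact (abs_sub _ _).trans (add_le_add (abs_cutSqrt_le M _) (abs_cutSqrt_le M _))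
  · rw [lintegral_const]
    exact ENNReal.mul_ne_top (by simp) (measure_ne_top _ _)
  · filter_upwards [hlim] with z hz
    have h1 := (hz.sub_const (cutSqrt M (X' z))).enorm
    simpa using ENNReal.Tendsto.pow (n := 2) h1

theorem exists_sampledSqrt_lt (h𝒢 : ∀ t, 𝒢 t ≤ mΩ) (hab : a ≤ b)
    (hX : ∀ t, Measurable[𝒢 t] (X t)) (hm : Measurable X')
    (hX' : ∀ᵐ ω ∂P, ∀ t, X' (ω, t) = X t ω) (hc : ∀ᵐ ω ∂P, IsCadlag fun t => X t ω)
    (hint : ∫⁻ z, ‖X' z‖ₑ ∂(P.prod (volume.restrict (Ioc a b))) ≠ ∞) {ε : ℝ≥0∞} (hε : 0 < ε) :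
    ∃ n M : ℕ, 0 < n ∧ eLpNorm (fun z =>
      (sampledSqrt P h𝒢 hab n M X hX).val z.2 z.1 - √(X' z)) 2
        (P.prod (volume.restrict (Ioc a b))) < ε := by
  obtain ⟨M, hM⟩ := ((tendsto_cutSqrt hm hint).eventually_lt_const
    (ENNReal.half_pos hε.ne')).exists
  obtain ⟨n, hn⟩ := ((tendsto_sampledSqrt h𝒢 hab hX hm hX' hc M).eventually_lt_const
    (ENNReal.half_pos hε.ne')).exists
  refine ⟨n + 1, M, n.succ_pos, ?_⟩
  have hcut : Measurable fun z => cutSqrt M (X' z) := (continuous_cutSqrt M).measurable.comp hm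
  have := eLpNorm_add_le (p := 2) (μ := P.prod (volume.restrict (Ioc a b)))
    (((sampledSqrt P h𝒢 hab (n + 1) M X hX).measurable_val h𝒢).sub hcut).aestronglyMeasurable
    (hcut.sub hm.sqrt).aestronglyMeasurable (by norm_num)
  refine lt_of_le_of_lt (le_trans (le_of_eq ?_) this)
    ((ENNReal.add_lt_add hn hM).trans_eq (ENNReal.add_halves ε))
  congr 1
  ext z
  simp only [Pi.add_apply, Pi.sub_apply]
  ring

end Approx

/-! ### Measurable approximations of the Itô integral -/

section Measurability

variable {Ω : Type*} {m : MeasurableSpace Ω} [mΩ : MeasurableSpace Ω] {P : Measure Ω}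
  {𝒢 : ℝ → MeasurableSpace Ω} {W : ℝ → Ω → ℝ} {a b : ℝ} {H : ℝ → Ω → ℝ}

theorem HasBrownianIncrements.measurable_integral (h : HasBrownianIncrements P 𝒢 W)
    (φ : SimpleProcess P 𝒢 a b) : Measurable[𝒢 b] (φ.integral W) := by
  refine Finset.measurable_fun_sum _ fun k _ => Measurable.mul ?_ ?_
  · exact (φ.adapted k).mono (h.mono (φ.time_mem k).2) le_rfl
  · exact h.measurable (φ.time_mono k.le_succ) (φ.time_mem _).2

theorem IsItoIntegral.exists_ae_eq_measurable {I : Ω → ℝ} (hI : IsItoIntegral P 𝒢 W H a b I)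
    (h : HasBrownianIncrements P 𝒢 W) : ∃ J : Ω → ℝ, Measurable[𝒢 b] J ∧ I =ᵐ[P] J := by
  obtain ⟨hI2, φ, -, hconv⟩ := hI
  have ht : TendstoInMeasure P (fun n => (φ n).integral W) atTop I :=
    tendstoInMeasure_of_tendsto_eLpNorm (p := 2) (by norm_num)
      (fun n => (h.memLp_simple_integral (φ n)).1) hI2.1 hconv
  obtain ⟨ns, _, hns⟩ := ht.exists_seq_tendsto_ae'
  refine ⟨fun ω => limsup (fun n => (φ (ns n)).integral W ω) atTop,
    Measurable.limsup fun n => h.measurable_integral _, ?_⟩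
  filter_upwards [hns] with ω hω
  exact hω.limsup_eq.symm

/-- After the isometry and an exchange of integrals, only the difference of `H` and `K` at a common
grid time remains. A bound at each fixed time suffices, without path regularity and uniformly in the
mesh. -/
theorem HasBrownianIncrements.eLpNorm_sampled_sub_sq_le [SFinite P]
    (h : HasBrownianIncrements P 𝒢 W) (hab : a ≤ b) {n : ℕ} (hn : 0 < n) {H K : ℝ → Ω → ℝ}
    (hH : ∀ t, Measurable[𝒢 t] (H t)) (hH2 : ∀ t, MemLp (H t) 2 P)
    (hK : ∀ t, Measurable[𝒢 t] (K t)) (hK2 : ∀ t, MemLp (K t) 2 P) {c : ℝ≥0∞}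
    (hc : ∀ t ∈ Icc a b, ∫⁻ ω, ‖H t ω - K t ω‖ₑ ^ 2 ∂P ≤ c) :
    eLpNorm (fun ω => (sampled hab n H hH hH2).integral W ω
      - (sampled hab n K hK hK2).integral W ω) 2 P ^ 2 ≤ c * ENNReal.ofReal (b - a) := by
  have hm : Measurable (Function.uncurry fun (ω : Ω) (s : ℝ) =>
      ‖(sampled (P := P) hab n H hH hH2).val s ω - (sampled (P := P) hab n K hK hK2).val s ω‖ₑ ^ 2) :=
    ((SimpleProcess.measurable_val _ h.le).sub
      (SimpleProcess.measurable_val _ h.le)).enorm.pow_const 2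
  rw [eLpNorm_two_sq, h.isometry_sub, lintegral_lintegral_swap hm.aemeasurable]
  refine (setLIntegral_mono measurable_const fun s hs => ?_).trans_eq
    (by rw [setLIntegral_const, Real.volume_Ioc])
  obtain ⟨τ, hτ, _, hv⟩ := exists_sampled_val_eq (P := P) (𝒢 := 𝒢) hab hs hn
  simp only [hv]
  exact hc τ ⟨hτ.1, hτ.2.le.trans hs.2⟩

/-- V is the integral of the capped root of Z on a grid. The grid is fine enough for the same
construction with X to be ε-close to `I`; replacing X by Z then costs δ on any grid and for any cap.
-/
theorem IsItoIntegral.exists_measurable_approx [IsProbabilityMeasure P]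
    (h : HasBrownianIncrements P 𝒢 W) (hab : a ≤ b) {X Z : ℝ → Ω → ℝ}
    (hX : ∀ t, Measurable[𝒢 t] (X t)) (hc : ∀ᵐ ω ∂P, IsCadlag fun t => X t ω)
    {X' : Ω × ℝ → ℝ} (hm : Measurable X') (hX' : ∀ᵐ ω ∂P, ∀ t, X' (ω, t) = X t ω)
    (hint : ∫⁻ z, ‖X' z‖ₑ ∂(P.prod (volume.restrict (Ioc a b))) ≠ ∞)
    (hZ : ∀ t, Measurable[𝒢 t] (Z t))
    (hZm : ∀ n M, Measurable[m] ((sampledSqrt P h.le hab n M Z hZ).integral W)) {c δ : ℝ≥0∞}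
    (hXZ : ∀ t ∈ Icc a b, ∫⁻ ω, ‖X t ω - Z t ω‖ₑ ∂P ≤ c)
    (hδ : c * ENNReal.ofReal (b - a) ≤ δ ^ 2) {I : Ω → ℝ}
    (hI : IsItoIntegral P 𝒢 W (fun t ω => √(X t ω)) a b I) {ε : ℝ≥0∞} (hε : 0 < ε) :
    ∃ V, Measurable[m] V ∧ ∫⁻ ω, ‖I ω - V ω‖ₑ ∂P ≤ δ + ε := by
  obtain ⟨n, M, hn, hnM⟩ := exists_sampledSqrt_lt h.le hab hX hm hX' hc hint hε
  set φ := sampledSqrt P h.le hab n M X hX with hφ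
  set ψ := sampledSqrt P h.le hab n M Z hZ with hψ
  have h1 : eLpNorm (fun ω => φ.integral W ω - I ω) 2 P ≤ ε :=
    (hI.eLpNorm_sub_le h hm.sqrt (hX'.mono fun ω hω t => by rw [hω]) φ).trans hnM.le
  have h2 : eLpNorm (fun ω => φ.integral W ω - ψ.integral W ω) 2 P ≤ δ := by
    rw [← ENNReal.pow_le_pow_left_iff two_ne_zero]
    refine le_trans ?_ hδ
    refine h.eLpNorm_sampled_sub_sq_le hab hn _ _ _ _ fun t ht => le_trans ?_ (hXZ t ht)
    exact lintegral_mono fun ω => enorm_cutSqrt_sub_sq_le M _ _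
  refine ⟨_, hZm n M, ?_⟩
  have h3 := MeasureTheory.eLpNorm_sub_le (p := 2) ((h.memLp_simple_integral φ).sub (h.memLp_simple_integral ψ)).1
    ((h.memLp_simple_integral φ).sub hI.1).1 (by norm_num)
  rw [sub_sub_sub_cancel_left] at h3
  rw [← eLpNorm_one_eq_lintegral_enorm]
  exact (eLpNorm_le_eLpNorm_of_exponent_le (by norm_num)
    (hI.1.sub (h.memLp_simple_integral ψ)).1).trans (h3.trans (add_le_add h2 h1))

end Measurability

/-! ### Covariance bounds -/

section Covariance

/-- The Lipschitz hypothesis bounds the set of quotients, so that `sSup` is a genuine supremum. -/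
theorem abs_sub_le_lipConst {v : ℕ} {G : (Fin v → ℝ) → ℝ} (hG : IsLipschitzSum G)
    (x y : Fin v → ℝ) : |G x - G y| ≤ lipConst G * ∑ i, ‖x i - y i‖ := by
  obtain ⟨K, hK⟩ := hG
  have hpos : ∀ x y : Fin v → ℝ, x ≠ y → 0 < ∑ i, ‖x i - y i‖ := fun x y hxy => by
    obtain ⟨i, hi⟩ := Function.ne_iff.1 hxy
    exact Finset.sum_pos' (fun _ _ => norm_nonneg _)
      ⟨i, Finset.mem_univ i, norm_pos_iff.2 (sub_ne_zero.2 hi)⟩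
  rcases eq_or_ne x y with rfl | hxy
  · simp
  · rw [← div_le_iff₀ (hpos x y hxy)]
    refine le_csSup ⟨K, ?_⟩ ⟨x, y, hxy, rfl⟩
    rintro q ⟨x, y, hxy, rfl⟩
    rw [div_le_iff₀ (hpos x y hxy)]
    exact hK x y

theorem lipConst_nonneg {v : ℕ} (G : (Fin v → ℝ) → ℝ) : 0 ≤ lipConst G := by
  refine Real.sSup_nonneg ?_
  rintro q ⟨x, y, -, rfl⟩
  positivity

theorem IsLipschitzSum.continuous {v : ℕ} {G : (Fin v → ℝ) → ℝ} (hG : IsLipschitzSum G) :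
    Continuous G := by
  rw [continuous_iff_continuousAt]
  intro x
  rw [ContinuousAt, tendsto_iff_dist_tendsto_zero]
  have hlim : Tendsto (fun y : Fin v → ℝ => lipConst G * ∑ i, ‖y i - x i‖) (𝓝 x) (𝓝 0) := by
    have : Continuous fun y : Fin v → ℝ => lipConst G * ∑ i, ‖y i - x i‖ := by fun_prop
    simpa using this.tendsto x
  exact squeeze_zero (fun _ => dist_nonneg) (fun y => abs_sub_le_lipConst hG y x) hlim

theorem abs_le_supNorm {α : Type*} {F : α → ℝ} (hF : ∀ x, |F x| ≤ 1) (x : α) :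
    |F x| ≤ supNorm F :=
  le_ciSup (f := fun x => |F x|) ⟨1, by rintro _ ⟨y, rfl⟩; exact hF y⟩ x

variable {Ω : Type*} {m₁ m₂ : MeasurableSpace Ω} [mΩ : MeasurableSpace Ω] {P : Measure Ω}
  [IsProbabilityMeasure P]

theorem abs_cov_le_of_abs_le {U D : Ω → ℝ} {K : ℝ} (hU : AEMeasurable U P)
    (hUK : ∀ ω, |U ω| ≤ K) (hD : MemLp D 2 P) :
    |cov[U, D; P]| ≤ 2 * K * ∫ ω, |D ω| ∂P := by
  have hU2 : MemLp U 2 P := MemLp.of_bound hU.aestronglyMeasurable K (ae_of_all _ hUK)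
  rw [covariance_eq_sub hU2 hD]
  have hDi : Integrable D P := hD.integrable (by norm_num)
  have h0 : 0 ≤ ∫ ω, |D ω| ∂P := integral_nonneg fun _ => abs_nonneg _
  have h1 : |∫ ω, (U * D) ω ∂P| ≤ K * ∫ ω, |D ω| ∂P := by
    rw [← integral_const_mul]
    refine (abs_integral_le_integral_abs).trans
      (integral_mono (hU2.integrable_mul hD).abs (hDi.abs.const_mul K) fun ω => ?_)
    simp only [Pi.mul_apply, abs_mul]
    exact mul_le_mul_of_nonneg_right (hUK ω) (abs_nonneg _)
  have h2 : |∫ ω, U ω ∂P| ≤ K := by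
    have := norm_integral_le_of_norm_le_const (μ := P) (f := U) (C := K) (ae_of_all _ hUK)
    simpa using this
  have h3 : |∫ ω, D ω ∂P| ≤ ∫ ω, |D ω| ∂P := abs_integral_le_integral_abs
  calc |∫ ω, (U * D) ω ∂P - (∫ ω, U ω ∂P) * ∫ ω, D ω ∂P|
      ≤ |∫ ω, (U * D) ω ∂P| + |(∫ ω, U ω ∂P) * ∫ ω, D ω ∂P| := abs_sub _ _
    _ ≤ K * (∫ ω, |D ω| ∂P) + K * ∫ ω, |D ω| ∂P := by
        rw [abs_mul]
        exact add_le_add h1 (mul_le_mul h2 h3 (abs_nonneg _) ((abs_nonneg _).trans h2))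
    _ = 2 * K * ∫ ω, |D ω| ∂P := by ring

/-- Covariance of a function of the past with a Lipschitz function of variables which are, up to an
`L¹` error, functions of an independent future. -/
theorem abs_cov_le_of_indep_approx (hm₁ : m₁ ≤ mΩ) (hm₂ : m₂ ≤ mΩ)
    (hind : Indep m₁ m₂ P) {U U' : Ω → ℝ} {K : ℝ} (hU' : Measurable[m₁] U') (hUU' : U =ᵐ[P] U')
    (hUK : ∀ ω, |U ω| ≤ K) {v : ℕ} {V : Fin v → Ω → ℝ} (hV : ∀ j, AEMeasurable (V j) P)
    {G : (Fin v → ℝ) → ℝ} (hG1 : ∀ x, |G x| ≤ 1) (hG : IsLipschitzSum G) {β : ℝ} (hβ : 0 ≤ β)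
    (happ : ∀ ε : ℝ, 0 < ε → ∀ j, ∃ V' : Ω → ℝ, Measurable[m₂] V' ∧
      ∫⁻ ω, ‖V j ω - V' ω‖ₑ ∂P ≤ ENNReal.ofReal (β + ε)) :
    |cov[U, fun ω => G (fun j => V j ω); P]| ≤ 2 * K * (v * lipConst G) * β := by
  have hK : 0 ≤ K := by
    obtain ⟨ω⟩ : Nonempty Ω := P.nonempty_of_neZero
    exact (abs_nonneg _).trans (hUK ω)
  have hL := lipConst_nonneg G
  have hUm : AEMeasurable U P := ⟨U', hU'.mono hm₁ le_rfl, hUU'⟩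
  have hU2 : MemLp U 2 P := MemLp.of_bound hUm.aestronglyMeasurable K (ae_of_all _ hUK)
  have key : ∀ ε : ℝ, 0 < ε → |cov[U, fun ω => G (fun j => V j ω); P]|
      ≤ 2 * K * (v * lipConst G) * (β + ε) := by
    intro ε hε
    choose V' hV'm hV' using happ ε hε
    have hGV : MemLp (fun ω => G (fun j => V j ω)) 2 P :=
      MemLp.of_bound (hG.continuous.measurable.comp_aemeasurable
        (aemeasurable_pi_lambda _ hV)).aestronglyMeasurable 1 (ae_of_all _ fun _ => hG1 _)
    have hGm : Measurable[m₂] fun ω => G (fun j => V' j ω) :=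
      by
      have : Measurable[m₂] fun ω (j : Fin v) => V' j ω := @measurable_pi_iff _ _ _ m₂ _ _ |>.2 hV'm
      exact hG.continuous.measurable.comp this
    have hGV' : MemLp (fun ω => G (fun j => V' j ω)) 2 P :=
      MemLp.of_bound (hGm.mono hm₂ le_rfl).aestronglyMeasurable 1 (ae_of_all _ fun _ => hG1 _)
    have hi : IndepFun U (fun ω => G (fun j => V' j ω)) P := by
      have : IndepFun U' (fun ω => G (fun j => V' j ω)) P := by
        rw [IndepFun_iff_Indep]
        exact indep_of_indep_of_le hind hU'.comap_le hGm.comap_le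
      exact this.congr hUU'.symm (EventuallyEq.refl _ _)
    -- Subtracting G(V'), which is independent of `U`, leaves the covariance unchanged.
    have hsplit : cov[U, fun ω => G (fun j => V j ω); P]
        = cov[U, (fun ω => G (fun j => V j ω)) - fun ω => G (fun j => V' j ω); P] := by
      rw [covariance_sub_right hU2 hGV hGV', hi.covariance_eq_zero hU2 hGV', sub_zero]
    rw [hsplit]
    have hVi : ∀ j, Integrable (fun ω => V j ω - V' j ω) P := fun j =>
      ⟨((hV j).sub ((hV'm j).mono hm₂ le_rfl).aemeasurable).aestronglyMeasurable,
        (hV' j).trans_lt ENNReal.ofReal_lt_top⟩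
    have hVb : ∀ j, ∫ ω, |V j ω - V' j ω| ∂P ≤ β + ε := fun j => by
      have := integral_norm_eq_lintegral_enorm (hVi j).1
      simp only [Real.norm_eq_abs] at this
      rw [this]
      exact ENNReal.toReal_le_of_le_ofReal (by positivity) (hV' j)
    refine (abs_cov_le_of_abs_le hUm hUK (hGV.sub hGV')).trans ?_
    have hD : ∫ ω, |((fun ω => G (fun j => V j ω)) - fun ω => G (fun j => V' j ω)) ω| ∂P
        ≤ lipConst G * (v * (β + ε)) := by
      calc _ ≤ ∫ ω, lipConst G * ∑ j, |V j ω - V' j ω| ∂P := by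
            refine integral_mono ((hGV.sub hGV').integrable (by norm_num)).abs
              ((integrable_finsetSum _ fun j _ => (hVi j).abs).const_mul _) fun ω => ?_
            exact abs_sub_le_lipConst hG _ _
        _ = lipConst G * ∑ j, ∫ ω, |V j ω - V' j ω| ∂P := by
            rw [integral_const_mul, integral_finsetSum _ fun j _ => (hVi j).abs]
        _ ≤ lipConst G * ∑ _j : Fin v, (β + ε) := by
            gcongr with j
            exact hVb j
        _ = lipConst G * (v * (β + ε)) := by
            rw [Finset.sum_const, Finset.card_univ, Fintype.card_fin, nsmul_eq_mul]
    calc _ ≤ 2 * K * (lipConst G * (v * (β + ε))) := by gcongr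
      _ = _ := by ring
  refine le_of_forall_pos_le_add fun η hη => ?_
  set A := 2 * K * (v * lipConst G) with hA
  have hA0 : 0 ≤ A := by positivity
  -- Let ε tend to 0; the `+ 1` covers A = 0.
  refine (key (η / (A + 1)) (by positivity)).trans ?_
  rw [mul_add]
  gcongr
  rw [mul_div_assoc', div_le_iff₀ (by positivity)]
  nlinarith

end Covariance

/-! ### The return process -/

section Returns

variable {S Ω : Type*} [MeasurableSpace S] [mΩ : MeasurableSpace Ω] {P : Measure Ω}
  [IsProbabilityMeasure P] {π : Measure S} [IsProbabilityMeasure π]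
  {Λ : Set (S × ℝ) → Ω → ℝ} {W : ℝ → Ω → ℝ} {γ : ℝ} {ν : Measure ℝ} {f : S × ℝ≥0 → ℝ}
  {X : ℝ → Ω → ℝ} {a b : ℝ}

theorem momentConst_mul_levyMass_ne_top (γ : ℝ) (ν : Measure ℝ) :
    momentConst * ENNReal.ofReal (levyMass γ ν) ≠ ∞ :=
  ENNReal.mul_ne_top momentConst_ne_top ENNReal.ofReal_ne_top

theorem measurable_sampledSqrt_integral {T : ℝ} (hTa : T ≤ a) (hab : a ≤ b)
    (h𝒢 : ∀ t, filtr P Λ W t ≤ mΩ) (n M : ℕ) {Z : ℝ → Ω → ℝ}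
    (hZ : ∀ t, Measurable[filtr P Λ W t] (Z t)) (hZT : ∀ t, Measurable[futureSigma Λ W T] (Z t)) :
    Measurable[futureSigma Λ W T] ((sampledSqrt P h𝒢 hab n M Z hZ).integral W) := by
  refine Finset.measurable_fun_sum _ fun k _ => Measurable.mul ?_ ?_
  · exact (continuous_cutSqrt M).measurable.comp (hZT _)
  · exact measurable_increment_futureSigma (hTa.trans (gridPoint_mem hab n k).1)
      (gridPoint_mono hab n k.le_succ)

/-- The volatility on `[a, b]` is close to an adapted process driven by the noise after time `T`. -/
theorem AssumptionH.exists_future_volatility (hH : AssumptionH P π Λ W γ ν f X)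
    (hf : Integrable f (π.prod lebesguePos)) {T r : ℝ} (hTa : T ≤ a) (hr : r ≤ a - T) :
    ∃ Z : ℝ → Ω → ℝ, (∀ t, Measurable[filtr P Λ W t] (Z t)) ∧
      (∀ t, Measurable[futureSigma Λ W T] (Z t)) ∧ ∀ t ∈ Icc a b,
        ∫⁻ ω, ‖X t ω - Z t ω‖ₑ ∂P
          ≤ momentConst * ENNReal.ofReal (levyMass γ ν) * kernelTail π f r := by
  -- A process must be defined at every time, so Z_t = 0 before T, where no estimate is claimed.
  have key : ∀ t, ∃ Z : Ω → ℝ, Measurable[filtr P Λ W t] Z ∧ Measurable[futureSigma Λ W T] Z ∧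
      (T ≤ t → ∫⁻ ω, ‖X t ω - Z ω‖ₑ ∂P
        ≤ momentConst * ENNReal.ofReal (levyMass γ ν) * kernelTail π f (t - T)) := by
    intro t
    by_cases hTt : T ≤ t
    · obtain ⟨Z, h1, h2, h3⟩ := exists_truncated_mma hH.basis (W := W)
        (momentConst_mul_levyMass_ne_top γ ν)
        (fun B hB => hH.quadruple.lintegral_enorm_le hH.basis hH.finiteMean hB)
        hH.kernel_measurable hf hH.mma hTt
      exact ⟨Z, h2.mono le_eventuallyMeasurableSpace le_rfl, h1, fun _ => h3⟩
    · exact ⟨0, measurable_const, measurable_const, fun h => absurd h hTt⟩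
  choose Z h1 h2 h3 using key
  refine ⟨Z, h1, h2, fun t ht => (h3 t (hTa.trans ht.1)).trans ?_⟩
  gcongr
  exact kernelTail_antitone π f (by linarith [ht.1])

variable [P.IsComplete]

theorem AssumptionH.exists_modification (hH : AssumptionH P π Λ W γ ν f X)
    (hf : Integrable f (π.prod lebesguePos)) (hW : IsBrownianLine P W) (a b : ℝ) :
    ∃ X' : Ω × ℝ → ℝ, Measurable X' ∧ (∀ᵐ ω ∂P, ∀ t, X' (ω, t) = X t ω) ∧
      ∫⁻ z, ‖X' z‖ₑ ∂(P.prod (volume.restrict (Ioc a b))) ≠ ∞ := by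
  obtain ⟨X', hm, hX'⟩ := exists_measurable_modification
    (fun t => (hH.adapted t).mono (filtr_le hH.basis hW t) le_rfl)
    (hH.cadlag.mono fun ω h t => (h t).1)
  refine ⟨X', hm, hX', ne_of_lt ?_⟩
  rw [lintegral_prod_symm _ hm.enorm.aemeasurable]
  have hfin : momentConst * ENNReal.ofReal (levyMass γ ν) * kernelTail π f 0 < ∞ :=
    ENNReal.mul_lt_top (momentConst_mul_levyMass_ne_top γ ν).lt_top
      (kernelTail_zero_lt_top hH.kernel_measurable hf)
  refine lt_of_le_of_lt (lintegral_mono fun s => ?_)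
    (b := ∫⁻ _ in Ioc a b, momentConst * ENNReal.ofReal (levyMass γ ν) * kernelTail π f 0) ?_
  · rw [lintegral_congr_ae (g := fun ω => ‖X s ω‖ₑ) (hX'.mono fun ω h => by simp only [h s])]
    exact lintegral_mma_le hH.basis (momentConst_mul_levyMass_ne_top γ ν)
      (fun B hB => hH.quadruple.lintegral_enorm_le hH.basis hH.finiteMean hB)
      hH.kernel_measurable hf hH.mma s
  · rw [setLIntegral_const, Real.volume_Ioc]
    exact ENNReal.mul_lt_top hfin ENNReal.ofReal_lt_top

theorem AssumptionH.exists_isItoIntegral (hH : AssumptionH P π Λ W γ ν f X)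
    (hf : Integrable f (π.prod lebesguePos)) (hW : IsBrownianLine P W)
    (hind : Indep (processSigma W) (basisSigma Λ) P) (hab : a ≤ b) :
    ∃ I, IsItoIntegral P (filtr P Λ W) W (fun s ω => √(X s ω)) a b I := by
  obtain ⟨X', hm, hX', hint⟩ := hH.exists_modification hf hW a b
  have h := hW.hasBrownianIncrements hH.basis hind
  refine h.exists_isItoIntegral hm.sqrt (hX'.mono fun ω hω t => by rw [hω]) fun ε hε => ?_
  obtain ⟨n, M, -, hnM⟩ := exists_sampledSqrt_lt h.le hab hH.adapted hm hX' hH.cadlag hint hε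
  exact ⟨_, hnM⟩

/-- If the window starts after T, truncate the volatility at T. If it starts before T, then r ≤ 0
and V = 0 is close enough: E|X_t| is bounded by the full kernel mass, which is at most `kernelTail π
f r`. -/
theorem AssumptionH.exists_future_approx (hH : AssumptionH P π Λ W γ ν f X)
    (hf : Integrable f (π.prod lebesguePos)) (hW : IsBrownianLine P W)
    (hind : Indep (processSigma W) (basisSigma Λ) P) (hab : a ≤ b) {T r : ℝ}
    (hr : r ≤ max (a - T) 0) {I : Ω → ℝ}
    (hI : IsItoIntegral P (filtr P Λ W) W (fun s ω => √(X s ω)) a b I) {δ ε : ℝ≥0∞}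
    (hδ : momentConst * ENNReal.ofReal (levyMass γ ν) * kernelTail π f r * ENNReal.ofReal (b - a)
      ≤ δ ^ 2) (hε : 0 < ε) :
    ∃ V, Measurable[futureSigma Λ W T] V ∧ ∫⁻ ω, ‖I ω - V ω‖ₑ ∂P ≤ δ + ε := by
  obtain ⟨X', hm, hX', hint⟩ := hH.exists_modification hf hW a b
  have h := hW.hasBrownianIncrements hH.basis hind
  rcases le_or_gt T a with hTa | hTa
  · rw [max_eq_left (sub_nonneg.2 hTa)] at hr
    obtain ⟨Z, h1, h2, h3⟩ := hH.exists_future_volatility (b := b) hf hTa hr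
    exact hI.exists_measurable_approx h hab hH.adapted hH.cadlag hm hX' hint h1
      (fun n M => measurable_sampledSqrt_integral hTa hab h.le n M h1 h2) h3 hδ hε
  · rw [max_eq_right (by linarith)] at hr
    refine hI.exists_measurable_approx h hab (Z := fun _ _ => 0) hH.adapted hH.cadlag hm hX' hint
      (fun t => measurable_const) (fun n M => ?_) (fun t _ => ?_) hδ hε
    · have : (sampledSqrt P h.le hab n M (fun _ _ => 0) fun t => measurable_const).integral W
          = fun _ => 0 := by
        ext ω
        simp [SimpleProcess.integral, sampledSqrt, sampled, cutSqrt_zero]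
      rw [this]
      exact measurable_const
    · simp only [sub_zero]
      refine (lintegral_mma_le hH.basis (momentConst_mul_levyMass_ne_top γ ν)
        (fun B hB => hH.quadruple.lintegral_enorm_le hH.basis hH.finiteMean hB)
        hH.kernel_measurable hf hH.mma t).trans ?_
      gcongr
      exact kernelTail_antitone π f hr

theorem thetaX_nonneg (π : Measure S) (γ : ℝ) (ν : Measure ℝ) (f : S × ℝ≥0 → ℝ) (r : ℝ) :
    0 ≤ thetaX π γ ν f r := by
  unfold thetaX; positivity

theorem tendsto_thetaX (hf : Measurable f) (hf0 : ∀ p, 0 ≤ f p)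
    (hfi : Integrable f (π.prod lebesguePos)) (γ : ℝ) (ν : Measure ℝ) :
    Tendsto (thetaX π γ ν f) atTop (𝓝 0) := by
  have h1 : Tendsto (fun r => ENNReal.ofReal (levyMass γ ν) * kernelTail π f r) atTop (𝓝 0) := by
    simpa using ENNReal.Tendsto.const_mul (tendsto_kernelTail hf hfi)
      (Or.inr ENNReal.ofReal_ne_top)
  have h2 := (ENNReal.tendsto_toReal ENNReal.zero_ne_top).comp h1
  rw [ENNReal.toReal_zero] at h2
  refine h2.congr' ?_
  filter_upwards [eventually_ge_atTop 0] with r hr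
  rw [Function.comp_apply, ← ofReal_thetaX hf hf0 hfi γ ν hr,
    ENNReal.toReal_ofReal (thetaX_nonneg π γ ν f r)]

theorem AssumptionH.isThetaWeaklyDependent (hH : AssumptionH P π Λ W γ ν f X)
    (hf : Integrable f (π.prod lebesguePos)) (hW : IsBrownianLine P W)
    (hind : Indep (processSigma W) (basisSigma Λ) P) {Δ : ℝ} (hΔ : 0 < Δ) {Y : ℝ → Ω → ℝ}
    (hY : ∀ t, IsItoIntegral P (filtr P Λ W) W (fun s ω => √(X s ω)) ((t - 1) * Δ) (t * Δ) (Y t)) :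
    IsThetaWeaklyDependent P Y
      fun r => √(Δ * thetaX π γ ν f (max ((r : ℝ) - 1) 0 * Δ)) := by
  have h := hW.hasBrownianIncrements hH.basis hind
  constructor
  · have h1 : Tendsto (fun r : ℝ≥0 => max ((r : ℝ) - 1) 0 * Δ) atTop atTop := by
      refine Tendsto.atTop_mul_const hΔ (tendsto_atTop_mono (fun r => le_max_left _ _) ?_)
      exact tendsto_atTop_add_const_right _ (-1) (NNReal.tendsto_coe_atTop.2 tendsto_id)
    have h2 := ((tendsto_thetaX hH.kernel_measurable hH.kernel_nonneg hf γ ν).comp h1).const_mul Δ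
    have h3 := (Real.continuous_sqrt.tendsto _).comp h2
    rw [mul_zero, Real.sqrt_zero] at h3
    exact h3
  -- The 2 comes from the covariance bound, the root from taking the first-moment constant through
  -- the isometry.
  refine ⟨2 * √momentConst.toReal, fun u v hu hv r i j hi hj hij F G hF hF1 hG1 hG => ?_⟩
  set ρ : ℝ := max ((r : ℝ) - 1) 0 * Δ with hρ
  have hρ0 : 0 ≤ ρ := by positivity
  -- The last past index; T = i_l Δ separates past from future.
  set l : Fin u := ⟨u - 1, by omega⟩ with hl
  have hil : ∀ k, i k ≤ i l := fun k => hi (Fin.le_def.2 (by have := k.2; simp only [hl]; omega))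
  choose J hJm hJ using fun k => (hY (i k)).exists_ae_eq_measurable h
  have hJm' : Measurable[filtr P Λ W (i l * Δ)] fun ω (k : Fin u) => J k ω := by
    refine @measurable_pi_iff _ _ _ (filtr P Λ W (i l * Δ)) _ _ |>.2 fun k => ?_
    exact (hJm k).mono (filtr_mono (mul_le_mul_of_nonneg_right (hil k) hΔ.le)) le_rfl
  have hUJ : (fun ω => F fun k => Y (i k) ω) =ᵐ[P] fun ω => F fun k => J k ω := by
    filter_upwards [ae_all_iff.2 hJ] with ω hω
    simp only [hω]
  have hθ0 := thetaX_nonneg π γ ν f ρ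
  -- The window has length Δ, and κ times the tail is θ_X(ρ), so δ² = C Δ θ_X(ρ).
  have hδ : ∀ k, momentConst * ENNReal.ofReal (levyMass γ ν) * kernelTail π f ρ
      * ENNReal.ofReal (j k * Δ - (j k - 1) * Δ)
      ≤ ENNReal.ofReal (√momentConst.toReal * √(Δ * thetaX π γ ν f ρ)) ^ 2 := fun k => by
    have e : j k * Δ - (j k - 1) * Δ = Δ := by ring
    rw [e, mul_assoc momentConst, ← ofReal_thetaX hH.kernel_measurable hH.kernel_nonneg hf γ ν hρ0,
      ← ENNReal.ofReal_pow (by positivity), mul_pow, Real.sq_sqrt ENNReal.toReal_nonneg,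
      Real.sq_sqrt (by positivity), ENNReal.ofReal_mul ENNReal.toReal_nonneg,
      ENNReal.ofReal_toReal momentConst_ne_top, mul_comm Δ, ENNReal.ofReal_mul hθ0, mul_assoc]
  have := abs_cov_le_of_indep_approx (filtr_le hH.basis hW (i l * Δ))
    (futureSigma_le hH.basis hW (i l * Δ)) (indep_filtr_futureSigma hH.basis hW hind (i l * Δ))
    (hF.comp hJm') hUJ (fun ω => abs_le_supNorm hF1 _) (V := fun k => Y (j k))
    (fun k => (hY (j k)).1.1.aemeasurable) hG1 hG
    (β := √momentConst.toReal * √(Δ * thetaX π γ ν f ρ)) (by positivity) fun ε hε k => by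
      rw [ENNReal.ofReal_add (by positivity) hε.le]
      refine hH.exists_future_approx hf hW hind (by nlinarith) (r := ρ) ?_ (hY (j k)) (hδ k)
        (ENNReal.ofReal_pos.2 hε)
      rw [hρ, max_mul_of_nonneg _ _ hΔ.le, zero_mul]
      refine max_le_max ?_ le_rfl
      have := hij l k
      nlinarith
  refine this.trans_eq ?_
  ring

end Returns

end MMASV

theorem mainTheorem7
    {S Ω : Type*} [TopologicalSpace S] [MeasurableSpace S] [BorelSpace S] [MeasurableSpace Ω]
    (P : Measure Ω) [IsProbabilityMeasure P] [P.IsComplete]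
    (π : Measure S) [IsProbabilityMeasure π]
    (Λ : Set (S × ℝ) → Ω → ℝ) (W : ℝ → Ω → ℝ) (γ : ℝ) (ν : Measure ℝ)
    (f : S × ℝ≥0 → ℝ) (X : ℝ → Ω → ℝ) (Δ : ℝ) (hΔ : 0 < Δ)
    (hW : MMASV.IsBrownianLine P W)
    (hind : Indep (MMASV.processSigma W) (MMASV.basisSigma Λ) P)
    (hH : MMASV.AssumptionH P π Λ W γ ν f X)
    (hf : Integrable f (π.prod MMASV.lebesguePos)) :
    (∀ t : ℝ, ∃ I : Ω → ℝ, MMASV.IsItoIntegral P (MMASV.filtr P Λ W) W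
      (fun s ω => √(X s ω)) ((t - 1) * Δ) (t * Δ) I) ∧
    ∀ Y : ℝ → Ω → ℝ,
      (∀ t : ℝ, MMASV.IsItoIntegral P (MMASV.filtr P Λ W) W
        (fun s ω => √(X s ω)) ((t - 1) * Δ) (t * Δ) (Y t)) →
      ∃ θY : ℝ≥0 → ℝ,
        (∀ r : ℝ≥0, 1 ≤ r → θY r = √(Δ * MMASV.thetaX π γ ν f ((r - 1) * Δ))) ∧
        MMASV.IsThetaWeaklyDependent P Y θY := by
  refine ⟨fun t => hH.exists_isItoIntegral hf hW hind (by nlinarith), fun Y hY => ?_⟩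
  -- For r < 1 the windows may overlap, and the coefficient is frozen at its value √(Δ θ_X(0)) at r
  -- = 1.
  refine ⟨fun r => √(Δ * MMASV.thetaX π γ ν f (max ((r : ℝ) - 1) 0 * Δ)), fun r hr => ?_,
    hH.isThetaWeaklyDependent hf hW hind hΔ hY⟩
  have hr' : (1 : ℝ) ≤ r := by exact_mod_cast hr
  simp only [max_eq_left (sub_nonneg.2 hr')]
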